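/- Let $SET\subseteq SET'$ be universes, let $V$ be a $SET$-small (not necessarily symmetric) monoidal category with unit $I$, let $V^{\mathrm{rev}}$ be its reverse, and let $\hat V=[V^{\mathrm{op}},SET]$ with the Day convolution monoidal structure. **Graded categories.** A *huge left $V$-graded category* $A$ is a $SET'$-small $[V^{\mathrm{op}},SET']$-category for Day convolution. Concretely: it has a $SET'$-small set of objects; $SET'$-small sets $A(X;a,b)$ of graded morphisms from $a$ to $b$ of grade $X\in V$; reindexing functions $\alpha^*:A(X;a,b)\to A(Y;a,b)$, functorial in $\alpha:Y\to X$; composition $(g,f)\mapsto g\circ f$, $A(Y;b,c)\times A(X;a,b)\to A(Y\otimes X;a,c)$, natural in $X,Y$; and identities in $A(I;a,a)$; composition is associative and unital up to reindexing along the constraints of $V$. Graded functors preserve all this structure; graded-natural transformations $F\Rightarrow G$ are families $\theta_a$ of grade $I$ with $\theta_b\circ F(f)=G(f)\circ\theta_a$ after reindexing along the unitors to the grade of $f$. *Right* $V$-graded means left $V^{\mathrm{rev}}$-graded, and $V$-$W$-*bigraded* means left $(V\times W^{\mathrm{rev}})$-graded. Write ${}_V\mathrm{GCAT}'$, $\mathrm{GCAT}'_V$,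 ${}_V\mathrm{GCAT}'_V$ for the 2-categories of huge left $V$-graded, right $V$-graded and $V$-$V$-bigraded categories. The formal opposite $A^\circ$ of a right (resp. left) $V$-graded category is left (resp. right) $V$-graded, with $A^\circ(X;a,b)=A(X;b,a)$. $\hat V$ is a $V$-$V$-bigraded category in which a graded morphism $P\to Q$ of grade $(X,X')$ is a natural transformation $P\Rightarrow Q(X\otimes-\otimes X')$. A bigraded category has an underlying left and an underlying right graded category, consisting of the graded morphisms of grades $(X,I)$ and $(I,X')$. **Graded bifunctors.** For $A$ left $V$-graded, $B$ right $V$-graded and $C$ $V$-$V$-bigraded, a graded bifunctor $F:A,B\to C$ consists of left graded functors $F(-,b)$ and right graded functors $F(a,-)$ agreeing on objects and such that, for $f\in A(X;a,a')$ and $g\in B(X';b,b')$, the composites $F(f,b')\circ F(a,g)$ and $F(a',g)\circ F(f,b)$ agree after reindexing along the unitors to the grade $(X,X')$. With the families of morphisms of grade $(I,I)$ that are left graded-natural in $a$ and right graded-natural in $b$, these form a category ${}_V\mathrm{GBIF}_V(A,B;C)$. The bigraded product $A\boxtimes B$ has as objects pairs $(a,b)$, and graded morphisms of grade $(X,X')$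 are pairs consisting of a graded morphism of $A$ of grade $X$ and one of $B$ of grade $X'$. **Modules.** For huge right $V$-graded categories $A,B$ (so that $A(a,a')=A(-;a,a')$ and $B(b,b')$ are presheaves on $V$), a $V$-graded module ($\hat V$-profunctor) $M:A\to B$ consists of objects $M(b,a)\in\hat V$ with actions $\lambda:B(b,b')\otimes M(b',a)\to M(b,a)$ and $\rho:M(b,a')\otimes A(a',a)\to M(b,a)$ (for Day convolution of presheaves) that are associative and unital and commute with each other; transformations are families of morphisms of $\hat V$ commuting with the actions. These form a category $\mathrm{GMOD}_V(A,B)$, contravariant in $A$ and $B$ on 1-cells, $M\mapsto M(G,F)$ for graded functors $F:A'\to A$, $G:B'\to B$, while $\varphi:F\Rightarrow F'$ and $\psi:G'\Rightarrow G$ induce $M(\psi,\varphi):M(G,F)\Rightarrow M(G',F')$. For huge left $V$-graded categories, ${}_V\mathrm{GMOD}(A,B)$ is defined in the same way over the reverse of the Day convolution structure. **Theorem.** There are isomorphisms of categories $$\mathrm{GMOD}_V(A,B)\;\cong\;{}_V\mathrm{GBIF}_V(B^\circ,A;\hat V)\qquad\text{2-natural in } A,B\in\mathrm{GCAT}'_V,$$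 $${}_V\mathrm{GMOD}(A,B)\;\cong\;{}_V\mathrm{GBIF}_V(A,B^\circ;\hat V)\qquad\text{2-natural in } A,B\in{}_V\mathrm{GCAT}'.$$ Consequently there are also isomorphisms of categories $$\mathrm{GMOD}_V(A,B)\;\cong\;{}_V\mathrm{GCAT}'_V(B^\circ\boxtimes A,\hat V),\qquad {}_V\mathrm{GMOD}(A,B)\;\cong\;{}_V\mathrm{GCAT}'_V(A\boxtimes B^\circ,\hat V),$$ 2-natural in $A,B\in\mathrm{GCAT}'_V$ and in $A,B\in{}_V\mathrm{GCAT}'$ respectively. -/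

import Mathlib

universe o o' o'' h h' w t v u v' u' p q p' q'

set_option linter.all false
set_option linter.checkUnivs false

noncomputable section

open CategoryTheory MonoidalCategory Opposite MonoidalOpposite
open scoped DayFunctor CategoryTheory.Prod

namespace VGraded

/-! ### Graded categories, graded functors, graded-natural transformations -/

/-- A (left) `V`-graded category, given concretely by graded morphisms: `Hom X A B` is the set of
graded morphisms from `A` to `B` with grade `X`, and `reindex α f` is `α^*(f)`. -/
structure GradedCat (V : Type u) [Category.{v} V] [MonoidalCategory V] where
  Obj : Type o
  Hom : V → Obj → Obj → Type h
  reindex : ∀ {X Y : V} (_ : Y ⟶ X) {A B : Obj}, Hom X A B → Hom Y A B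
  /-- `comp g f` is the composite `g ∘ f`. -/
  comp : ∀ {X Y : V} {A B C : Obj}, Hom Y B C → Hom X A B → Hom (Y ⊗ X) A C
  ident : ∀ A : Obj, Hom (𝟙_ V) A A
  reindex_id : ∀ {X : V} {A B : Obj} (f : Hom X A B), reindex (𝟙 X) f = f
  reindex_comp : ∀ {X Y Z : V} (α : Z ⟶ Y) (β : Y ⟶ X) {A B : Obj} (f : Hom X A B),
    reindex (α ≫ β) f = reindex α (reindex β f)
  comp_natural : ∀ {X X' Y Y' : V} (α : X' ⟶ X) (β : Y' ⟶ Y) {A B C : Obj}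
    (g : Hom Y B C) (f : Hom X A B),
    comp (reindex β g) (reindex α f) = reindex (β ⊗ₘ α) (comp g f)
  assoc : ∀ {X Y Z : V} {A B C D : Obj} (k : Hom Z C D) (g : Hom Y B C) (f : Hom X A B),
    comp (comp k g) f = reindex (α_ Z Y X).hom (comp k (comp g f))
  comp_ident : ∀ {X : V} {A B : Obj} (f : Hom X A B), comp f (ident A) = reindex (ρ_ X).hom f
  ident_comp : ∀ {X : V} {A B : Obj} (f : Hom X A B), comp (ident B) f = reindex (λ_ X).hom f

section Basic

variable {V : Type u} [Category.{v} V] [MonoidalCategory V]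

namespace GradedCat

variable (C : GradedCat.{o, h} V)

theorem comp_reindex {X X' Y : V} (α : X' ⟶ X) {A B D : C.Obj}
    (g : C.Hom Y B D) (f : C.Hom X A B) :
    C.comp g (C.reindex α f) = C.reindex (Y ◁ α) (C.comp g f) := by
  simpa [C.reindex_id] using C.comp_natural α (𝟙 Y) g f

theorem reindex_comp_left {X Y Y' : V} (β : Y' ⟶ Y) {A B D : C.Obj}
    (g : C.Hom Y B D) (f : C.Hom X A B) :
    C.comp (C.reindex β g) f = C.reindex (β ▷ X) (C.comp g f) := by
  simpa [C.reindex_id] using C.comp_natural (𝟙 X) β g f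

theorem reindex_reindex {X Y Z : V} (α : Z ⟶ Y) (β : Y ⟶ X) {A B : C.Obj} (f : C.Hom X A B) :
    C.reindex α (C.reindex β f) = C.reindex (α ≫ β) f := (C.reindex_comp α β f).symm

/-- Composition in the underlying ordinary category `C₀`, whose morphisms are the graded
morphisms of grade `I`. -/
def comp₀ {A B D : C.Obj} (g : C.Hom (𝟙_ V) B D) (f : C.Hom (𝟙_ V) A B) : C.Hom (𝟙_ V) A D :=
  C.reindex (λ_ (𝟙_ V)).inv (C.comp g f)

theorem comp₀_ident {A B : C.Obj} (f : C.Hom (𝟙_ V) A B) : C.comp₀ f (C.ident A) = f := by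
  rw [comp₀, C.comp_ident, C.reindex_reindex, ← unitors_equal]
  simp [C.reindex_id]

theorem ident_comp₀ {A B : C.Obj} (f : C.Hom (𝟙_ V) A B) : C.comp₀ (C.ident B) f = f := by
  rw [comp₀, C.ident_comp, C.reindex_reindex]
  simp [C.reindex_id]

theorem comp₀_assoc {A B D E : C.Obj} (k : C.Hom (𝟙_ V) D E) (g : C.Hom (𝟙_ V) B D)
    (f : C.Hom (𝟙_ V) A B) : C.comp₀ (C.comp₀ k g) f = C.comp₀ k (C.comp₀ g f) := by
  simp only [comp₀, C.comp_reindex, C.reindex_comp_left, C.assoc, C.reindex_reindex]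
  congr 1
  monoidal

end GradedCat

/-- The assignment `map` on graded morphisms (lying over `obj` on objects) preserves reindexing,
composition, and identities. -/
structure IsGradedFunctor (C : GradedCat.{o, h} V) (D : GradedCat.{o', h'} V) (obj : C.Obj → D.Obj)
    (map : ∀ {X : V} {A B : C.Obj}, C.Hom X A B → D.Hom X (obj A) (obj B)) : Prop where
  map_reindex : ∀ {X Y : V} (α : Y ⟶ X) {A B : C.Obj} (f : C.Hom X A B),
    map (C.reindex α f) = D.reindex α (map f)
  map_comp : ∀ {X Y : V} {A B E : C.Obj} (g : C.Hom Y B E) (f : C.Hom X A B),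
    map (C.comp g f) = D.comp (map g) (map f)
  map_ident : ∀ A : C.Obj, map (C.ident A) = D.ident (obj A)

/-- Left `V`-graded functors. -/
structure GradedFunctor (C : GradedCat.{o, h} V) (D : GradedCat.{o', h'} V) where
  obj : C.Obj → D.Obj
  map : ∀ {X : V} {A B : C.Obj}, C.Hom X A B → D.Hom X (obj A) (obj B)
  isGraded : IsGradedFunctor C D obj map

/-- A family of morphisms in `D₀` is left `V`-graded natural with respect to the two given
assignments on graded morphisms. -/
def IsGradedNatural (C : GradedCat.{o, h} V) (D : GradedCat.{o', h'} V) {obj obj' : C.Obj → D.Obj}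
    (map : ∀ {X : V} {A B : C.Obj}, C.Hom X A B → D.Hom X (obj A) (obj B))
    (map' : ∀ {X : V} {A B : C.Obj}, C.Hom X A B → D.Hom X (obj' A) (obj' B))
    (app : ∀ A : C.Obj, D.Hom (𝟙_ V) (obj A) (obj' A)) : Prop :=
  ∀ {X : V} {A B : C.Obj} (f : C.Hom X A B),
    D.reindex (λ_ X).inv (D.comp (app B) (map f)) = D.reindex (ρ_ X).inv (D.comp (map' f) (app A))

/-- Left `V`-graded-natural transformations. -/
@[ext]
structure GradedNat {C : GradedCat.{o, h} V} {D : GradedCat.{o', h'} V}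
    (F G : GradedFunctor C D) where
  app : ∀ A : C.Obj, D.Hom (𝟙_ V) (F.obj A) (G.obj A)
  natural : IsGradedNatural C D F.map G.map app

theorem IsGradedFunctor.isGradedNatural_ident {C : GradedCat.{o, h} V} {D : GradedCat.{o', h'} V}
    {obj : C.Obj → D.Obj}
    {map : ∀ {X : V} {A B : C.Obj}, C.Hom X A B → D.Hom X (obj A) (obj B)} :
    IsGradedNatural C D map map (fun A => D.ident (obj A)) := by
  intro X A B f
  simp [D.ident_comp, D.comp_ident, D.reindex_reindex]

theorem IsGradedNatural.comp {C : GradedCat.{o, h} V} {D : GradedCat.{o', h'} V}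
    {obj obj' obj'' : C.Obj → D.Obj}
    {map : ∀ {X : V} {A B : C.Obj}, C.Hom X A B → D.Hom X (obj A) (obj B)}
    {map' : ∀ {X : V} {A B : C.Obj}, C.Hom X A B → D.Hom X (obj' A) (obj' B)}
    {map'' : ∀ {X : V} {A B : C.Obj}, C.Hom X A B → D.Hom X (obj'' A) (obj'' B)}
    {a : ∀ A : C.Obj, D.Hom (𝟙_ V) (obj A) (obj' A)}
    {b : ∀ A : C.Obj, D.Hom (𝟙_ V) (obj' A) (obj'' A)}
    (hb : IsGradedNatural C D map' map'' b) (ha : IsGradedNatural C D map map' a) :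
    IsGradedNatural C D map map'' (fun A => D.comp₀ (b A) (a A)) := by
  intro X A B f
  have h1 := congrArg (fun z => D.reindex (λ_ X).inv (D.comp (b B) z)) (ha f)
  have h2 := congrArg (fun z => D.reindex (ρ_ X).inv (D.comp z (a A))) (hb f)
  simp only [GradedCat.comp₀, D.comp_reindex, D.reindex_comp_left, D.assoc,
    D.reindex_reindex] at h1 h2 ⊢
  calc _ = _ := ?_
    _ = _ := h1
    _ = _ := ?_
    _ = _ := h2
    _ = _ := ?_
  all_goals
    congr 1
    monoidal

/-- The category of graded functors `C → D` and graded-natural transformations, i.e. the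
hom-category of the 2-category of graded categories. -/
instance (C : GradedCat.{o, h} V) (D : GradedCat.{o', h'} V) : Category (GradedFunctor C D) where
  Hom F G := GradedNat F G
  id F := ⟨fun A => D.ident (F.obj A), IsGradedFunctor.isGradedNatural_ident⟩
  comp a b := ⟨fun A => D.comp₀ (b.app A) (a.app A), IsGradedNatural.comp b.natural a.natural⟩
  id_comp _ := GradedNat.ext (funext fun _ => D.comp₀_ident _)
  comp_id _ := GradedNat.ext (funext fun _ => D.ident_comp₀ _)
  assoc _ _ _ := GradedNat.ext (funext fun _ => (D.comp₀_assoc _ _ _).symm)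

/-- Composition of graded functors. -/
def GradedFunctor.comp {C : GradedCat.{o, h} V} {D : GradedCat.{o', h'} V}
    {E : GradedCat.{o'', p} V} (F : GradedFunctor C D) (G : GradedFunctor D E) :
    GradedFunctor C E where
  obj A := G.obj (F.obj A)
  map f := G.map (F.map f)
  isGraded :=
    { map_reindex := fun α _ _ f => by rw [F.isGraded.map_reindex, G.isGraded.map_reindex]
      map_comp := fun g f => by rw [F.isGraded.map_comp, G.isGraded.map_comp]
      map_ident := fun A => by rw [F.isGraded.map_ident, G.isGraded.map_ident] }

theorem GradedFunctor.map_comp₀ {C : GradedCat.{o, h} V} {D : GradedCat.{o', h'} V}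
    (F : GradedFunctor C D) {A B E : C.Obj} (g : C.Hom (𝟙_ V) B E) (f : C.Hom (𝟙_ V) A B) :
    F.map (C.comp₀ g f) = D.comp₀ (F.map g) (F.map f) := by
  rw [GradedCat.comp₀, F.isGraded.map_reindex, F.isGraded.map_comp, GradedCat.comp₀]

/-- Precomposition with a graded functor `K`. -/
def precomp {C : GradedCat.{o, h} V} {D : GradedCat.{o', h'} V} (K : GradedFunctor C D)
    (E : GradedCat.{o'', p} V) : GradedFunctor D E ⥤ GradedFunctor C E where
  obj H := K.comp H
  map {H H'} (θ : GradedNat H H') :=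
    (⟨fun A => θ.app (K.obj A), fun f => θ.natural (K.map f)⟩ : GradedNat (K.comp H) (K.comp H'))

/-- Whiskering of a graded-natural transformation `δ : K ⇒ K'` by graded functors `H`, as a
natural transformation `H ↦ H δ`. -/
def precompWhisker {C : GradedCat.{o, h} V} {D : GradedCat.{o', h'} V} {K K' : GradedFunctor C D}
    (δ : GradedNat K K') (E : GradedCat.{o'', p} V) : precomp K E ⟶ precomp K' E where
  app H := (⟨fun A => H.map (δ.app A), fun f => by
    have := congrArg H.map (δ.natural f)
    rwa [H.isGraded.map_reindex, H.isGraded.map_comp, H.isGraded.map_reindex,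
      H.isGraded.map_comp] at this⟩ : GradedNat (K.comp H) (K'.comp H))
  naturality H H' (θ : GradedNat H H') := GradedNat.ext (funext fun A => by
    have := θ.natural (δ.app A)
    rw [← unitors_inv_equal] at this
    exact this.symm)

end Basic

/-! ### Formal opposites, contravariant change of base, bigraded categories -/

section Opposites

variable {V : Type u} [Category.{v} V] [MonoidalCategory V]

/-- A right `V`-graded category is a left `V^rev`-graded category, where `V^rev` is
Mathlib's `Vᴹᵒᵖ`. -/
abbrev RightGradedCat (V : Type u) [Category.{v} V] [MonoidalCategory V] := GradedCat.{o, h} Vᴹᵒᵖ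

/-- The formal opposite `C^∘`, a right `V`-graded category, of a left `V`-graded category `C`. -/
def GradedCat.formalOp (C : GradedCat.{o, h} V) : RightGradedCat.{o, h} V where
  Obj := C.Obj
  Hom X A B := C.Hom X.unmop B A
  reindex α _ _ f := C.reindex α.unmop f
  comp g f := C.comp f g
  ident A := C.ident A
  reindex_id f := C.reindex_id f
  reindex_comp α β _ _ f := C.reindex_comp α.unmop β.unmop f
  comp_natural α β _ _ _ g f := C.comp_natural β.unmop α.unmop f g
  assoc {X Y Z _ _ _ _} k g f := by
    change C.comp f (C.comp g k) =
      C.reindex (α_ X.unmop Y.unmop Z.unmop).inv (C.comp (C.comp f g) k)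
    rw [C.assoc, C.reindex_reindex, Iso.inv_hom_id, C.reindex_id]
  comp_ident f := C.ident_comp f
  ident_comp f := C.comp_ident f

/-- The formal opposite `C^∘`, a left `V`-graded category, of a right `V`-graded category `C`. -/
def RightGradedCat.formalOp (C : RightGradedCat.{o, h} V) : GradedCat.{o, h} V where
  Obj := C.Obj
  Hom X A B := C.Hom (mop X) B A
  reindex α _ _ f := C.reindex α.mop f
  comp g f := C.comp f g
  ident A := C.ident A
  reindex_id f := C.reindex_id f
  reindex_comp α β _ _ f := C.reindex_comp α.mop β.mop f
  comp_natural α β _ _ _ g f := C.comp_natural β.mop α.mop f g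
  assoc {X Y Z _ _ _ _} k g f := by
    change C.comp f (C.comp g k) =
      C.reindex (α_ (mop X) (mop Y) (mop Z)).inv (C.comp (C.comp f g) k)
    rw [C.assoc, C.reindex_reindex, Iso.inv_hom_id, C.reindex_id]
  comp_ident f := C.ident_comp f
  ident_comp f := C.comp_ident f

/-- The action of `(-)^∘` on 1-cells. -/
def GradedFunctor.formalOp {C : GradedCat.{o, h} V} {D : GradedCat.{o', h'} V}
    (F : GradedFunctor C D) : GradedFunctor C.formalOp D.formalOp where
  obj A := F.obj A
  map f := F.map f
  isGraded :=
    { map_reindex := fun α _ _ f => F.isGraded.map_reindex α.unmop f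
      map_comp := fun g f => F.isGraded.map_comp f g
      map_ident := fun A => F.isGraded.map_ident A }

/-- The action of `(-)^∘` on 1-cells. -/
def GradedFunctor.rightFormalOp {C : RightGradedCat.{o, h} V} {D : RightGradedCat.{o', h'} V}
    (F : GradedFunctor C D) :
    GradedFunctor (RightGradedCat.formalOp C) (RightGradedCat.formalOp D) where
  obj A := F.obj A
  map f := F.map f
  isGraded :=
    { map_reindex := fun α _ _ f => F.isGraded.map_reindex α.mop f
      map_comp := fun g f => F.isGraded.map_comp f g
      map_ident := fun A => F.isGraded.map_ident A }

/-- The action of `(-)^∘` on 2-cells, reversing their direction. -/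
def GradedNat.formalOp {C : GradedCat.{o, h} V} {D : GradedCat.{o', h'} V}
    {F G : GradedFunctor C D} (θ : GradedNat F G) : GradedNat G.formalOp F.formalOp where
  app A := θ.app A
  natural f := (θ.natural f).symm

/-- The action of `(-)^∘` on 2-cells, reversing their direction. -/
def GradedNat.rightFormalOp {C : RightGradedCat.{o, h} V} {D : RightGradedCat.{o', h'} V}
    {F G : GradedFunctor C D} (θ : GradedNat F G) : GradedNat G.rightFormalOp F.rightFormalOp where
  app A := θ.app A
  natural f := (θ.natural f).symm

end Opposites

section Bigraded

open Functor.OplaxMonoidal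

/-- Contravariant change of base `F^* C` of a graded category along an opmonoidal functor `F`. -/
def GradedCat.changeBase {V : Type u} [Category.{v} V] [MonoidalCategory V]
    {W : Type u'} [Category.{v'} W] [MonoidalCategory W]
    (F : V ⥤ W) [F.OplaxMonoidal] (C : GradedCat.{o, h} W) : GradedCat.{o, h} V where
  Obj := C.Obj
  Hom X A B := C.Hom (F.obj X) A B
  reindex α _ _ f := C.reindex (F.map α) f
  comp {X Y _ _ _} g f := C.reindex (δ F Y X) (C.comp g f)
  ident A := C.reindex (η F) (C.ident A)
  reindex_id f := by rw [F.map_id, C.reindex_id]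
  reindex_comp α β _ _ f := by rw [F.map_comp, C.reindex_comp]
  comp_natural α β _ _ _ g f := by
    rw [C.comp_natural, C.reindex_reindex, C.reindex_reindex, δ_natural]
  assoc k g f := by
    simp only [C.comp_reindex, C.reindex_comp_left, C.assoc, C.reindex_reindex]
    congr 1
    simp
  comp_ident f := by
    rw [C.comp_reindex, C.comp_ident, C.reindex_reindex, C.reindex_reindex]
    congr 1
    simp
  ident_comp f := by
    rw [C.reindex_comp_left, C.ident_comp, C.reindex_reindex, C.reindex_reindex]
    congr 1
    simp

variable {V : Type u} [Category.{v} V] [MonoidalCategory V]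
variable {W : Type u'} [Category.{v'} W] [MonoidalCategory W]

variable (V W) in
/-- The strong (op)monoidal functor `U_ℓ = (-, I) : V → V × W`. -/
abbrev inl : V ⥤ V × W := Prod.sectL V (𝟙_ W)

variable (V W) in
/-- The strong (op)monoidal functor `U_r = (I, -) : W → V × W`. -/
abbrev inr : W ⥤ V × W := Prod.sectR (𝟙_ V) W

instance : (inl V W).OplaxMonoidal where
  η := 𝟙 _
  δ X Y := 𝟙 (X ⊗ Y) ×ₘ (λ_ (𝟙_ W)).inv
  δ_natural_left {X Y} f X' := by
    refine Prod.hom_ext ?_ ?_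
    · change 𝟙 _ ≫ f ▷ X' = f ▷ X' ≫ 𝟙 _
      simp
    · change (λ_ (𝟙_ W)).inv ≫ 𝟙 _ ▷ _ = 𝟙 _ ≫ (λ_ (𝟙_ W)).inv
      simp
  δ_natural_right {X Y} X' f := by
    refine Prod.hom_ext ?_ ?_
    · change 𝟙 _ ≫ X' ◁ f = X' ◁ f ≫ 𝟙 _
      simp
    · change (λ_ (𝟙_ W)).inv ≫ _ ◁ 𝟙 _ = 𝟙 _ ≫ (λ_ (𝟙_ W)).inv
      simp
  oplax_associativity X Y Z := by
    refine Prod.hom_ext ?_ ?_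
    · change 𝟙 _ ≫ 𝟙 _ ▷ _ ≫ (α_ X Y Z).hom = (α_ X Y Z).hom ≫ 𝟙 _ ≫ _ ◁ 𝟙 _
      simp
    · change (λ_ (𝟙_ W)).inv ≫ (λ_ (𝟙_ W)).inv ▷ _ ≫ (α_ _ _ _).hom =
        𝟙 _ ≫ (λ_ (𝟙_ W)).inv ≫ _ ◁ (λ_ (𝟙_ W)).inv
      monoidal
  oplax_left_unitality X := by
    refine Prod.hom_ext ?_ ?_
    · change (λ_ X).inv = (λ_ X).inv ≫ 𝟙 _ ≫ 𝟙 _ ▷ _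
      simp
    · change (λ_ (𝟙_ W)).inv = 𝟙 _ ≫ (λ_ (𝟙_ W)).inv ≫ 𝟙 _ ▷ _
      simp
  oplax_right_unitality X := by
    refine Prod.hom_ext ?_ ?_
    · change (ρ_ X).inv = (ρ_ X).inv ≫ 𝟙 _ ≫ _ ◁ 𝟙 _
      simp
    · change (ρ_ (𝟙_ W)).inv = 𝟙 _ ≫ (λ_ (𝟙_ W)).inv ≫ _ ◁ 𝟙 _
      simp [unitors_inv_equal]

instance : (inr V W).OplaxMonoidal where
  η := 𝟙 _
  δ X Y := (λ_ (𝟙_ V)).inv ×ₘ 𝟙 (X ⊗ Y)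
  δ_natural_left {X Y} f X' := by
    refine Prod.hom_ext ?_ ?_
    · change (λ_ (𝟙_ V)).inv ≫ 𝟙 _ ▷ _ = 𝟙 _ ≫ (λ_ (𝟙_ V)).inv
      simp
    · change 𝟙 _ ≫ f ▷ X' = f ▷ X' ≫ 𝟙 _
      simp
  δ_natural_right {X Y} X' f := by
    refine Prod.hom_ext ?_ ?_
    · change (λ_ (𝟙_ V)).inv ≫ _ ◁ 𝟙 _ = 𝟙 _ ≫ (λ_ (𝟙_ V)).inv
      simp
    · change 𝟙 _ ≫ X' ◁ f = X' ◁ f ≫ 𝟙 _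
      simp
  oplax_associativity X Y Z := by
    refine Prod.hom_ext ?_ ?_
    · change (λ_ (𝟙_ V)).inv ≫ (λ_ (𝟙_ V)).inv ▷ _ ≫ (α_ _ _ _).hom =
        𝟙 _ ≫ (λ_ (𝟙_ V)).inv ≫ _ ◁ (λ_ (𝟙_ V)).inv
      monoidal
    · change 𝟙 _ ≫ 𝟙 _ ▷ _ ≫ (α_ X Y Z).hom = (α_ X Y Z).hom ≫ 𝟙 _ ≫ _ ◁ 𝟙 _
      simp
  oplax_left_unitality X := by
    refine Prod.hom_ext ?_ ?_
    · change (λ_ (𝟙_ V)).inv = 𝟙 _ ≫ (λ_ (𝟙_ V)).inv ≫ 𝟙 _ ▷ _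
      simp
    · change (λ_ X).inv = (λ_ X).inv ≫ 𝟙 _ ≫ 𝟙 _ ▷ _
      simp
  oplax_right_unitality X := by
    refine Prod.hom_ext ?_ ?_
    · change (ρ_ (𝟙_ V)).inv = 𝟙 _ ≫ (λ_ (𝟙_ V)).inv ≫ _ ◁ 𝟙 _
      simp [unitors_inv_equal]
    · change (ρ_ X).inv = (ρ_ X).inv ≫ 𝟙 _ ≫ _ ◁ 𝟙 _
      simp

/-- A `V`-`W`-bigraded category is a left `(V × W^rev)`-graded category. -/
abbrev BigradedCat (V : Type u) [Category.{v} V] [MonoidalCategory V]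
    (W : Type u') [Category.{v'} W] [MonoidalCategory W] := GradedCat.{o, h} (V × Wᴹᵒᵖ)

/-- The underlying left `V`-graded category `U_ℓ^* C` of a bigraded category. -/
abbrev BigradedCat.left (C : BigradedCat.{o, h} V W) : GradedCat.{o, h} V :=
  GradedCat.changeBase (inl V Wᴹᵒᵖ) C

/-- The underlying right `W`-graded category `U_r^* C` of a bigraded category. -/
abbrev BigradedCat.right (C : BigradedCat.{o, h} V W) : RightGradedCat.{o, h} W :=
  GradedCat.changeBase (inr V Wᴹᵒᵖ) C

/-- `(f, g, φ, φ')` is an `(X, X')`-bigraded square: the composites `g ∘ φ` and `φ' ∘ f`,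
reindexed to the grade `(X, X')` along the unitors, agree. -/
def BigradedCat.IsBigradedSquare (C : BigradedCat.{o, h} V W) {X : V} {X' : Wᴹᵒᵖ}
    {A A' B B' : C.Obj} (f : C.left.Hom X A A') (g : C.left.Hom X B B')
    (φ : C.right.Hom X' A B) (φ' : C.right.Hom X' A' B') : Prop :=
  C.reindex ((ρ_ X).inv ×ₘ (λ_ X').inv) (C.comp (X := (𝟙_ V, X')) (Y := (X, 𝟙_ Wᴹᵒᵖ)) g φ) =
    C.reindex ((λ_ X).inv ×ₘ (ρ_ X').inv) (C.comp (X := (X, 𝟙_ Wᴹᵒᵖ)) (Y := (𝟙_ V, X')) φ' f)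

/-! ### Graded sesquifunctors and graded bifunctors -/

/-- A graded sesquifunctor `F : A, B → C`: graded functors `F(-, b)` and `F(a, -)` that agree
on objects. -/
structure GradedSesquifunctor (A : GradedCat.{o, h} V) (B : RightGradedCat.{o', h'} W)
    (C : BigradedCat.{o'', p} V W) where
  obj : A.Obj → B.Obj → C.Obj
  /-- `mapL b f` is `F(f, b)`. -/
  mapL : ∀ (b : B.Obj) {X : V} {a a' : A.Obj}, A.Hom X a a' → C.left.Hom X (obj a b) (obj a' b)
  /-- `mapR a g` is `F(a, g)`. -/
  mapR : ∀ (a : A.Obj) {X : Wᴹᵒᵖ} {b b' : B.Obj},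
    B.Hom X b b' → C.right.Hom X (obj a b) (obj a b')
  isGradedL : ∀ b : B.Obj, IsGradedFunctor A C.left (fun a => obj a b) (mapL b)
  isGradedR : ∀ a : A.Obj, IsGradedFunctor B C.right (fun b => obj a b) (mapR a)

/-- A graded bifunctor `F : A, B → C`: a graded sesquifunctor under which all graded morphisms
in `A` commute with all graded morphisms in `B`. -/
structure GradedBifunctor (A : GradedCat.{o, h} V) (B : RightGradedCat.{o', h'} W)
    (C : BigradedCat.{o'', p} V W) extends GradedSesquifunctor A B C where
  square : ∀ {X : V} {a a' : A.Obj} (f : A.Hom X a a') {X' : Wᴹᵒᵖ} {b b' : B.Obj}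
    (g : B.Hom X' b b'),
    BigradedCat.IsBigradedSquare C (mapL b f) (mapL b' f) (mapR a g) (mapR a' g)

/-- Transformations of graded bifunctors: families of morphisms in `C₀` that are left graded
natural in the first variable and right graded natural in the second. -/
@[ext]
structure GradedBifunctor.Transformation {A : GradedCat.{o, h} V} {B : RightGradedCat.{o', h'} W}
    {C : BigradedCat.{o'', p} V W} (F G : GradedBifunctor A B C) where
  app : ∀ (a : A.Obj) (b : B.Obj), C.Hom (𝟙_ (V × Wᴹᵒᵖ)) (F.obj a b) (G.obj a b)
  naturalL : ∀ b : B.Obj, IsGradedNatural A C.left (F.mapL b) (G.mapL b) (fun a => app a b)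
  naturalR : ∀ a : A.Obj, IsGradedNatural B C.right (F.mapR a) (G.mapR a) (fun b => app a b)

theorem left_comp₀ (C : BigradedCat.{o, h} V W) {a b d : C.Obj}
    (g : C.Hom (𝟙_ (V × Wᴹᵒᵖ)) b d) (f : C.Hom (𝟙_ (V × Wᴹᵒᵖ)) a b) :
    C.left.comp₀ g f = C.comp₀ g f := by
  change C.reindex _ (C.reindex _ (C.comp _ _)) = C.reindex _ (C.comp _ _)
  rw [C.reindex_reindex]
  congr 1
  refine Prod.hom_ext ?_ ?_
  · exact Category.comp_id _
  · exact Category.id_comp _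

theorem right_comp₀ (C : BigradedCat.{o, h} V W) {a b d : C.Obj}
    (g : C.Hom (𝟙_ (V × Wᴹᵒᵖ)) b d) (f : C.Hom (𝟙_ (V × Wᴹᵒᵖ)) a b) :
    C.right.comp₀ g f = C.comp₀ g f := by
  change C.reindex _ (C.reindex _ (C.comp _ _)) = C.reindex _ (C.comp _ _)
  rw [C.reindex_reindex]
  congr 1
  refine Prod.hom_ext ?_ ?_
  · exact Category.id_comp _
  · exact Category.comp_id _

theorem left_ident (C : BigradedCat.{o, h} V W) (a : C.Obj) : C.left.ident a = C.ident a :=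
  C.reindex_id _

theorem right_ident (C : BigradedCat.{o, h} V W) (a : C.Obj) : C.right.ident a = C.ident a :=
  C.reindex_id _

/-- The identity transformation. -/
def GradedBifunctor.Transformation.id {A : GradedCat.{o, h} V} {B : RightGradedCat.{o', h'} W}
    {C : BigradedCat.{o'', p} V W} (F : GradedBifunctor A B C) : Transformation F F where
  app a b := C.ident (F.obj a b)
  naturalL b := by
    simp only [← left_ident]
    exact IsGradedFunctor.isGradedNatural_ident (C := A) (D := C.left) (obj := fun a => F.obj a b)
      (map := F.mapL b)
  naturalR a := by
    simp only [← right_ident]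
    exact IsGradedFunctor.isGradedNatural_ident (C := B) (D := C.right) (obj := fun b => F.obj a b)
      (map := F.mapR a)

/-- Composition of transformations, componentwise in `C₀`. -/
def GradedBifunctor.Transformation.comp {A : GradedCat.{o, h} V} {B : RightGradedCat.{o', h'} W}
    {C : BigradedCat.{o'', p} V W} {F G H : GradedBifunctor A B C} (θ : Transformation F G)
    (κ : Transformation G H) : Transformation F H where
  app a b := C.comp₀ (κ.app a b) (θ.app a b)
  naturalL b := by
    simp only [← left_comp₀]
    exact IsGradedNatural.comp (κ.naturalL b) (θ.naturalL b)
  naturalR a := by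
    simp only [← right_comp₀]
    exact IsGradedNatural.comp (κ.naturalR a) (θ.naturalR a)

/-- The category of graded bifunctors `A, B → C`. -/
instance (A : GradedCat.{o, h} V) (B : RightGradedCat.{o', h'} W)
    (C : BigradedCat.{o'', p} V W) : Category (GradedBifunctor A B C) where
  Hom F G := GradedBifunctor.Transformation F G
  id F := GradedBifunctor.Transformation.id F
  comp θ κ := GradedBifunctor.Transformation.comp θ κ
  id_comp _ := GradedBifunctor.Transformation.ext (funext₂ fun _ _ => C.comp₀_ident _)
  comp_id _ := GradedBifunctor.Transformation.ext (funext₂ fun _ _ => C.ident_comp₀ _)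
  assoc _ _ _ := GradedBifunctor.Transformation.ext
    (funext₂ fun _ _ => (C.comp₀_assoc _ _ _).symm)

/-- Precomposing a functorial assignment with a graded functor. -/
theorem IsGradedFunctor.precomp {A A' : GradedCat.{o, h} V} {D : GradedCat.{o', h'} V}
    {obj : A.Obj → D.Obj} {map : ∀ {X : V} {a b : A.Obj}, A.Hom X a b → D.Hom X (obj a) (obj b)}
    (H : IsGradedFunctor A D obj map) (P : GradedFunctor A' A) :
    IsGradedFunctor A' D (fun a => obj (P.obj a)) (fun f => map (P.map f)) where
  map_reindex := fun α _ _ f => by rw [P.isGraded.map_reindex, H.map_reindex]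
  map_comp := fun g f => by rw [P.isGraded.map_comp, H.map_comp]
  map_ident := fun A => by rw [P.isGraded.map_ident, H.map_ident]

/-- The graded bifunctor `F(P-, Q-)`. -/
def GradedBifunctor.restrict {A A' : GradedCat.{o, h} V} {B B' : RightGradedCat.{o', h'} W}
    {C : BigradedCat.{o'', p} V W} (F : GradedBifunctor A B C) (P : GradedFunctor A' A)
    (Q : GradedFunctor B' B) : GradedBifunctor A' B' C where
  obj a b := F.obj (P.obj a) (Q.obj b)
  mapL b _ _ _ f := F.mapL (Q.obj b) (P.map f)
  mapR a _ _ _ g := F.mapR (P.obj a) (Q.map g)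
  isGradedL b := (F.isGradedL (Q.obj b)).precomp P
  isGradedR a := (F.isGradedR (P.obj a)).precomp Q
  square f _ _ _ g := F.square (P.map f) (Q.map g)

/-- The 2-functor of graded bifunctors on 1-cells: `F ↦ F(P-, Q-)`. -/
def GBif.map {A A' : GradedCat.{o, h} V} {B B' : RightGradedCat.{o', h'} W}
    (C : BigradedCat.{o'', p} V W) (P : GradedFunctor A' A) (Q : GradedFunctor B' B) :
    GradedBifunctor A B C ⥤ GradedBifunctor A' B' C where
  obj F := F.restrict P Q
  map {F G} (θ : GradedBifunctor.Transformation F G) :=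
    ({ app := fun a b => θ.app (P.obj a) (Q.obj b)
       naturalL := fun b _ _ _ f => θ.naturalL (Q.obj b) (P.map f)
       naturalR := fun a _ _ _ g => θ.naturalR (P.obj a) (Q.map g) } :
      GradedBifunctor.Transformation (F.restrict P Q) (G.restrict P Q))

theorem IsBigradedSquare.natR {C : BigradedCat.{o, h} V W} {X' : Wᴹᵒᵖ}
    {A A' B B' : C.Obj} {f : C.left.Hom (𝟙_ V) A A'} {g : C.left.Hom (𝟙_ V) B B'}
    {φ : C.right.Hom X' A B} {φ' : C.right.Hom X' A' B'} (H : C.IsBigradedSquare f g φ φ') :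
    C.right.reindex (λ_ X').inv (C.right.comp (X := X') (Y := 𝟙_ Wᴹᵒᵖ) g φ) =
      C.right.reindex (ρ_ X').inv (C.right.comp (X := 𝟙_ Wᴹᵒᵖ) (Y := X') φ' f) := by
  refine Eq.trans ?_ (Eq.trans H ?_)
  · refine (C.reindex_reindex _ _ _).trans (congrArg (fun z => C.reindex z _) ?_)
    refine Prod.hom_ext ?_ ?_
    · exact (Category.id_comp _).trans unitors_inv_equal
    · exact Category.comp_id _
  · refine (congrArg (fun z => C.reindex z _) ?_).trans (C.reindex_reindex _ _ _).symm
    refine Prod.hom_ext ?_ ?_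
    · exact (Category.id_comp _).symm
    · exact (Category.comp_id _).symm

theorem IsBigradedSquare.natL {C : BigradedCat.{o, h} V W} {X : V}
    {A A' B B' : C.Obj} {f : C.left.Hom X A A'} {g : C.left.Hom X B B'}
    {φ : C.right.Hom (𝟙_ Wᴹᵒᵖ) A B} {φ' : C.right.Hom (𝟙_ Wᴹᵒᵖ) A' B'}
    (H : C.IsBigradedSquare f g φ φ') :
    C.left.reindex (λ_ X).inv (C.left.comp (X := X) (Y := 𝟙_ V) φ' f) =
      C.left.reindex (ρ_ X).inv (C.left.comp (X := 𝟙_ V) (Y := X) g φ) := by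
  refine Eq.trans ?_ (Eq.trans H.symm ?_)
  · refine (C.reindex_reindex _ _ _).trans (congrArg (fun z => C.reindex z _) ?_)
    refine Prod.hom_ext ?_ ?_
    · exact Category.comp_id _
    · exact (Category.id_comp _).trans unitors_inv_equal
  · refine (congrArg (fun z => C.reindex z _) ?_).trans (C.reindex_reindex _ _ _).symm
    refine Prod.hom_ext ?_ ?_
    · exact (Category.comp_id _).symm
    · exact (Category.id_comp _).symm

/-- The whiskering of `ξ : P ⇒ P'` by graded bifunctors `F`, with components `F(ξ_a, Q b)`. -/
def GBif.map₂L {A A' : GradedCat.{o, h} V} {B B' : RightGradedCat.{o', h'} W}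
    (C : BigradedCat.{o'', p} V W) {P P' : GradedFunctor A' A} (ξ : GradedNat P P')
    (Q : GradedFunctor B' B) :
    GBif.map (A := A) (B := B) C P Q ⟶ GBif.map C P' Q where
  app F :=
    ({ app := fun a b => F.mapL (Q.obj b) (ξ.app a)
       naturalL := fun b X a a' f => by
         have := congrArg (F.mapL (Q.obj b)) (ξ.natural f)
         rwa [(F.isGradedL _).map_reindex, (F.isGradedL _).map_comp, (F.isGradedL _).map_reindex,
           (F.isGradedL _).map_comp] at this
       naturalR := fun a X b b' g => by
         exact IsBigradedSquare.natR (F.square (ξ.app a) (Q.map g))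
       } : GradedBifunctor.Transformation (F.restrict P Q) (F.restrict P' Q))
  naturality F G (θ : GradedBifunctor.Transformation F G) :=
    GradedBifunctor.Transformation.ext (funext₂ fun a b => by
      have := θ.naturalL (Q.obj b) (ξ.app a)
      rw [← unitors_inv_equal] at this
      exact (left_comp₀ C _ _).symm.trans (this.symm.trans (left_comp₀ C _ _)))

/-- The whiskering of `ζ : Q ⇒ Q'` by graded bifunctors `F`, with components `F(P a, ζ_b)`. -/
def GBif.map₂R {A A' : GradedCat.{o, h} V} {B B' : RightGradedCat.{o', h'} W}
    (C : BigradedCat.{o'', p} V W) (P : GradedFunctor A' A) {Q Q' : GradedFunctor B' B}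
    (ζ : GradedNat Q Q') :
    GBif.map (A := A) (B := B) C P Q ⟶ GBif.map C P Q' where
  app F :=
    ({ app := fun a b => F.mapR (P.obj a) (ζ.app b)
       naturalL := fun b X a a' f => by
         exact IsBigradedSquare.natL (F.square (P.map f) (ζ.app b))
       naturalR := fun a X b b' g => by
         have := congrArg (F.mapR (P.obj a)) (ζ.natural g)
         rwa [(F.isGradedR _).map_reindex, (F.isGradedR _).map_comp, (F.isGradedR _).map_reindex,
           (F.isGradedR _).map_comp] at this
       } : GradedBifunctor.Transformation (F.restrict P Q) (F.restrict P Q'))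
  naturality F G (θ : GradedBifunctor.Transformation F G) :=
    GradedBifunctor.Transformation.ext (funext₂ fun a b => by
      have := θ.naturalR (P.obj a) (ζ.app b)
      rw [← unitors_inv_equal] at this
      exact (right_comp₀ C _ _).symm.trans (this.symm.trans (right_comp₀ C _ _)))

/-- The 2-functor of graded bifunctors on 2-cells: `ξ : P ⇒ P'` and `ζ : Q ⇒ Q'` induce the
transformations with components `F(P' a, ζ_b) ∘ F(ξ_a, Q b)`. -/
def GBif.map₂ {A A' : GradedCat.{o, h} V} {B B' : RightGradedCat.{o', h'} W}
    (C : BigradedCat.{o'', p} V W) {P P' : GradedFunctor A' A} (ξ : GradedNat P P')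
    {Q Q' : GradedFunctor B' B} (ζ : GradedNat Q Q') :
    GBif.map (A := A) (B := B) C P Q ⟶ GBif.map C P' Q' :=
  GBif.map₂L C ξ Q ≫ GBif.map₂R C P' ζ

/-! ### The bigraded category `A ⊠ B` -/

/-- The bigraded category `A ⊠ B`. -/
def boxProd (A : GradedCat.{o, h} V) (B : RightGradedCat.{o', h'} W) :
    BigradedCat.{max o o', max h h'} V W where
  Obj := A.Obj × B.Obj
  Hom X a b := A.Hom X.1 a.1 b.1 × B.Hom X.2 a.2 b.2
  reindex α _ _ f := (A.reindex α.1 f.1, B.reindex α.2 f.2)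
  comp g f := (A.comp g.1 f.1, B.comp g.2 f.2)
  ident a := (A.ident a.1, B.ident a.2)
  reindex_id _ := Prod.ext (A.reindex_id _) (B.reindex_id _)
  reindex_comp _ _ _ _ _ := Prod.ext (A.reindex_comp _ _ _) (B.reindex_comp _ _ _)
  comp_natural _ _ _ _ _ _ _ := Prod.ext (A.comp_natural _ _ _ _) (B.comp_natural _ _ _ _)
  assoc _ _ _ := Prod.ext (A.assoc _ _ _) (B.assoc _ _ _)
  comp_ident _ := Prod.ext (A.comp_ident _) (B.comp_ident _)
  ident_comp _ := Prod.ext (A.ident_comp _) (B.ident_comp _)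

/-- `P ⊠ Q` on 1-cells. -/
def boxMap {A A' : GradedCat.{o, h} V} {B B' : RightGradedCat.{o', h'} W}
    (P : GradedFunctor A' A) (Q : GradedFunctor B' B) :
    GradedFunctor (boxProd A' B') (boxProd A B) where
  obj a := (P.obj a.1, Q.obj a.2)
  map f := (P.map f.1, Q.map f.2)
  isGraded :=
    { map_reindex := fun _ _ _ _ => Prod.ext (P.isGraded.map_reindex _ _)
        (Q.isGraded.map_reindex _ _)
      map_comp := fun _ _ => Prod.ext (P.isGraded.map_comp _ _) (Q.isGraded.map_comp _ _)
      map_ident := fun _ => Prod.ext (P.isGraded.map_ident _) (Q.isGraded.map_ident _) }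

/-- `ξ ⊠ ζ` on 2-cells. -/
def boxMap₂ {A A' : GradedCat.{o, h} V} {B B' : RightGradedCat.{o', h'} W}
    {P P' : GradedFunctor A' A} (ξ : GradedNat P P') {Q Q' : GradedFunctor B' B}
    (ζ : GradedNat Q Q') : GradedNat (boxMap P Q) (boxMap P' Q') where
  app a := (ξ.app a.1, ζ.app a.2)
  natural f := Prod.ext (ξ.natural f.1) (ζ.natural f.2)

end Bigraded

/-! ### `V̂` as a `V`-`V`-bigraded category -/

section Presheaves

variable {V : Type w} [SmallCategory V] [MonoidalCategory V]

/-- The functor `X ⊗ - ⊗ X' : V → V`, taken to be `(X ⊗ -) ⊗ X'`. -/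
def shift (U : V × Vᴹᵒᵖ) : V ⥤ V where
  obj Z := (U.1 ⊗ Z) ⊗ U.2.unmop
  map f := (U.1 ◁ f) ▷ U.2.unmop

/-- `X ⊗ - ⊗ X'` is functorial in `(X, X')`. -/
def shiftMap {T U : V × Vᴹᵒᵖ} (α : T ⟶ U) (Z : V) : (shift T).obj Z ⟶ (shift U).obj Z :=
  (α.1 ▷ Z) ⊗ₘ α.2.unmop

/-- The canonical isomorphism `(Y ⊗ X) ⊗ Z ⊗ (X' ⊗ Y') ⟶ Y ⊗ (X ⊗ Z ⊗ X') ⊗ Y'`. -/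
def shiftTensor (T U : V × Vᴹᵒᵖ) (Z : V) :
    (shift (T ⊗ U)).obj Z ⟶ (shift T).obj ((shift U).obj Z) :=
  (α_ T.1 U.1 Z).hom ▷ (U.2.unmop ⊗ T.2.unmop) ≫
    (α_ (T.1 ⊗ (U.1 ⊗ Z)) U.2.unmop T.2.unmop).inv ≫
      (α_ T.1 (U.1 ⊗ Z) U.2.unmop).hom ▷ T.2.unmop

/-- The canonical isomorphism `I ⊗ Z ⊗ I ⟶ Z`. -/
def shiftUnit (Z : V) : (shift (𝟙_ (V × Vᴹᵒᵖ))).obj Z ⟶ Z :=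
  (ρ_ (𝟙_ V ⊗ Z)).hom ≫ (λ_ Z).hom

theorem shiftMap_naturality {T U : V × Vᴹᵒᵖ} (α : T ⟶ U) {Z Z' : V} (f : Z ⟶ Z') :
    (shift T).map f ≫ shiftMap α Z' = shiftMap α Z ≫ (shift U).map f := by
  change (T.1 ◁ f) ▷ T.2.unmop ≫ (α.1 ▷ Z' ⊗ₘ α.2.unmop) =
    (α.1 ▷ Z ⊗ₘ α.2.unmop) ≫ (U.1 ◁ f) ▷ U.2.unmop
  simp only [← tensorHom_id, ← id_tensorHom, tensorHom_comp_tensorHom, Category.id_comp,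
    Category.comp_id]

theorem shiftTensor_naturality (T U : V × Vᴹᵒᵖ) {Z Z' : V} (f : Z ⟶ Z') :
    (shift (T ⊗ U)).map f ≫ shiftTensor T U Z' =
      shiftTensor T U Z ≫ (shift T).map ((shift U).map f) := by
  change ((T.1 ⊗ U.1) ◁ f) ▷ (U.2.unmop ⊗ T.2.unmop) ≫
      (α_ T.1 U.1 Z').hom ▷ (U.2.unmop ⊗ T.2.unmop) ≫
      (α_ (T.1 ⊗ (U.1 ⊗ Z')) U.2.unmop T.2.unmop).inv ≫
      (α_ T.1 (U.1 ⊗ Z') U.2.unmop).hom ▷ T.2.unmop =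
    ((α_ T.1 U.1 Z).hom ▷ (U.2.unmop ⊗ T.2.unmop) ≫
      (α_ (T.1 ⊗ (U.1 ⊗ Z)) U.2.unmop T.2.unmop).inv ≫
      (α_ T.1 (U.1 ⊗ Z) U.2.unmop).hom ▷ T.2.unmop) ≫ (T.1 ◁ (U.1 ◁ f) ▷ U.2.unmop) ▷ T.2.unmop
  monoidal

theorem shiftUnit_naturality {Z Z' : V} (f : Z ⟶ Z') :
    (shift (𝟙_ (V × Vᴹᵒᵖ))).map f ≫ shiftUnit Z' = shiftUnit Z ≫ f := by
  change (𝟙_ V ◁ f) ▷ (𝟙_ V) ≫ ((ρ_ (𝟙_ V ⊗ Z')).hom ≫ (λ_ Z').hom) =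
    ((ρ_ (𝟙_ V ⊗ Z)).hom ≫ (λ_ Z).hom) ≫ f
  monoidal

theorem shiftMap_id (U : V × Vᴹᵒᵖ) (Z : V) : shiftMap (𝟙 U) Z = 𝟙 _ := by
  change (𝟙 U.1 ▷ Z) ⊗ₘ 𝟙 U.2.unmop = 𝟙 ((U.1 ⊗ Z) ⊗ U.2.unmop)
  simp

theorem shiftMap_comp {S T U : V × Vᴹᵒᵖ} (α : S ⟶ T) (β : T ⟶ U) (Z : V) :
    shiftMap (α ≫ β) Z = shiftMap α Z ≫ shiftMap β Z := by
  change ((α.1 ≫ β.1) ▷ Z) ⊗ₘ (α.2.unmop ≫ β.2.unmop) =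
    (α.1 ▷ Z ⊗ₘ α.2.unmop) ≫ (β.1 ▷ Z ⊗ₘ β.2.unmop)
  rw [tensorHom_comp_tensorHom, comp_whiskerRight]

theorem shiftTensor_tensor {T T' U U' : V × Vᴹᵒᵖ} (β : T' ⟶ T) (α : U' ⟶ U) (Z : V) :
    shiftMap (β ⊗ₘ α) Z ≫ shiftTensor T U Z =
      shiftTensor T' U' Z ≫ shiftMap β _ ≫ (shift T).map (shiftMap α Z) := by
  change (((β.1 ⊗ₘ α.1) ▷ Z) ⊗ₘ (α.2.unmop ⊗ₘ β.2.unmop)) ≫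
      ((α_ T.1 U.1 Z).hom ▷ (U.2.unmop ⊗ T.2.unmop) ≫
      (α_ (T.1 ⊗ (U.1 ⊗ Z)) U.2.unmop T.2.unmop).inv ≫
      (α_ T.1 (U.1 ⊗ Z) U.2.unmop).hom ▷ T.2.unmop) =
    ((α_ T'.1 U'.1 Z).hom ▷ (U'.2.unmop ⊗ T'.2.unmop) ≫
      (α_ (T'.1 ⊗ (U'.1 ⊗ Z)) U'.2.unmop T'.2.unmop).inv ≫
      (α_ T'.1 (U'.1 ⊗ Z) U'.2.unmop).hom ▷ T'.2.unmop) ≫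
      (β.1 ▷ ((U'.1 ⊗ Z) ⊗ U'.2.unmop) ⊗ₘ β.2.unmop) ≫
      (T.1 ◁ (α.1 ▷ Z ⊗ₘ α.2.unmop)) ▷ T.2.unmop
  simp only [← tensorHom_id, ← id_tensorHom, tensorHom_comp_tensorHom, Category.id_comp,
    Category.comp_id, Category.assoc, associator_naturality, tensorHom_comp_tensorHom_assoc]
  have e : ((α_ T'.1 U'.1 Z).hom ≫ (β.1 ⊗ₘ (α.1 ⊗ₘ 𝟙 Z))) ⊗ₘ (α.2.unmop ⊗ₘ β.2.unmop) =
      ((α_ T'.1 U'.1 Z).hom ⊗ₘ 𝟙 (U'.2.unmop ⊗ T'.2.unmop)) ≫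
        ((β.1 ⊗ₘ (α.1 ⊗ₘ 𝟙 Z)) ⊗ₘ (α.2.unmop ⊗ₘ β.2.unmop)) := by
    rw [tensorHom_comp_tensorHom, Category.id_comp]
  rw [e, Category.assoc, associator_inv_naturality_assoc, tensorHom_comp_tensorHom,
    associator_naturality, Category.comp_id]

theorem shiftTensor_assoc (T U S : V × Vᴹᵒᵖ) (Z : V) :
    shiftMap (α_ T U S).hom Z ≫ shiftTensor T (U ⊗ S) Z ≫ (shift T).map (shiftTensor U S Z) =
      shiftTensor (T ⊗ U) S Z ≫ shiftTensor T U ((shift S).obj Z) := by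
  change (((α_ T.1 U.1 S.1).hom ▷ Z) ⊗ₘ (α_ S.2.unmop U.2.unmop T.2.unmop).inv) ≫
    ((α_ T.1 (U.1 ⊗ S.1) Z).hom ▷ ((S.2.unmop ⊗ U.2.unmop) ⊗ T.2.unmop) ≫
      (α_ _ (S.2.unmop ⊗ U.2.unmop) T.2.unmop).inv ≫
       (α_ T.1 ((U.1 ⊗ S.1) ⊗ Z) (S.2.unmop ⊗ U.2.unmop)).hom ▷ T.2.unmop) ≫
    (T.1 ◁ shiftTensor U S Z) ▷ T.2.unmop =
    ((α_ (T.1 ⊗ U.1) S.1 Z).hom ▷ (S.2.unmop ⊗ (U.2.unmop ⊗ T.2.unmop)) ≫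
      (α_ _ S.2.unmop (U.2.unmop ⊗ T.2.unmop)).inv ≫
      (α_ (T.1 ⊗ U.1) (S.1 ⊗ Z) (S.2.unmop)).hom ▷ (U.2.unmop ⊗ T.2.unmop)) ≫
      ((α_ T.1 U.1 _).hom ▷ (U.2.unmop ⊗ T.2.unmop) ≫
      (α_ _ U.2.unmop T.2.unmop).inv ≫
      (α_ T.1 _ (U.2.unmop)).hom ▷ (T.2.unmop))
  simp only [shiftTensor]
  monoidal

theorem shiftTensor_unit (T : V × Vᴹᵒᵖ) (Z : V) :
    shiftTensor T (𝟙_ _) Z ≫ (shift T).map (shiftUnit Z) = shiftMap (ρ_ T).hom Z := by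
  change ((α_ T.1 (𝟙_ V) Z).hom ▷ ((𝟙_ V) ⊗ T.2.unmop) ≫ (α_ _ (𝟙_ V) T.2.unmop).inv ≫
    (α_ T.1 (𝟙_ V ⊗ Z) (𝟙_ V)).hom ▷ T.2.unmop) ≫ (T.1 ◁ shiftUnit Z) ▷ T.2.unmop =
    ((ρ_ T.1).hom ▷ Z) ⊗ₘ (λ_ T.2.unmop).hom
  simp only [shiftUnit]
  monoidal

theorem unit_shiftTensor (T : V × Vᴹᵒᵖ) (Z : V) :
    shiftTensor (𝟙_ _) T Z ≫ shiftUnit ((shift T).obj Z) = shiftMap (λ_ T).hom Z := by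
  change ((α_ (𝟙_ V) T.1 Z).hom ▷ (T.2.unmop ⊗ 𝟙_ V) ≫ (α_ _ T.2.unmop (𝟙_ V)).inv ≫
    (α_ (𝟙_ V) (T.1 ⊗ Z) (T.2.unmop)).hom ▷ (𝟙_ V)) ≫
      ((ρ_ (𝟙_ V ⊗ ((T.1 ⊗ Z) ⊗ T.2.unmop))).hom ≫ (λ_ ((T.1 ⊗ Z) ⊗ T.2.unmop)).hom) =
    ((λ_ T.1).hom ▷ Z) ⊗ₘ (ρ_ T.2.unmop).hom
  monoidal

variable (V) in
/-- The `V`-`V`-bigraded category `V̂` of presheaves on `V`: a graded morphism `P → Q` of grade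
`(X, X')` is a natural transformation `P ⇒ Q(X ⊗ - ⊗ X')`. -/
def presheaves : BigradedCat.{w + 1, w} V V where
  Obj := Vᵒᵖ ⥤ Type w
  Hom U P Q := P ⟶ (shift U).op ⋙ Q
  reindex {T U} α P Q f :=
    { app := fun Z => f.app Z ≫ Q.map (shiftMap α Z.unop).op
      naturality := fun Z Z' k => by
        simp only [NatTrans.naturality_assoc, Category.assoc, Functor.comp_map, Functor.op_map,
          ← Q.map_comp, ← op_comp, shiftMap_naturality] }
  comp {T U P Q R} g f :=
    { app := fun Z => f.app Z ≫ g.app (op ((shift T).obj Z.unop)) ≫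
        R.map (shiftTensor U T Z.unop).op
      naturality := fun Z Z' k => by
        have := g.naturality ((shift T).map k.unop).op
        simp only [Functor.comp_map, Functor.op_map, Quiver.Hom.unop_op] at this
        simp only [NatTrans.naturality_assoc, Category.assoc, Functor.comp_map, Functor.op_map,
          ← R.map_comp, ← op_comp, shiftTensor_naturality]
        rw [reassoc_of% this, op_comp, R.map_comp] }
  ident P :=
    { app := fun Z => P.map (shiftUnit Z.unop).op
      naturality := fun Z Z' k => by
        simp only [Functor.comp_map, Functor.op_map, ← P.map_comp]
        exact congrArg P.map (Quiver.Hom.unop_inj (shiftUnit_naturality k.unop).symm) }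
  reindex_id {U P Q} f := by
    ext Z : 2
    simp [shiftMap_id]
  reindex_comp α β _ Q f := by
    ext Z : 2
    have h : shiftMap (α ≫ β) Z.unop = shiftMap α Z.unop ≫ shiftMap β Z.unop :=
      shiftMap_comp α β Z.unop
    change f.app Z ≫ Q.map (shiftMap (α ≫ β) Z.unop).op =
      (f.app Z ≫ Q.map (shiftMap β Z.unop).op) ≫ Q.map (shiftMap α Z.unop).op
    rw [h, op_comp, Q.map_comp, Category.assoc]
  comp_natural {T T' U U'} α β P Q R g f := by
    ext Z : 2
    have := g.naturality (shiftMap α Z.unop).op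
    simp only [Functor.comp_map, Functor.op_map, Quiver.Hom.unop_op] at this
    simp only [Category.assoc]
    rw [reassoc_of% this]
    simp only [← R.map_comp, ← op_comp, shiftTensor_tensor, Category.assoc]
  assoc {X Y Z A B C D} k g f := by
    ext S : 2
    have := k.naturality (shiftTensor Y X S.unop).op
    simp only [Functor.comp_map, Functor.op_map, Quiver.Hom.unop_op] at this
    simp only [Category.assoc]
    rw [reassoc_of% this]
    simp only [← D.map_comp, ← op_comp, shiftTensor_assoc, Category.assoc]
  comp_ident {U P Q} f := by
    ext Z : 2
    have := f.naturality (shiftUnit Z.unop).op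
    simp only [Functor.comp_map, Functor.op_map, Quiver.Hom.unop_op] at this
    change P.map _ ≫ _ ≫ _ = _ ≫ _
    rw [reassoc_of% this]
    simp only [← Q.map_comp, ← op_comp, shiftTensor_unit]
  ident_comp {U P Q} f := by
    ext Z : 2
    change _ ≫ Q.map _ ≫ Q.map _ = _ ≫ Q.map _
    simp only [← Q.map_comp, ← op_comp, unit_shiftTensor]

end Presheaves

/-! ### Modules between enriched categories -/

section Modules

/-- Natural transformations of enriched functors. -/
@[ext]
structure EnrNatTrans (W : Type u) [Category.{v} W] [MonoidalCategory W]
    {A : Type p} [EnrichedCategory W A] {B : Type q} [EnrichedCategory W B]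
    (F G : EnrichedFunctor W A B) where
  app : ∀ a : A, 𝟙_ W ⟶ (F.obj a ⟶[W] G.obj a)
  natural : ∀ a a' : A,
    (λ_ _).inv ≫ (app a ⊗ₘ G.map a a') ≫ eComp W (F.obj a) (G.obj a) (G.obj a') =
      (ρ_ _).inv ≫ (F.map a a' ⊗ₘ app a') ≫ eComp W (F.obj a) (F.obj a') (G.obj a')

variable {W : Type u} [Category.{v} W] [MonoidalCategory W]

/-- A `W`-module `M : A ⇸ B` whose values `M(b, a)` lie in the full subcategory `J : W₀ ↪ W`
(all `W`-modules are obtained by taking `J` to be the identity). -/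
structure EnrModule {W₀ : Type u'} [Category.{v'} W₀] (J : W₀ ⥤ W)
    (A : Type p) [EnrichedCategory W A] (B : Type q) [EnrichedCategory W B] where
  obj : B → A → W₀
  /-- The action `λ : B(b, b') ⊗ M(b', a) → M(b, a)`. -/
  lact : ∀ (b b' : B) (a : A), (b ⟶[W] b') ⊗ J.obj (obj b' a) ⟶ J.obj (obj b a)
  /-- The action `ρ : M(b, a') ⊗ A(a', a) → M(b, a)`. -/
  ract : ∀ (b : B) (a' a : A), J.obj (obj b a') ⊗ (a' ⟶[W] a) ⟶ J.obj (obj b a)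
  lact_unit : ∀ (b : B) (a : A),
    (λ_ _).inv ≫ eId W b ▷ J.obj (obj b a) ≫ lact b b a = 𝟙 _
  lact_assoc : ∀ (b b' b'' : B) (a : A),
    eComp W b b' b'' ▷ J.obj (obj b'' a) ≫ lact b b'' a =
      (α_ _ _ _).hom ≫ (b ⟶[W] b') ◁ lact b' b'' a ≫ lact b b' a
  ract_unit : ∀ (b : B) (a : A),
    (ρ_ _).inv ≫ J.obj (obj b a) ◁ eId W a ≫ ract b a a = 𝟙 _
  ract_assoc : ∀ (b : B) (a'' a' a : A),
    J.obj (obj b a'') ◁ eComp W a'' a' a ≫ ract b a'' a =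
      (α_ _ _ _).inv ≫ ract b a'' a' ▷ (a' ⟶[W] a) ≫ ract b a' a
  lact_ract : ∀ (b b' : B) (a' a : A),
    lact b b' a' ▷ (a' ⟶[W] a) ≫ ract b a' a =
      (α_ _ _ _).hom ≫ (b ⟶[W] b') ◁ ract b' a' a ≫ lact b b' a

namespace EnrModule

variable {W₀ : Type u'} [Category.{v'} W₀] {J : W₀ ⥤ W}
  {A : Type p} [EnrichedCategory W A] {B : Type q} [EnrichedCategory W B]
  {A' : Type p'} [EnrichedCategory W A'] {B' : Type q'} [EnrichedCategory W B']

/-- Transformations of modules. -/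
@[ext]
structure Transformation (M N : EnrModule J A B) where
  app : ∀ (b : B) (a : A), M.obj b a ⟶ N.obj b a
  lact : ∀ (b b' : B) (a : A),
    M.lact b b' a ≫ J.map (app b a) = (b ⟶[W] b') ◁ J.map (app b' a) ≫ N.lact b b' a
  ract : ∀ (b : B) (a' a : A),
    M.ract b a' a ≫ J.map (app b a) = J.map (app b a') ▷ (a' ⟶[W] a) ≫ N.ract b a' a

/-- The category of modules `A ⇸ B`. -/
instance : Category (EnrModule J A B) where
  Hom M N := Transformation M N
  id M :=
    { app := fun _ _ => 𝟙 _
      lact := fun _ _ _ => by simp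
      ract := fun _ _ _ => by simp }
  comp θ κ :=
    { app := fun b a => θ.app b a ≫ κ.app b a
      lact := fun _ _ _ => by simp [reassoc_of% θ.lact, κ.lact]
      ract := fun _ _ _ => by simp [reassoc_of% θ.ract, κ.ract] }
  id_comp _ := Transformation.ext (funext₂ fun _ _ => Category.id_comp _)
  comp_id _ := Transformation.ext (funext₂ fun _ _ => Category.comp_id _)
  assoc _ _ _ := Transformation.ext (funext₂ fun _ _ => Category.assoc _ _ _)

/-- The module `M(G, F)`. -/
def restrict (M : EnrModule J A B) (F : EnrichedFunctor W A' A) (G : EnrichedFunctor W B' B) :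
    EnrModule J A' B' where
  obj b a := M.obj (G.obj b) (F.obj a)
  lact b b' a := G.map b b' ▷ _ ≫ M.lact (G.obj b) (G.obj b') (F.obj a)
  ract b a' a := _ ◁ F.map a' a ≫ M.ract (G.obj b) (F.obj a') (F.obj a)
  lact_unit b a := by
    rw [← comp_whiskerRight_assoc, G.map_id, M.lact_unit]
  lact_assoc b b' b'' a := by
    rw [← comp_whiskerRight_assoc, G.map_comp, comp_whiskerRight, Category.assoc, M.lact_assoc]
    simp only [MonoidalCategory.tensorHom_def]
    simp only [comp_whiskerRight, whisker_assoc, Category.assoc, associator_naturality_left_assoc,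
      Iso.inv_hom_id_assoc, MonoidalCategory.whiskerLeft_comp, whisker_exchange_assoc]
  ract_unit b a := by
    rw [← MonoidalCategory.whiskerLeft_comp_assoc, F.map_id, M.ract_unit]
  ract_assoc b a'' a' a := by
    rw [← MonoidalCategory.whiskerLeft_comp_assoc, F.map_comp, MonoidalCategory.whiskerLeft_comp,
      Category.assoc, M.ract_assoc, MonoidalCategory.tensorHom_def, comp_whiskerRight,
      Category.assoc, ← whisker_exchange_assoc]
    monoidal
  lact_ract b b' a' a := by
    rw [comp_whiskerRight, Category.assoc, ← whisker_exchange_assoc, M.lact_ract,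
      MonoidalCategory.whiskerLeft_comp, Category.assoc, whisker_exchange_assoc,
      whisker_exchange_assoc]
    monoidal

/-- The 2-functor of modules on 1-cells: `M ↦ M(G, F)`. -/
def map (J : W₀ ⥤ W) (F : EnrichedFunctor W A' A) (G : EnrichedFunctor W B' B) :
    EnrModule J A B ⥤ EnrModule J A' B' where
  obj M := M.restrict F G
  map {M N} (θ : Transformation M N) :=
    ({ app := fun b a => θ.app (G.obj b) (F.obj a)
       lact := fun b b' a => by
         have := θ.lact (G.obj b) (G.obj b') (F.obj a)
         simp only [restrict, Category.assoc, this, whisker_exchange_assoc]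
       ract := fun b a' a => by
         have := θ.ract (G.obj b) (F.obj a') (F.obj a)
         simp only [restrict, Category.assoc, this, whisker_exchange_assoc] } :
      Transformation (M.restrict F G) (N.restrict F G))

/-- The action of a generalized element `y : I → B(b, b')` on a module, by way of `λ`. -/
def lelt (M : EnrModule J A B) {b b' : B} (y : 𝟙_ W ⟶ (b ⟶[W] b')) (a : A) :
    J.obj (M.obj b' a) ⟶ J.obj (M.obj b a) :=
  (λ_ _).inv ≫ y ▷ _ ≫ M.lact b b' a

/-- The action of a generalized element `x : I → A(a', a)` on a module, by way of `ρ`. -/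
def relt (M : EnrModule J A B) (b : B) {a' a : A} (x : 𝟙_ W ⟶ (a' ⟶[W] a)) :
    J.obj (M.obj b a') ⟶ J.obj (M.obj b a) :=
  (ρ_ _).inv ≫ _ ◁ x ≫ M.ract b a' a

theorem lact_lelt (M : EnrModule J A B) {b b' b'' : B} (y : 𝟙_ W ⟶ (b ⟶[W] b')) (a : A) :
    M.lact b' b'' a ≫ M.lelt y a =
      ((λ_ _).inv ≫ y ▷ (b' ⟶[W] b'') ≫ eComp W b b' b'') ▷ _ ≫ M.lact b b'' a := by
  rw [comp_whiskerRight, comp_whiskerRight, Category.assoc, Category.assoc, M.lact_assoc, lelt,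
    leftUnitor_inv_naturality_assoc, whisker_exchange_assoc]
  monoidal

theorem whiskerLeft_lelt_lact (M : EnrModule J A B) {b b' b'' : B} (y : 𝟙_ W ⟶ (b' ⟶[W] b''))
    (a : A) :
    (b ⟶[W] b') ◁ M.lelt y a ≫ M.lact b b' a =
      ((ρ_ _).inv ≫ (b ⟶[W] b') ◁ y ≫ eComp W b b' b'') ▷ _ ≫ M.lact b b'' a := by
  rw [comp_whiskerRight, comp_whiskerRight, Category.assoc, Category.assoc, M.lact_assoc, lelt]
  monoidal

theorem ract_lelt (M : EnrModule J A B) {b b' : B} (y : 𝟙_ W ⟶ (b ⟶[W] b')) (a' a : A) :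
    M.ract b' a' a ≫ M.lelt y a = M.lelt y a' ▷ (a' ⟶[W] a) ≫ M.ract b a' a := by
  rw [lelt, lelt, comp_whiskerRight, comp_whiskerRight, Category.assoc, Category.assoc,
    M.lact_ract, leftUnitor_inv_naturality_assoc, whisker_exchange_assoc]
  monoidal

theorem ract_relt (M : EnrModule J A B) (b : B) {a'' a' a : A} (x : 𝟙_ W ⟶ (a' ⟶[W] a)) :
    M.ract b a'' a' ≫ M.relt b x =
      J.obj (M.obj b a'') ◁ ((ρ_ _).inv ≫ (a'' ⟶[W] a') ◁ x ≫ eComp W a'' a' a) ≫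
        M.ract b a'' a := by
  rw [MonoidalCategory.whiskerLeft_comp, MonoidalCategory.whiskerLeft_comp, Category.assoc,
    Category.assoc, M.ract_assoc, relt, rightUnitor_inv_naturality_assoc, ← whisker_exchange_assoc]
  monoidal

theorem whiskerRight_relt_ract (M : EnrModule J A B) (b : B) {a'' a' a : A}
    (x : 𝟙_ W ⟶ (a'' ⟶[W] a')) :
    M.relt b x ▷ (a' ⟶[W] a) ≫ M.ract b a' a =
      J.obj (M.obj b a'') ◁ ((λ_ _).inv ≫ x ▷ (a' ⟶[W] a) ≫ eComp W a'' a' a) ≫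
        M.ract b a'' a := by
  rw [MonoidalCategory.whiskerLeft_comp, MonoidalCategory.whiskerLeft_comp, Category.assoc,
    Category.assoc, M.ract_assoc, relt]
  monoidal

theorem lact_relt (M : EnrModule J A B) (b b' : B) {a' a : A} (x : 𝟙_ W ⟶ (a' ⟶[W] a)) :
    M.lact b b' a' ≫ M.relt b x = (b ⟶[W] b') ◁ M.relt b' x ≫ M.lact b b' a := by
  rw [relt, relt, MonoidalCategory.whiskerLeft_comp, MonoidalCategory.whiskerLeft_comp,
    Category.assoc, Category.assoc, rightUnitor_inv_naturality_assoc, ← whisker_exchange_assoc,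
    M.lact_ract]
  monoidal

theorem Transformation.lelt {M N : EnrModule J A B} (θ : Transformation M N) {b b' : B}
    (y : 𝟙_ W ⟶ (b ⟶[W] b')) (a : A) :
    M.lelt y a ≫ J.map (θ.app b a) = J.map (θ.app b' a) ≫ N.lelt y a := by
  rw [EnrModule.lelt, EnrModule.lelt, Category.assoc, Category.assoc, θ.lact,
    leftUnitor_inv_naturality_assoc, whisker_exchange_assoc]

theorem Transformation.relt {M N : EnrModule J A B} (θ : Transformation M N) (b : B) {a' a : A}
    (x : 𝟙_ W ⟶ (a' ⟶[W] a)) :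
    M.relt b x ≫ J.map (θ.app b a) = J.map (θ.app b a') ≫ N.relt b x := by
  rw [EnrModule.relt, EnrModule.relt, Category.assoc, Category.assoc, θ.ract,
    rightUnitor_inv_naturality_assoc, whisker_exchange_assoc]


/-- The transformation `M(G, F) ⇒ M(G', F)` induced by `ψ : G' ⇒ G`. -/
def map₂L (J : W₀ ⥤ W) [J.Full] [J.Faithful] (F : EnrichedFunctor W A' A)
    {G G' : EnrichedFunctor W B' B} (ψ : EnrNatTrans W G' G) :
    map (A := A) (B := B) J F G ⟶ map J F G' where
  app M :=
    ({ app := fun b a => J.preimage (M.lelt (ψ.app b) (F.obj a))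
       lact := fun b b' a => by
         have h := ψ.natural b b'
         rw [MonoidalCategory.tensorHom_def, MonoidalCategory.tensorHom_def', Category.assoc,
           Category.assoc] at h
         simp only [restrict, Functor.map_preimage, Category.assoc, M.lact_lelt]
         rw [whisker_exchange_assoc, M.whiskerLeft_lelt_lact, ← comp_whiskerRight_assoc,
           ← comp_whiskerRight_assoc]
         congr 2
         rw [leftUnitor_inv_naturality_assoc, rightUnitor_inv_naturality_assoc]
         rw [whisker_exchange_assoc] at h ⊢
         exact h
       ract := fun b a' a => by
         simp only [restrict, Functor.map_preimage, Category.assoc, M.ract_lelt,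
           whisker_exchange_assoc] } :
      Transformation (M.restrict F G) (M.restrict F G'))
  naturality M N (θ : Transformation M N) :=
    Transformation.ext (funext₂ fun b a => J.map_injective (by
      have := θ.lelt (ψ.app b) (F.obj a)
      change J.map (θ.app _ _ ≫ J.preimage _) = J.map (J.preimage _ ≫ θ.app _ _)
      rw [Functor.map_comp, Functor.map_comp, Functor.map_preimage, Functor.map_preimage, this]))

/-- The transformation `M(G, F) ⇒ M(G, F')` induced by `φ : F ⇒ F'`. -/
def map₂R (J : W₀ ⥤ W) [J.Full] [J.Faithful] {F F' : EnrichedFunctor W A' A}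
    (φ : EnrNatTrans W F F') (G : EnrichedFunctor W B' B) :
    map (A := A) (B := B) J F G ⟶ map J F' G where
  app M :=
    ({ app := fun b a => J.preimage (M.relt (G.obj b) (φ.app a))
       lact := fun b b' a => by
         simp only [restrict, Functor.map_preimage, Category.assoc, M.lact_relt,
           whisker_exchange_assoc]
       ract := fun b a' a => by
         have h := φ.natural a' a
         rw [MonoidalCategory.tensorHom_def, MonoidalCategory.tensorHom_def', Category.assoc,
           Category.assoc] at h
         simp only [restrict, Functor.map_preimage, Category.assoc, M.ract_relt]
         rw [← whisker_exchange_assoc, M.whiskerRight_relt_ract,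
           ← MonoidalCategory.whiskerLeft_comp_assoc,
           ← MonoidalCategory.whiskerLeft_comp_assoc]
         congr 2
         rw [leftUnitor_inv_naturality_assoc, rightUnitor_inv_naturality_assoc]
         rw [whisker_exchange_assoc] at h ⊢
         exact h.symm } :
      Transformation (M.restrict F G) (M.restrict F' G))
  naturality M N (θ : Transformation M N) :=
    Transformation.ext (funext₂ fun b a => J.map_injective (by
      have := θ.relt (G.obj b) (φ.app a)
      change J.map (θ.app _ _ ≫ J.preimage _) = J.map (J.preimage _ ≫ θ.app _ _)
      rw [Functor.map_comp, Functor.map_comp, Functor.map_preimage, Functor.map_preimage, this]))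

/-- The 2-functor of modules on 2-cells: `φ : F ⇒ F'` and `ψ : G' ⇒ G` induce
`M(ψ, φ) : M(G, F) ⇒ M(G', F')`. -/
def map₂ (J : W₀ ⥤ W) [J.Full] [J.Faithful] {F F' : EnrichedFunctor W A' A}
    (φ : EnrNatTrans W F F') {G G' : EnrichedFunctor W B' B} (ψ : EnrNatTrans W G' G) :
    map (A := A) (B := B) J F G ⟶ map J F' G' :=
  map₂L J F ψ ≫ map₂R J φ G'

end EnrModule

end Modules

/-! ### Graded categories as categories enriched in presheaves with Day convolution -/

section Day

open scoped MonoidalCategory.ExternalProduct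

variable {V : Type w} [SmallCategory V] [MonoidalCategory V]

variable (V) in
/-- The monoidal category of presheaves of (possibly huge) sets on `V`, under Day convolution. -/
abbrev Psh := Vᵒᵖ ⊛⥤ Type (max w t)

namespace Psh

/-- The universal bilinear map `F x × G y → (F ⊗ G)(x ⊗ y)`. -/
def eta (F G : Psh.{w, t} V) {x y : Vᵒᵖ} (f : F.functor.obj x) (g : G.functor.obj y) :
    (F ⊗ G).functor.obj (x ⊗ y) :=
  (DayFunctor.η F G).app (x, y) (show F.functor.obj x ⊗ G.functor.obj y from (f, g))

variable (V) in
/-- The universal element of the unit presheaf. -/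
def nu : (𝟙_ (Psh.{w, t} V)).functor.obj (𝟙_ Vᵒᵖ) :=
  DayFunctor.ν Vᵒᵖ (Type (max w t)) PUnit.unit

theorem eta_map {F G : Psh.{w, t} V} {x y x' y' : Vᵒᵖ} (u : x ⟶ x') (v : y ⟶ y')
    (f : F.functor.obj x) (g : G.functor.obj y) :
    eta F G (F.functor.map u f) (G.functor.map v g) =
      (F ⊗ G).functor.map (u ⊗ₘ v) (eta F G f g) :=
  types_congr_hom ((DayFunctor.η F G).naturality (X := (x, y)) (Y := (x', y')) (u ×ₘ v)) (f, g)

theorem exists_eta {F G : Psh.{w, t} V} {z : Vᵒᵖ} (k : (F ⊗ G).functor.obj z) :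
    ∃ (x y : Vᵒᵖ) (u : x ⊗ y ⟶ z) (f : F.functor.obj x) (g : G.functor.obj y),
      k = (F ⊗ G).functor.map u (eta F G f g) := by
  obtain ⟨j, p, rfl⟩ := Limits.Types.jointly_surjective_of_isColimit
    (LawfulDayConvolutionMonoidalCategoryStruct.isPointwiseLeftKanExtensionConvolutionExtensionUnit
      (C := Vᵒᵖ) (V := Type (max w t)) F G z) k
  exact ⟨j.left.1, j.left.2, j.hom, p.1, p.2, rfl⟩

theorem eta_ext {F G H : Psh.{w, t} V} {a b : F ⊗ G ⟶ H}
    (h : ∀ (x y : Vᵒᵖ) (f : F.functor.obj x) (g : G.functor.obj y),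
      a.natTrans.app (x ⊗ y) (eta F G f g) = b.natTrans.app (x ⊗ y) (eta F G f g)) : a = b :=
  DayFunctor.tensor_hom_ext fun x y => by
    ext p
    exact h x y p.1 p.2

theorem nu_ext {F : Psh.{w, t} V} {a b : 𝟙_ (Psh.{w, t} V) ⟶ F}
    (h : a.natTrans.app (𝟙_ _) (nu V) = b.natTrans.app (𝟙_ _) (nu V)) : a = b :=
  DayFunctor.unit_hom_ext (by
    ext p
    exact h)

theorem app_map {F G : Psh.{w, t} V} (a : F ⟶ G) {x y : Vᵒᵖ} (u : x ⟶ y) (f : F.functor.obj x) :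
    a.natTrans.app y (F.functor.map u f) = G.functor.map u (a.natTrans.app x f) :=
  types_congr_hom (a.natTrans.naturality u) f

theorem eta_ext₃ {F G H K : Psh.{w, t} V} {a b : (F ⊗ G) ⊗ H ⟶ K}
    (h : ∀ (x y z : Vᵒᵖ) (f : F.functor.obj x) (g : G.functor.obj y) (k : H.functor.obj z),
      a.natTrans.app ((x ⊗ y) ⊗ z) (eta (F ⊗ G) H (eta F G f g) k) =
        b.natTrans.app ((x ⊗ y) ⊗ z) (eta (F ⊗ G) H (eta F G f g) k)) : a = b :=
  eta_ext fun x' z p k => by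
    obtain ⟨x, y, u, f, g, rfl⟩ := exists_eta p
    have := eta_map (F := F ⊗ G) (G := H) u (𝟙 z) (eta F G f g) k
    rw [H.functor.map_id] at this
    change eta _ _ _ k = _ at this
    rw [this, app_map, app_map, h]

theorem tensor_app (F G F' G' : Psh.{w, t} V) (a : F ⟶ F') (b : G ⟶ G') {x y : Vᵒᵖ}
    (f : F.functor.obj x) (g : G.functor.obj y) :
    (a ⊗ₘ b).natTrans.app (x ⊗ y) (eta F G f g) =
      eta F' G' (a.natTrans.app x f) (b.natTrans.app y g) :=
  types_congr_hom
    (LawfulDayConvolutionMonoidalCategoryStruct.convolutionExtensionUnit_comp_ι_map_tensorHom_app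
      Vᵒᵖ (Type (max w t)) a b x y) _

theorem whiskerLeft_app (F G G' : Psh.{w, t} V) (b : G ⟶ G') {x y : Vᵒᵖ}
    (f : F.functor.obj x) (g : G.functor.obj y) :
    (F ◁ b).natTrans.app (x ⊗ y) (eta F G f g) = eta F G' f (b.natTrans.app y g) :=
  types_congr_hom
    (LawfulDayConvolutionMonoidalCategoryStruct.convolutionExtensionUnit_comp_ι_map_whiskerLeft_app
      (Type (max w t)) F b x y) _

theorem whiskerRight_app (F F' G : Psh.{w, t} V) (a : F ⟶ F') {x y : Vᵒᵖ}
    (f : F.functor.obj x) (g : G.functor.obj y) :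
    (a ▷ G).natTrans.app (x ⊗ y) (eta F G f g) = eta F' G (a.natTrans.app x f) g :=
  types_congr_hom
    (LawfulDayConvolutionMonoidalCategoryStruct.convolutionExtensionUnit_comp_ι_map_whiskerRight_app
      Vᵒᵖ (Type (max w t)) a G x y) _

theorem associator_app (F G H : Psh.{w, t} V) {x y z : Vᵒᵖ}
    (f : F.functor.obj x) (g : G.functor.obj y) (k : H.functor.obj z) :
    (α_ F G H).hom.natTrans.app ((x ⊗ y) ⊗ z) (eta (F ⊗ G) H (eta F G f g) k) =
      (F ⊗ (G ⊗ H)).functor.map (α_ x y z).inv (eta F (G ⊗ H) f (eta G H g k)) :=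
  types_congr_hom
    (LawfulDayConvolutionMonoidalCategoryStruct.associator_hom_unit_unit
      (Type (max w t)) F G H x y z) ((f, g), k)

theorem leftUnitor_app (F : Psh.{w, t} V) {y : Vᵒᵖ} (f : F.functor.obj y) :
    (λ_ F).hom.natTrans.app (𝟙_ Vᵒᵖ ⊗ y) (eta (𝟙_ _) F (nu V) f) = F.functor.map (λ_ y).inv f :=
  types_congr_hom
    (LawfulDayConvolutionMonoidalCategoryStruct.leftUnitor_hom_unit_app
      (Type (max w t)) F y) (PUnit.unit, f)

theorem rightUnitor_app (F : Psh.{w, t} V) {y : Vᵒᵖ} (f : F.functor.obj y) :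
    (ρ_ F).hom.natTrans.app (y ⊗ 𝟙_ Vᵒᵖ) (eta F (𝟙_ _) f (nu V)) = F.functor.map (ρ_ y).inv f :=
  types_congr_hom
    (LawfulDayConvolutionMonoidalCategoryStruct.rightUnitor_hom_unit_app
      (Type (max w t)) F y) (f, PUnit.unit)

theorem comp_app {F G H : Psh.{w, t} V} (a : F ⟶ G) (b : G ⟶ H) {x : Vᵒᵖ}
    (f : F.functor.obj x) :
    (a ≫ b).natTrans.app x f = b.natTrans.app x (a.natTrans.app x f) := rfl

theorem map_map (F : Psh.{w, t} V) {x y z : Vᵒᵖ} (u : x ⟶ y) (v : y ⟶ z) (f : F.functor.obj x) :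
    F.functor.map v (F.functor.map u f) = F.functor.map (u ≫ v) f :=
  (types_congr_hom (F.functor.map_comp u v) f).symm

theorem map_id (F : Psh.{w, t} V) {x : Vᵒᵖ} (f : F.functor.obj x) : F.functor.map (𝟙 x) f = f :=
  types_congr_hom (F.functor.map_id x) f

theorem hom_ext' {F G : Psh.{w, t} V} {a b : F ⟶ G}
    (h : ∀ (x : Vᵒᵖ) (f : F.functor.obj x), a.natTrans.app x f = b.natTrans.app x f) : a = b := by
  ext x f
  exact h x f

theorem leftUnitor_inv_app (F : Psh.{w, t} V) {y : Vᵒᵖ} (f : F.functor.obj y) :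
    (λ_ F).inv.natTrans.app y f =
      (𝟙_ _ ⊗ F).functor.map (λ_ y).hom (eta (𝟙_ _) F (nu V) f) := by
  have h := congrArg ((λ_ F).inv.natTrans.app y)
    (congrArg (F.functor.map (λ_ y).hom) (leftUnitor_app F f))
  rw [map_map, Iso.inv_hom_id, map_id, ← app_map, ← comp_app, Iso.hom_inv_id] at h
  exact h.symm

theorem rightUnitor_inv_app (F : Psh.{w, t} V) {y : Vᵒᵖ} (f : F.functor.obj y) :
    (ρ_ F).inv.natTrans.app y f =
      (F ⊗ 𝟙_ _).functor.map (ρ_ y).hom (eta F (𝟙_ _) f (nu V)) := by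
  have h := congrArg ((ρ_ F).inv.natTrans.app y)
    (congrArg (F.functor.map (ρ_ y).hom) (rightUnitor_app F f))
  rw [map_map, Iso.inv_hom_id, map_id, ← app_map, ← comp_app, Iso.hom_inv_id] at h
  exact h.symm

theorem tensorDesc_app {F G H : Psh.{w, t} V}
    (a : F.functor ⊠ G.functor ⟶ tensor Vᵒᵖ ⋙ H.functor) {x y : Vᵒᵖ}
    (f : F.functor.obj x) (g : G.functor.obj y) :
    (DayFunctor.tensorDesc a).natTrans.app (x ⊗ y) (eta F G f g) = a.app (x, y) (f, g) :=
  types_congr_hom (DayFunctor.η_comp_tensorDesc_app a x y) (f, g)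

theorem unitDesc_app {F : Psh.{w, t} V} (a : 𝟙_ (Type (max w t)) ⟶ F.functor.obj (𝟙_ Vᵒᵖ)) :
    (DayFunctor.unitDesc a).natTrans.app (𝟙_ Vᵒᵖ) (nu V) = a PUnit.unit :=
  types_congr_hom (DayFunctor.ν_comp_unitDesc a) PUnit.unit

end Psh

/-- The right `V̂`-category corresponding to the right `V`-graded category `A`: its hom-objects are
the presheaves `X ↦ A(X; a, a')`, and composition and identities are induced by those of `A`. -/
def RightGradedCat.Enriched (A : RightGradedCat.{o, max w t} V) : Type o := A.Obj

namespace RightGradedCat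

variable (A : RightGradedCat.{o, max w t} V)

/-- The presheaf of graded morphisms from `a` to `a'`. -/
def homPsh (a a' : A.Obj) : Psh.{w, t} V where
  functor :=
    { obj := fun X => A.Hom (mop X.unop) a a'
      map := fun u => ↾(fun f => A.reindex u.unop.mop f)
      map_id := fun X => by
        ext f
        exact A.reindex_id f
      map_comp := fun u v => by
        ext f
        exact A.reindex_comp v.unop.mop u.unop.mop f }

/-- Composition `A(a, b) ⊗ A(b, c) → A(a, c)`, determined by `(f, g) ↦ g ∘ f`. -/
def compPsh (a b c : A.Obj) : homPsh.{o, w, t} A a b ⊗ homPsh A b c ⟶ homPsh A a c :=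
  DayFunctor.tensorDesc
    { app := fun _ => ↾(fun p => A.comp p.2 p.1)
      naturality := fun _ _ u => by
        ext p
        exact A.comp_natural u.1.unop.mop u.2.unop.mop p.2 p.1 }

/-- The identity `I → A(a, a)`. -/
def idPsh (a : A.Obj) : 𝟙_ (Psh.{w, t} V) ⟶ homPsh A a a :=
  DayFunctor.unitDesc (↾(fun _ => A.ident a))

theorem compPsh_app {a b c : A.Obj} {x y : Vᵒᵖ} (f : (homPsh.{o, w, t} A a b).functor.obj x)
    (g : (homPsh.{o, w, t} A b c).functor.obj y) :
    (compPsh A a b c).natTrans.app (x ⊗ y) (Psh.eta _ _ f g) =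
      A.comp (X := mop x.unop) (Y := mop y.unop) g f :=
  Psh.tensorDesc_app _ f g

theorem idPsh_app (a : A.Obj) :
    (idPsh.{o, w, t} A a).natTrans.app (𝟙_ _) (Psh.nu V) = A.ident a :=
  Psh.unitDesc_app _

theorem idPsh_comp (a b : A.Obj) :
    (λ_ _).inv ≫ idPsh.{o, w, t} A a ▷ homPsh.{o, w, t} A a b ≫ compPsh.{o, w, t} A a a b = 𝟙 _ :=
  Psh.hom_ext' fun x f => by
    rw [Psh.comp_app, Psh.comp_app, Psh.leftUnitor_inv_app, Psh.app_map, Psh.app_map,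
      Psh.whiskerRight_app, compPsh_app, idPsh_app]
    refine (congrArg (A.reindex _) (A.comp_ident f)).trans ((A.reindex_reindex _ _ _).trans ?_)
    refine Eq.trans ?_ (A.reindex_id f)
    congr 1
    exact congrArg (fun u => Quiver.Hom.mop u) (Iso.inv_hom_id (λ_ x.unop))

theorem comp_idPsh (a b : A.Obj) :
    (ρ_ _).inv ≫ homPsh.{o, w, t} A a b ◁ idPsh.{o, w, t} A b ≫ compPsh.{o, w, t} A a b b = 𝟙 _ :=
  Psh.hom_ext' fun x f => by
    rw [Psh.comp_app, Psh.comp_app, Psh.rightUnitor_inv_app, Psh.app_map, Psh.app_map,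
      Psh.whiskerLeft_app, compPsh_app, idPsh_app]
    refine (congrArg (A.reindex _) (A.ident_comp f)).trans ((A.reindex_reindex _ _ _).trans ?_)
    refine Eq.trans ?_ (A.reindex_id f)
    congr 1
    exact congrArg (fun u => Quiver.Hom.mop u) (Iso.inv_hom_id (ρ_ x.unop))

theorem compPsh_assoc_left (a b c d : A.Obj) {x y z : Vᵒᵖ}
    (f : (homPsh.{o, w, t} A a b).functor.obj x) (g : (homPsh.{o, w, t} A b c).functor.obj y)
    (k : (homPsh.{o, w, t} A c d).functor.obj z) :
    (compPsh.{o, w, t} A a b c ▷ homPsh.{o, w, t} A c d ≫ compPsh.{o, w, t} A a c d).natTrans.app ((x ⊗ y) ⊗ z)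
      (Psh.eta _ _ (Psh.eta _ _ f g) k) =
    A.comp (X := mop (x ⊗ y).unop) (Y := mop z.unop) k
      (A.comp (X := mop x.unop) (Y := mop y.unop) g f) := by
  rw [Psh.comp_app, Psh.whiskerRight_app, compPsh_app, compPsh_app]

theorem compPsh_assoc_right (a b c d : A.Obj) {x y z : Vᵒᵖ}
    (f : (homPsh.{o, w, t} A a b).functor.obj x) (g : (homPsh.{o, w, t} A b c).functor.obj y)
    (k : (homPsh.{o, w, t} A c d).functor.obj z) :
    ((α_ _ _ _).hom ≫ homPsh.{o, w, t} A a b ◁ compPsh.{o, w, t} A b c d ≫ compPsh.{o, w, t} A a b d).natTrans.app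
      ((x ⊗ y) ⊗ z) (Psh.eta _ _ (Psh.eta _ _ f g) k) =
    A.reindex (α_ x y z).inv.unop.mop (A.comp (X := mop x.unop) (Y := mop (y ⊗ z).unop)
      (A.comp (X := mop y.unop) (Y := mop z.unop) k g) f) := by
  rw [Psh.comp_app, Psh.comp_app, Psh.associator_app, Psh.app_map, Psh.app_map,
    Psh.whiskerLeft_app, compPsh_app, compPsh_app]
  rfl

theorem compPsh_assoc (a b c d : A.Obj) :
    compPsh.{o, w, t} A a b c ▷ homPsh.{o, w, t} A c d ≫ compPsh.{o, w, t} A a c d =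
      (α_ _ _ _).hom ≫ homPsh.{o, w, t} A a b ◁ compPsh.{o, w, t} A b c d ≫ compPsh.{o, w, t} A a b d :=
  Psh.eta_ext₃ fun x y z f g k => by
    rw [compPsh_assoc_left, compPsh_assoc_right]
    refine Eq.trans ?_ (congrArg (A.reindex _) (A.assoc (X := mop x.unop) (Y := mop y.unop)
      (Z := mop z.unop) k g f)).symm
    refine Eq.trans ?_ (A.reindex_reindex _ _ _).symm
    refine (A.reindex_id _).symm.trans ?_
    congr 1
    exact congrArg (fun u => Quiver.Hom.mop u)
      (Iso.hom_inv_id (α_ x.unop y.unop z.unop)).symm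

theorem compPsh_assoc' (a b c d : A.Obj) :
    (α_ _ _ _).inv ≫ compPsh.{o, w, t} A a b c ▷ homPsh.{o, w, t} A c d ≫
        compPsh.{o, w, t} A a c d =
      homPsh.{o, w, t} A a b ◁ compPsh.{o, w, t} A b c d ≫ compPsh.{o, w, t} A a b d :=
  (Iso.inv_comp_eq _).mpr (compPsh_assoc.{o, w, t} A a b c d)

instance : EnrichedCategory (Psh.{w, t} V) (RightGradedCat.Enriched.{o, w, t} A) where
  Hom a a' := homPsh.{o, w, t} A a a'
  id a := idPsh.{o, w, t} A a
  comp a b c := compPsh.{o, w, t} A a b c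
  id_comp a b := idPsh_comp.{o, w, t} A a b
  comp_id a b := comp_idPsh.{o, w, t} A a b
  assoc a b c d := compPsh_assoc'.{o, w, t} A a b c d

end RightGradedCat

/-- The right `V̂`-functor corresponding to a right `V`-graded functor. -/
def GradedFunctor.enriched {A B : RightGradedCat.{o, max w t} V} (F : GradedFunctor A B) :
    EnrichedFunctor (Psh.{w, t} V) (RightGradedCat.Enriched.{o, w, t} A)
      (RightGradedCat.Enriched.{o, w, t} B) where
  obj := F.obj
  map a a' :=
    ⟨{ app := fun X => ↾(fun f => F.map (X := mop X.unop) f)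
       naturality := fun _ _ u => by
         ext f
         exact F.isGraded.map_reindex u.unop.mop f }⟩
  map_id a := Psh.nu_ext (by
    refine (Psh.comp_app _ _ _).trans ?_
    refine (congrArg _ (RightGradedCat.idPsh_app.{o, w, t} A a)).trans ?_
    refine Eq.trans ?_ (RightGradedCat.idPsh_app.{o, w, t} B _).symm
    exact F.isGraded.map_ident a)
  map_comp a b c := Psh.eta_ext fun x y f g => by
    refine (Psh.comp_app _ _ _).trans ?_
    refine (congrArg _ (RightGradedCat.compPsh_app.{o, w, t} A f g)).trans ?_
    refine Eq.trans ?_ (Psh.comp_app _ _ _).symm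
    refine Eq.trans ?_ (congrArg _ (Psh.tensor_app _ _ _ _ _ _ f g).symm)
    refine Eq.trans ?_ (RightGradedCat.compPsh_app.{o, w, t} B _ _).symm
    exact F.isGraded.map_comp g f

/-- The right `V̂`-natural transformation corresponding to a right graded-natural one. -/
def GradedNat.enriched {A B : RightGradedCat.{o, max w t} V} {F G : GradedFunctor A B}
    (θ : GradedNat F G) :
    EnrNatTrans (Psh.{w, t} V) (GradedFunctor.enriched.{o, w, t} F)
      (GradedFunctor.enriched.{o, w, t} G) where
  app a := DayFunctor.unitDesc (↾(fun _ => θ.app a))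
  natural a a' := Psh.hom_ext' fun x f => by
    have hu : ∀ a : A.Obj, (DayFunctor.unitDesc (F := RightGradedCat.homPsh.{o, w, t} B (F.obj a)
        (G.obj a)) (↾(fun _ => θ.app a))).natTrans.app (𝟙_ _) (Psh.nu V) = θ.app a :=
      fun a => Psh.unitDesc_app _
    refine (Psh.comp_app _ _ _).trans ?_
    refine Eq.trans ?_ (Psh.comp_app _ _ _).symm
    refine (congrArg _ (Psh.leftUnitor_inv_app _ f)).trans ?_
    refine Eq.trans ?_ (congrArg _ (Psh.rightUnitor_inv_app _ f)).symm
    refine (Psh.app_map _ _ _).trans ?_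
    refine Eq.trans ?_ (Psh.app_map _ _ _).symm
    refine (congrArg _ (Psh.comp_app _ _ _)).trans ?_
    refine Eq.trans ?_ (congrArg _ (Psh.comp_app _ _ _)).symm
    refine (congrArg _ (congrArg _ (Psh.tensor_app _ _ _ _ _ _ _ f))).trans ?_
    refine Eq.trans ?_ (congrArg _ (congrArg _ (Psh.tensor_app _ _ _ _ _ _ f _))).symm
    refine (congrArg _ (RightGradedCat.compPsh_app.{o, w, t} B _ _)).trans ?_
    refine Eq.trans ?_ (congrArg _ (RightGradedCat.compPsh_app.{o, w, t} B _ _)).symm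
    refine (congrArg (fun z => B.reindex (λ_ x).hom.unop.mop
      (B.comp (X := 𝟙_ Vᴹᵒᵖ) (Y := mop x.unop) (G.map f) z)) (hu a)).trans ?_
    refine Eq.trans ?_ (congrArg (fun z => B.reindex (ρ_ x).hom.unop.mop
      (B.comp (X := mop x.unop) (Y := 𝟙_ Vᴹᵒᵖ) z (F.map f))) (hu a')).symm
    exact (θ.natural (X := mop x.unop) f).symm

variable (V) in
/-- The inclusion of `V̂`, the category of presheaves valued in `SET`, into the category of
presheaves of possibly huge sets. -/
def inclPsh : (Vᵒᵖ ⥤ Type w) ⥤ Psh.{w, t} V :=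
  (Functor.whiskeringRight Vᵒᵖ _ _).obj uliftFunctor.{t, w} ⋙ (DayFunctor.equiv _ _).inverse

instance : (inclPsh.{w, t} V).Full := by
  unfold inclPsh
  infer_instance

instance : (inclPsh.{w, t} V).Faithful := by
  unfold inclPsh
  infer_instance

end Day

/-! ### Formal opposites of enriched categories, and left `V̂`-categories -/

section EnrichedOpposites

/-- The formal opposite of a `W`-category `A`, a category enriched in the reverse `Wᴹᵒᵖ`. -/
def EnrOp (W : Type u) [Category.{v} W] [MonoidalCategory W] (A : Type p) [EnrichedCategory W A] :
    Type p := A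

variable {W : Type u} [Category.{v} W] [MonoidalCategory W]

instance (A : Type p) [EnrichedCategory W A] : EnrichedCategory Wᴹᵒᵖ (EnrOp W A) where
  Hom a b := mop (EnrichedCategory.Hom (V := W) (C := A) b a)
  id a := (eId W (C := A) a).mop
  comp a b c := (eComp W (C := A) c b a).mop
  id_comp a b := congrArg Quiver.Hom.mop (e_comp_id W (C := A) b a)
  comp_id a b := congrArg Quiver.Hom.mop (e_id_comp W (C := A) b a)
  assoc a b c d := congrArg Quiver.Hom.mop (e_assoc' W (C := A) d c b a)

/-- The formal opposite of an enriched functor. -/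
def enrOpFunctor {A : Type p} [EnrichedCategory W A] {B : Type q} [EnrichedCategory W B]
    (F : EnrichedFunctor W A B) : EnrichedFunctor Wᴹᵒᵖ (EnrOp W A) (EnrOp W B) where
  obj := F.obj
  map a b := (F.map (show A from b) (show A from a)).mop
  map_id a := congrArg Quiver.Hom.mop (F.map_id a)
  map_comp a b c := congrArg Quiver.Hom.mop (F.map_comp c b a)

/-- The formal opposite of an enriched-natural transformation. -/
def EnrNatTrans.enrOp {A : Type p} [EnrichedCategory W A] {B : Type q} [EnrichedCategory W B]
    {F G : EnrichedFunctor W A B} (θ : EnrNatTrans W F G) :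
    EnrNatTrans Wᴹᵒᵖ (enrOpFunctor G) (enrOpFunctor F) where
  app a := (θ.app a).mop
  natural a b := congrArg Quiver.Hom.mop (θ.natural b a).symm

end EnrichedOpposites

section Left

variable {V : Type w} [SmallCategory V] [MonoidalCategory V]

/-- The left `V̂`-category (that is, `V̂ᴹᵒᵖ`-category in the convention of `EnrichedCategory`)
corresponding to the left `V`-graded category `A`: its hom-objects are the presheaves
`X ↦ A(X; a, a')`. -/
abbrev GradedCat.LeftEnriched (A : GradedCat.{o, max w t} V) : Type o :=
  EnrOp (Psh.{w, t} V) (RightGradedCat.Enriched.{o, w, t} A.formalOp)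

/-- The left `V̂`-functor corresponding to a left `V`-graded functor. -/
abbrev GradedFunctor.leftEnriched {A B : GradedCat.{o, max w t} V} (F : GradedFunctor A B) :
    EnrichedFunctor (Psh.{w, t} V)ᴹᵒᵖ (GradedCat.LeftEnriched.{o, w, t} A)
      (GradedCat.LeftEnriched.{o, w, t} B) :=
  enrOpFunctor (GradedFunctor.enriched.{o, w, t} F.formalOp)

/-- The left `V̂`-natural transformation corresponding to a left graded-natural one. -/
abbrev GradedNat.leftEnriched {A B : GradedCat.{o, max w t} V} {F G : GradedFunctor A B}
    (θ : GradedNat F G) :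
    EnrNatTrans (Psh.{w, t} V)ᴹᵒᵖ (GradedFunctor.leftEnriched.{o, w, t} F)
      (GradedFunctor.leftEnriched.{o, w, t} G) :=
  (GradedNat.enriched.{o, w, t} θ.formalOp).enrOp

variable (V) in
/-- The inclusion of `V̂` into the reverse of the category of presheaves of huge sets. -/
abbrev inclPshRev : (Vᵒᵖ ⥤ Type w) ⥤ (Psh.{w, t} V)ᴹᵒᵖ :=
  inclPsh.{w, t} V ⋙ mopFunctor _

instance : (inclPshRev.{w, t} V).Full :=
  inferInstanceAs (inclPsh.{w, t} V ⋙ (mopEquiv (Psh.{w, t} V)).functor).Full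

instance : (inclPshRev.{w, t} V).Faithful :=
  inferInstanceAs (inclPsh.{w, t} V ⋙ (mopEquiv (Psh.{w, t} V)).functor).Faithful

end Left

/-! ### The 2-functors and their 2-natural isomorphisms -/

section TwoFunctors

/-- The data of a 2-functor `𝒢^op × 𝒢^coop → CAT`, where `𝒢` is the 2-category of left
`U`-graded categories. -/
structure TwoFunctorData (U : Type u) [Category.{v} U] [MonoidalCategory U] where
  obj : GradedCat.{o, h} U → GradedCat.{o, h} U → Type p
  cat : ∀ A B, Category.{q} (obj A B)
  map : ∀ {A A' B B' : GradedCat.{o, h} U},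
    GradedFunctor A' A → GradedFunctor B' B → obj A B ⥤ obj A' B'
  map₂ : ∀ {A A' B B' : GradedCat.{o, h} U} {F F' : GradedFunctor A' A} {G G' : GradedFunctor B' B},
    GradedNat F F' → GradedNat G' G → (map F G ⟶ map F' G')

attribute [instance] TwoFunctorData.cat

/-- A 2-natural isomorphism, i.e. a family of isomorphisms of categories `S(A, B) ≅ T(A, B)`
that is natural with respect to 1-cells and 2-cells in both variables. -/
structure TwoNatIso {U : Type u} [Category.{v} U] [MonoidalCategory U]
    (S : TwoFunctorData.{o, h, v, u, p, q} U) (T : TwoFunctorData.{o, h, v, u, p', q'} U) where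
  hom : ∀ A B : GradedCat.{o, h} U, S.obj A B ⥤ T.obj A B
  inv : ∀ A B : GradedCat.{o, h} U, T.obj A B ⥤ S.obj A B
  hom_inv : ∀ A B, hom A B ⋙ inv A B = 𝟭 _
  inv_hom : ∀ A B, inv A B ⋙ hom A B = 𝟭 _
  natural : ∀ {A A' B B' : GradedCat.{o, h} U} (F : GradedFunctor A' A) (G : GradedFunctor B' B),
    S.map F G ⋙ hom A' B' = hom A B ⋙ T.map F G
  natural₂ : ∀ {A A' B B' : GradedCat.{o, h} U} {F F' : GradedFunctor A' A}
    {G G' : GradedFunctor B' B} (φ : GradedNat F F') (ψ : GradedNat G' G),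
    Functor.whiskerRight (S.map₂ φ ψ) (hom A' B') =
      eqToHom (natural F G) ≫ Functor.whiskerLeft (hom A B) (T.map₂ φ ψ) ≫
        eqToHom (natural F' G').symm

variable (V : Type w) [SmallCategory V] [MonoidalCategory V]

/-- `GMOD_V(A, B)`, the category of `V̂`-modules `A ⇸ B`, for right `V`-graded `A` and `B`. -/
def gmodRight : TwoFunctorData.{o, max w t} Vᴹᵒᵖ where
  obj A B := EnrModule (inclPsh.{w, t} V) (RightGradedCat.Enriched.{o, w, t} A)
    (RightGradedCat.Enriched.{o, w, t} B)
  cat _ _ := inferInstance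
  map F G := EnrModule.map (inclPsh.{w, t} V) (GradedFunctor.enriched.{o, w, t} F)
    (GradedFunctor.enriched.{o, w, t} G)
  map₂ φ ψ := EnrModule.map₂ (inclPsh.{w, t} V) (GradedNat.enriched.{o, w, t} φ)
    (GradedNat.enriched.{o, w, t} ψ)

/-- The category of `V̂`-modules `A ⇸ B`, for left `V`-graded `A` and `B`. -/
def gmodLeft : TwoFunctorData.{o, max w t} V where
  obj A B := EnrModule (inclPshRev.{w, t} V) (GradedCat.LeftEnriched.{o, w, t} A)
    (GradedCat.LeftEnriched.{o, w, t} B)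
  cat _ _ := inferInstance
  map F G := EnrModule.map (inclPshRev.{w, t} V) (GradedFunctor.leftEnriched.{o, w, t} F)
    (GradedFunctor.leftEnriched.{o, w, t} G)
  map₂ φ ψ := EnrModule.map₂ (inclPshRev.{w, t} V) (GradedNat.leftEnriched.{o, w, t} φ)
    (GradedNat.leftEnriched.{o, w, t} ψ)

/-- `(A, B) ↦ GBIF(B°, A; V̂)`, for right `V`-graded `A` and `B`. -/
def gbifRight : TwoFunctorData.{o, h} Vᴹᵒᵖ where
  obj A B := GradedBifunctor (RightGradedCat.formalOp B) A (presheaves V)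
  cat _ _ := inferInstance
  map F G := GBif.map (presheaves V) G.rightFormalOp F
  map₂ φ ψ := GBif.map₂ (presheaves V) ψ.rightFormalOp φ

/-- `(A, B) ↦ GBIF(A, B°; V̂)`, for left `V`-graded `A` and `B`. -/
def gbifLeft : TwoFunctorData.{o, h} V where
  obj A B := GradedBifunctor A B.formalOp (presheaves V)
  cat _ _ := inferInstance
  map F G := GBif.map (presheaves V) F G.formalOp
  map₂ φ ψ := GBif.map₂ (presheaves V) φ ψ.formalOp

/-- `(A, B) ↦ GCAT(B° ⊠ A, V̂)`, for right `V`-graded `A` and `B`. -/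
def gcatRight : TwoFunctorData.{o, h} Vᴹᵒᵖ where
  obj A B := GradedFunctor (boxProd (RightGradedCat.formalOp B) A) (presheaves V)
  cat _ _ := inferInstance
  map F G := precomp (boxMap G.rightFormalOp F) (presheaves V)
  map₂ φ ψ := precompWhisker (boxMap₂ ψ.rightFormalOp φ) (presheaves V)

/-- `(A, B) ↦ GCAT(A ⊠ B°, V̂)`, for left `V`-graded `A` and `B`. -/
def gcatLeft : TwoFunctorData.{o, h} V where
  obj A B := GradedFunctor (boxProd A B.formalOp) (presheaves V)
  cat _ _ := inferInstance
  map F G := precomp (boxMap F G.formalOp) (presheaves V)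
  map₂ φ ψ := precompWhisker (boxMap₂ φ ψ.formalOp) (presheaves V)

end TwoFunctors

end VGraded

end

-- The heart of the theorem is the universal property of Day convolution. A morphism `H ⊗ P → Q` of
-- presheaves is the same as a natural family of maps `H(X) × P(Z) → Q(X ⊗ Z)`. For `H = B(b, b')`
-- this assigns to each `f ∈ B(X; b, b')` a natural family `M(b', a)(Z) → M(b, a)(X ⊗ Z)`, which up
-- to a unitor is a graded morphism `M(b', a) → M(b, a)` of `V̂` of grade `(X, I)`. Thus a left
-- action is an assignment on graded morphisms of `B°`, and in the same way a right action is an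
-- assignment sending graded morphisms of `A` to graded morphisms of `V̂` of grade `(I, X)`.
-- Naturality in the grade is preservation of reindexing. The unit and associativity axioms are
-- preservation of identities and composition (`lunit_iff`, `lassoc_iff` and their right-hand
-- versions). Commutation of the two actions is the bigraded square (`lrassoc_iff` against
-- `isBigradedSquare_iff`). A graded morphism of grade `(I, I)` is a morphism of presheaves
-- (`ofHom`, `toHom`), and graded naturality on each side is compatibility with the corresponding
-- action. A 2-cell has components of grade `I`, and both constructions let it act through those
-- elements (`ofHom_map₂_app`).
--
-- Bifunctors `A, B → C` are functors `A ⊠ B → C` because a pair `(f, g)` is the composite of `(f,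
-- id)` and `(id, g)` up to unitors. Defining the value at `(f, g)` as `F(a', g) ∘ F(f, b)`, the
-- squares supply the interchange needed for functoriality (`comp_interchange`), and restriction to
-- pairs with an identity gives the inverse.
--
-- The statements for left graded categories follow by duality. Modules over a reversed monoidal
-- category are modules in the opposite direction over the original one, so left modules `A ⇸ B` are
-- right modules `B° ⇸ A°`. Double formal opposites are trivial, so the right-hand isomorphisms
-- transport.
--
-- Each isomorphism of categories is built from a fully faithful functor that is bijective on
-- objects. Equality of objects, rather than isomorphism, is available because corresponding data
-- have the same underlying presheaves.

universe p'' q''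

noncomputable section

open CategoryTheory MonoidalCategory Opposite MonoidalOpposite
open scoped DayFunctor CategoryTheory.Prod

namespace VGraded

/-! ### Constructing and combining 2-natural isomorphisms -/

section StrictInverse

variable {C : Type u} [Category.{v} C] {D : Type u'} [Category.{v'} D]

/-- The strict inverse of a fully faithful functor that is bijective on objects. -/
def strictInverse (F : C ⥤ D) [F.Full] [F.Faithful] (g : D → C) (hg : ∀ d, F.obj (g d) = d) :
    D ⥤ C where
  obj := g
  map {d d'} f := F.preimage (eqToHom (hg d) ≫ f ≫ eqToHom (hg d').symm)
  map_id d := F.map_injective (by simp)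
  map_comp f f' := F.map_injective (by simp)

/-- As `F` is faithful, agreement on morphisms can be tested after applying `F`; there the preimage
cancels and only transports along object equalities remain. -/
theorem comp_strictInverse (F : C ⥤ D) [F.Full] [F.Faithful] (g : D → C)
    (hg : ∀ d, F.obj (g d) = d) (hg' : ∀ c, g (F.obj c) = c) : F ⋙ strictInverse F g hg = 𝟭 C :=
  CategoryTheory.Functor.ext hg' fun c c' f => F.map_injective (by
    change F.map (F.preimage _) = F.map (eqToHom (hg' c) ≫ f ≫ eqToHom (hg' c').symm)
    rw [F.map_preimage, F.map_comp, F.map_comp, eqToHom_map F, eqToHom_map F])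

theorem strictInverse_comp (F : C ⥤ D) [F.Full] [F.Faithful] (g : D → C)
    (hg : ∀ d, F.obj (g d) = d) : strictInverse F g hg ⋙ F = 𝟭 D :=
  CategoryTheory.Functor.ext hg fun d d' f => by simp [strictInverse]

end StrictInverse

section TwoNatIso

variable {U : Type u} [Category.{v} U] [MonoidalCategory U]

/-- A 2-natural isomorphism from a 2-natural family of fully faithful functors that are bijective
on objects. -/
def TwoNatIso.ofFullyFaithful
    {S : TwoFunctorData.{o, h, v, u, p, q} U} {T : TwoFunctorData.{o, h, v, u, p', q'} U}
    (hom : ∀ A B : GradedCat.{o, h} U, S.obj A B ⥤ T.obj A B)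
    [full : ∀ A B, (hom A B).Full] [faithful : ∀ A B, (hom A B).Faithful]
    (inv : ∀ A B, T.obj A B → S.obj A B) (hom_inv : ∀ A B M, inv A B ((hom A B).obj M) = M)
    (inv_hom : ∀ A B N, (hom A B).obj (inv A B N) = N)
    (natural : ∀ {A A' B B' : GradedCat.{o, h} U} (F : GradedFunctor A' A)
      (G : GradedFunctor B' B), S.map F G ⋙ hom A' B' = hom A B ⋙ T.map F G)
    (natural₂ : ∀ {A A' B B' : GradedCat.{o, h} U} {F F' : GradedFunctor A' A}
      {G G' : GradedFunctor B' B} (φ : GradedNat F F') (ψ : GradedNat G' G) (M : S.obj A B),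
      HEq ((hom A' B').map ((S.map₂ φ ψ).app M)) ((T.map₂ φ ψ).app ((hom A B).obj M))) :
    TwoNatIso S T where
  hom := hom
  inv A B := strictInverse (hom A B) (inv A B) (inv_hom A B)
  hom_inv A B := comp_strictInverse _ _ _ (hom_inv A B)
  inv_hom A B := strictInverse_comp _ _ _
  natural := natural
  natural₂ {A A' B B' F F' G G'} φ ψ := by
    ext M
    simp only [Functor.whiskerRight_app, NatTrans.comp_app, eqToHom_app,
      Functor.whiskerLeft_app]
    -- Conjugation by transports along equalities of objects amounts to heterogeneous equality,
    -- which is the form in which `natural₂` is supplied.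
    exact (conj_eqToHom_iff_heq _ _ (Functor.congr_obj (natural F G) M)
      (Functor.congr_obj (natural F' G') M)).2 (natural₂ φ ψ M)

/-- Composition of 2-natural isomorphisms. -/
def TwoNatIso.trans {S : TwoFunctorData.{o, h, v, u, p, q} U}
    {T : TwoFunctorData.{o, h, v, u, p', q'} U} {R : TwoFunctorData.{o, h, v, u, p'', q''} U}
    (e : TwoNatIso S T) (e' : TwoNatIso T R) : TwoNatIso S R where
  hom A B := e.hom A B ⋙ e'.hom A B
  inv A B := e'.inv A B ⋙ e.inv A B
  hom_inv A B := by
    rw [Functor.assoc, ← Functor.assoc (e'.hom A B), e'.hom_inv, Functor.id_comp, e.hom_inv]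
  inv_hom A B := by
    rw [Functor.assoc, ← Functor.assoc (e.inv A B), e.inv_hom, Functor.id_comp, e'.inv_hom]
  natural {A A' B B'} F G := by
    rw [← Functor.assoc, e.natural, Functor.assoc, e'.natural, Functor.assoc]
  natural₂ {A A' B B' F F' G G'} φ ψ := by
    ext M
    have h₁ := NatTrans.congr_app (e.natural₂ φ ψ) M
    have h₂ := NatTrans.congr_app (e'.natural₂ φ ψ) ((e.hom A B).obj M)
    simp only [Functor.whiskerRight_app, NatTrans.comp_app, eqToHom_app,
      Functor.whiskerLeft_app, Functor.comp_map, Functor.comp_obj] at h₁ h₂ ⊢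
    -- A functor sends transports to transports, so those coming from `e` merge with those coming
    -- from `e'`.
    rw [h₁, Functor.map_comp, Functor.map_comp, h₂, eqToHom_map, eqToHom_map]
    simp

end TwoNatIso

/-! ### Passage between left and right graded categories by formal opposites. -/

section FormalOp

variable {V : Type u} [Category.{v} V] [MonoidalCategory V]

/-- The 2-functor `(A, B) ↦ T(B°, A°)` on left `V`-graded categories. -/
def TwoFunctorData.formalOp (T : TwoFunctorData.{o, h, v, u, p, q} Vᴹᵒᵖ) :
    TwoFunctorData.{o, h, v, u, p, q} V where
  obj A B := T.obj B.formalOp A.formalOp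
  cat A B := T.cat B.formalOp A.formalOp
  map F G := T.map G.formalOp F.formalOp
  -- The two variables have opposite variance on 2-cells; exchanging them is compensated by the
  -- reversal of 2-cells under `(-)°`.
  map₂ φ ψ := T.map₂ ψ.formalOp φ.formalOp

/-- A 2-natural isomorphism `S(A, B) ≅ T(A, B)` for right graded categories yields one
`S(B°, A°) ≅ T(B°, A°)` for left graded categories. -/
def TwoNatIso.formalOp {S : TwoFunctorData.{o, h, v, u, p, q} Vᴹᵒᵖ}
    {T : TwoFunctorData.{o, h, v, u, p', q'} Vᴹᵒᵖ} (e : TwoNatIso S T) :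
    TwoNatIso S.formalOp T.formalOp where
  hom A B := e.hom B.formalOp A.formalOp
  inv A B := e.inv B.formalOp A.formalOp
  hom_inv A B := e.hom_inv B.formalOp A.formalOp
  inv_hom A B := e.inv_hom B.formalOp A.formalOp
  natural F G := e.natural G.formalOp F.formalOp
  natural₂ φ ψ := e.natural₂ ψ.formalOp φ.formalOp

end FormalOp

/-! ### Graded bifunctors `A, B → C` as graded functors `A ⊠ B → C` -/

section Box

open Functor.OplaxMonoidal

section

variable {V : Type u} [Category.{v} V] [MonoidalCategory V]
variable {W : Type u'} [Category.{v'} W] [MonoidalCategory W]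

/-- Both sides are fourfold composites that differ only in their two middle factors, and `H`
exchanges these. What remains is coherence in each coordinate. The second factor is an arbitrary `W`
rather than a reverse, so that both coherence goals lie in plain monoidal categories. -/
theorem GradedCat.comp_interchange (C : GradedCat.{o, h} (V × W)) {X Y : V} {X' Y' : W}
    {p q q' r s t : C.Obj} (f : C.Hom (X, 𝟙_ W) p q) (f' : C.Hom (Y, 𝟙_ W) q q')
    (g : C.Hom (𝟙_ V, X') q r) (k : C.Hom (Y, 𝟙_ W) r s) (k' : C.Hom (𝟙_ V, X') q' s)
    (g' : C.Hom (𝟙_ V, Y') s t)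
    (H : C.comp k g = C.reindex (((ρ_ Y).hom ≫ (λ_ Y).inv) ×ₘ ((λ_ X').hom ≫ (ρ_ X').inv))
      (C.comp k' f')) :
    C.reindex ((λ_ (Y ⊗ X)).inv ×ₘ (ρ_ (Y' ⊗ X')).inv)
      (C.comp (C.reindex (((λ_ (𝟙_ V)).inv ×ₘ 𝟙 (Y' ⊗ X') :
          (𝟙_ V, Y' ⊗ X') ⟶ (𝟙_ V, Y') ⊗ (𝟙_ V, X'))) (C.comp g' k'))
        (C.reindex ((𝟙 (Y ⊗ X) ×ₘ (λ_ (𝟙_ W)).inv :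
          (Y ⊗ X, 𝟙_ W) ⟶ (Y, 𝟙_ W) ⊗ (X, 𝟙_ W))) (C.comp f' f))) =
    C.comp (C.reindex ((λ_ Y).inv ×ₘ (ρ_ Y').inv) (C.comp g' k))
      (C.reindex ((λ_ X).inv ×ₘ (ρ_ X').inv) (C.comp g f)) := by
  -- Composing `H` with `f` and reassociating expresses `k ∘ (g ∘ f)` through `k' ∘ (f' ∘ f)`, which
  -- is how the middle factors occur in the fully right-associated composites.
  have h := congrArg (fun z => C.comp z f) H
  rw [C.assoc, C.reindex_comp_left, C.assoc] at h
  replace h := congrArg (C.reindex (α_ _ _ _).inv) h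
  rw [C.reindex_reindex, Iso.inv_hom_id, C.reindex_id] at h
  simp only [C.comp_reindex, C.reindex_comp_left, C.assoc, C.reindex_reindex, h]
  congr 1
  refine Prod.hom_ext ?_ ?_
  · dsimp [Iso.prod]
    monoidal
  · dsimp [Iso.prod]
    monoidal

end

section

variable {V : Type u} [Category.{v} V] [MonoidalCategory V]
variable {W : Type u'} [Category.{v'} W] [MonoidalCategory W]

/-- The unitors in a bigraded square are invertible, so the square can be solved for one composite;
this form can be rewritten inside longer composites. -/
theorem BigradedCat.IsBigradedSquare.comp_eq {C : BigradedCat.{o, h} V W} {X : V} {X' : Wᴹᵒᵖ}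
    {A A' B B' : C.Obj} {f : C.left.Hom X A A'} {g : C.left.Hom X B B'}
    {φ : C.right.Hom X' A B} {φ' : C.right.Hom X' A' B'} (H : C.IsBigradedSquare f g φ φ') :
    C.comp (X := (𝟙_ V, X')) (Y := (X, 𝟙_ Wᴹᵒᵖ)) g φ =
      C.reindex (((ρ_ X).hom ≫ (λ_ X).inv) ×ₘ ((λ_ X').hom ≫ (ρ_ X').inv))
        (C.comp (X := (X, 𝟙_ Wᴹᵒᵖ)) (Y := (𝟙_ V, X')) φ' f) := by
  have := congrArg (C.reindex ((ρ_ X).hom ×ₘ (λ_ X').hom)) H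
  rw [C.reindex_reindex, C.reindex_reindex] at this
  refine Eq.trans ?_ this
  refine (C.reindex_id _).symm.trans ?_
  congr 1
  exact Prod.hom_ext (Iso.hom_inv_id _).symm (Iso.hom_inv_id _).symm

variable {A : GradedCat.{o, h} V} {B : RightGradedCat.{o', h'} W} {C : BigradedCat.{o'', p} V W}

namespace GradedBifunctor

/-- The value on a graded morphism `(f, g)` of `A ⊠ B` of the graded functor corresponding to `F`:
the composite `F(a', g) ∘ F(f, b)`. -/
def boxHom (F : GradedBifunctor A B C) {X : V} {X' : Wᴹᵒᵖ} {a a' : A.Obj}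
    {b b' : B.Obj} (f : A.Hom X a a') (g : B.Hom X' b b') :
    C.Hom (X, X') (F.obj a b) (F.obj a' b') :=
  C.reindex ((λ_ X).inv ×ₘ (ρ_ X').inv)
    (C.comp (X := (X, 𝟙_ Wᴹᵒᵖ)) (Y := (𝟙_ V, X')) (F.mapR a' g) (F.mapL b f))

theorem boxHom_reindex (F : GradedBifunctor A B C) {X Y : V} {X' Y' : Wᴹᵒᵖ}
    {a a' : A.Obj} {b b' : B.Obj} (α : Y ⟶ X) (β : Y' ⟶ X') (f : A.Hom X a a')
    (g : B.Hom X' b b') :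
    F.boxHom (A.reindex α f) (B.reindex β g) = C.reindex (α ×ₘ β) (F.boxHom f g) := by
  unfold boxHom
  rw [(F.isGradedL b).map_reindex, (F.isGradedR a').map_reindex]
  refine (congrArg _ (C.comp_natural (X := (X, 𝟙_ Wᴹᵒᵖ)) (Y := (𝟙_ V, X')) (α ×ₘ 𝟙 _) (𝟙 _ ×ₘ β)
    (F.mapR a' g) (F.mapL b f))).trans ?_
  rw [C.reindex_reindex, C.reindex_reindex]
  congr 1
  refine Prod.hom_ext ?_ ?_
  · change (λ_ Y).inv ≫ (𝟙 _ ⊗ₘ α) = α ≫ (λ_ X).inv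
    simp
  · change (ρ_ Y').inv ≫ (β ⊗ₘ 𝟙 _) = β ≫ (ρ_ X').inv
    simp

/-- Of the functor laws for `toBox`, this is the one that needs the squares of `F`: in `F(a'', g') ∘
F(f', b') ∘ F(a', g) ∘ F(f, b)` the two middle factors have to change places. -/
theorem boxHom_comp (F : GradedBifunctor A B C) {X Y : V} {X' Y' : Wᴹᵒᵖ}
    {a a' a'' : A.Obj} {b b' b'' : B.Obj} (f : A.Hom X a a') (f' : A.Hom Y a' a'')
    (g : B.Hom X' b b') (g' : B.Hom Y' b' b'') :
    F.boxHom (A.comp f' f) (B.comp g' g) = C.comp (F.boxHom f' g') (F.boxHom f g) := by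
  unfold boxHom
  rw [(F.isGradedL b).map_comp, (F.isGradedR a'').map_comp]
  exact GradedCat.comp_interchange C (F.mapL b f) (F.mapL b f') (F.mapR a' g) (F.mapL b' f')
    (F.mapR a'' g) (F.mapR a'' g') (F.square f' g).comp_eq

/-- With `boxHom_ident_left`, this recovers a bifunctor from its box functor. One factor of `boxHom`
becomes an identity, and the leftover constraint in the second coordinate vanishes because the two
unitors at `I` coincide. -/
theorem boxHom_ident_right (F : GradedBifunctor A B C) {X : V} {a a' : A.Obj} (b : B.Obj)
    (f : A.Hom X a a') :
    F.boxHom f (B.ident b) = (F.mapL b f : C.Hom (X, 𝟙_ Wᴹᵒᵖ) _ _) := by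
  unfold boxHom
  rw [(F.isGradedR a').map_ident, right_ident]
  refine (congrArg _ (C.ident_comp (X := (X, 𝟙_ Wᴹᵒᵖ)) (F.mapL b f))).trans ?_
  refine (C.reindex_reindex _ _ _).trans
    ((congrArg (fun u => C.reindex u _) ?_).trans (C.reindex_id _))
  refine Prod.hom_ext ?_ ?_
  · exact Iso.inv_hom_id _
  · change (ρ_ _).inv ≫ (λ_ _).hom = 𝟙 _
    monoidal

theorem boxHom_ident_left (F : GradedBifunctor A B C) {X : Wᴹᵒᵖ} (a : A.Obj) {b b' : B.Obj}
    (g : B.Hom X b b') :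
    F.boxHom (A.ident a) g = (F.mapR a g : C.Hom (𝟙_ V, X) _ _) := by
  unfold boxHom
  rw [(F.isGradedL b).map_ident, left_ident]
  refine (congrArg _ (C.comp_ident (X := (𝟙_ V, X)) (F.mapR a g))).trans ?_
  refine (C.reindex_reindex _ _ _).trans
    ((congrArg (fun u => C.reindex u _) ?_).trans (C.reindex_id _))
  refine Prod.hom_ext ?_ ?_
  · change (λ_ _).inv ≫ (ρ_ _).hom = 𝟙 _
    monoidal
  · exact Iso.inv_hom_id _

/-- The graded functor on `A ⊠ B` corresponding to a graded bifunctor. -/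
def toBox (F : GradedBifunctor A B C) : GradedFunctor (boxProd A B) C where
  obj x := F.obj x.1 x.2
  map f := F.boxHom f.1 f.2
  isGraded :=
    { map_reindex := fun α _ _ f => F.boxHom_reindex α.1 α.2 f.1 f.2
      map_comp := fun g f => F.boxHom_comp f.1 g.1 f.2 g.2
      map_ident := fun x => (F.boxHom_ident_left x.1 (B.ident x.2)).trans
        (((F.isGradedR x.1).map_ident x.2).trans (right_ident C _)) }

end GradedBifunctor

theorem GradedCat.reindex_comp_ident (A : GradedCat.{o, h} V) {X : V} {a b : A.Obj}
    (f : A.Hom X a b) : A.reindex (ρ_ X).inv (A.comp f (A.ident a)) = f := by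
  rw [A.comp_ident, A.reindex_reindex, Iso.inv_hom_id, A.reindex_id]

theorem GradedCat.reindex_ident_comp (A : GradedCat.{o, h} V) {X : V} {a b : A.Obj}
    (f : A.Hom X a b) : A.reindex (λ_ X).inv (A.comp (A.ident b) f) = f := by
  rw [A.ident_comp, A.reindex_reindex, Iso.inv_hom_id, A.reindex_id]

namespace GradedFunctor

variable (H : GradedFunctor (boxProd A B) C)

/-- `H` preserves composition and reindexing, and both are computed coordinatewise in `A ⊠ B`. The
results `k` and `l` are left free, so that the functoriality and square laws of `ofBox` arise by
inserting unit laws of `A` and `B` for `hk` and `hl`. -/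
theorem map_box {X Y Z : V} {T U S : Wᴹᵒᵖ} {x y z : (boxProd A B).Obj}
    (α : Z ⟶ Y ⊗ X) (β : S ⟶ U ⊗ T) (f : A.Hom X x.1 y.1) (f' : A.Hom Y y.1 z.1)
    (g : B.Hom T x.2 y.2) (g' : B.Hom U y.2 z.2) {k : A.Hom Z x.1 z.1} {l : B.Hom S x.2 z.2}
    (hk : A.reindex α (A.comp f' f) = k) (hl : B.reindex β (B.comp g' g) = l) :
    C.reindex (X := (Y, U) ⊗ (X, T)) (Y := (Z, S)) (α ×ₘ β)
      (C.comp (X := (X, T)) (Y := (Y, U)) (H.map (X := (Y, U)) (A := y) (B := z) (f', g'))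
        (H.map (X := (X, T)) (A := x) (B := y) (f, g))) =
      H.map (X := (Z, S)) (A := x) (B := z) (k, l) := by
  subst hk hl
  exact (congrArg _ (H.isGraded.map_comp (X := (X, T)) (Y := (Y, U)) (A := x) (B := y) (E := z)
    (f', g') (f, g)).symm).trans (H.isGraded.map_reindex (X := (Y ⊗ X, U ⊗ T)) (Y := (Z, S))
      (α ×ₘ β) (A := x) (B := z) (A.comp f' f, B.comp g' g)).symm

/-- The graded bifunctor corresponding to a graded functor on `A ⊠ B`. -/
def ofBox : GradedBifunctor A B C where
  obj a b := H.obj (a, b)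
  mapL b {X a a'} f := H.map (X := (X, 𝟙_ Wᴹᵒᵖ)) (A := (a, b)) (B := (a', b)) (f, B.ident b)
  mapR a {X b b'} g := H.map (X := (𝟙_ V, X)) (A := (a, b)) (B := (a, b')) (A.ident a, g)
  isGradedL b :=
    { map_reindex := fun {X Y} α a a' f => by
        refine Eq.trans ?_ (H.isGraded.map_reindex (X := (X, 𝟙_ Wᴹᵒᵖ)) (Y := (Y, 𝟙_ Wᴹᵒᵖ))
          (α ×ₘ 𝟙 _) (A := (a, b)) (B := (a', b)) (f, B.ident b))
        exact congrArg (fun l => H.map (X := (Y, 𝟙_ Wᴹᵒᵖ)) (A := (a, b)) (B := (a', b))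
          (A.reindex α f, l)) (B.reindex_id _).symm
      map_comp := fun g f => (H.map_box (x := (_, b)) (y := (_, b)) (z := (_, b)) (𝟙 _) (λ_ _).inv
        f g (B.ident b) (B.ident b) (A.reindex_id _) (B.reindex_ident_comp _)).symm
      map_ident := fun a => (H.isGraded.map_ident (a, b)).trans (left_ident C _).symm }
  isGradedR a :=
    { map_reindex := fun {X Y} α b b' f => by
        refine Eq.trans ?_ (H.isGraded.map_reindex (X := (𝟙_ V, X)) (Y := (𝟙_ V, Y))
          (𝟙 _ ×ₘ α) (A := (a, b)) (B := (a, b')) (A.ident a, f))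
        exact congrArg (fun l => H.map (X := (𝟙_ V, Y)) (A := (a, b)) (B := (a, b'))
          (l, B.reindex α f)) (A.reindex_id _).symm
      map_comp := fun g f => (H.map_box (x := (a, _)) (y := (a, _)) (z := (a, _)) (λ_ _).inv (𝟙 _)
        (A.ident a) (A.ident a) f g (A.reindex_ident_comp _) (B.reindex_id _)).symm
      map_ident := fun b => (H.isGraded.map_ident (a, b)).trans (right_ident C _).symm }
  square {X a a'} f {X' b b'} g :=
    (H.map_box (x := (a, b)) (y := (a, b')) (z := (a', b')) (ρ_ X).inv (λ_ X').inv (A.ident a) f g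
      (B.ident b') (A.reindex_comp_ident f) (B.reindex_ident_comp g)).trans
    (H.map_box (x := (a, b)) (y := (a', b)) (z := (a', b')) (λ_ X).inv (ρ_ X').inv f (A.ident a')
      (B.ident b) g (A.reindex_ident_comp f) (B.reindex_comp_ident g)).symm

/-- A pair `(f, g)` is `(id, g) ∘ (f, id)` up to unitors, so `H` is determined by its restrictions
to the two variables. -/
theorem ofBox_boxHom {X : V} {X' : Wᴹᵒᵖ} {x y : (boxProd A B).Obj} (f : A.Hom X x.1 y.1)
    (g : B.Hom X' x.2 y.2) :
    H.ofBox.boxHom f g = H.map (X := (X, X')) (A := x) (B := y) (f, g) :=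
  H.map_box (x := x) (y := (y.1, x.2)) (z := y) (λ_ X).inv (ρ_ X').inv f (A.ident _)
      (B.ident _) g (A.reindex_ident_comp f) (B.reindex_comp_ident g)

theorem toBox_ofBox : H.ofBox.toBox = H := by
  obtain ⟨obj, map, h⟩ := H
  have : (fun {X : V × Wᴹᵒᵖ} {x y : (boxProd A B).Obj} (f : (boxProd A B).Hom X x y) =>
      (GradedFunctor.mk obj map h).ofBox.boxHom f.1 f.2) = @map := by
    funext X x y f
    exact ofBox_boxHom _ f.1 f.2
  simp only [GradedBifunctor.toBox]
  congr 1

end GradedFunctor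

/-- The action on objects is shared by both sides, so values on graded morphisms can be compared
without transport; the laws are propositions. -/
theorem GradedBifunctor.ext_map {obj : A.Obj → B.Obj → C.Obj}
    {mapL mapL' : ∀ (b : B.Obj) {X : V} {a a' : A.Obj},
      A.Hom X a a' → C.left.Hom X (obj a b) (obj a' b)}
    {mapR mapR' : ∀ (a : A.Obj) {X : Wᴹᵒᵖ} {b b' : B.Obj},
      B.Hom X b b' → C.right.Hom X (obj a b) (obj a b')}
    (hL : ∀ (b : B.Obj) {X : V} {a a' : A.Obj} (f : A.Hom X a a'), mapL b f = mapL' b f)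
    (hR : ∀ (a : A.Obj) {X : Wᴹᵒᵖ} {b b' : B.Obj} (g : B.Hom X b b'), mapR a g = mapR' a g)
    (h₁ h₂ h₃ h₁' h₂' h₃') :
    (⟨⟨obj, mapL, mapR, h₁, h₂⟩, h₃⟩ : GradedBifunctor A B C) =
      ⟨⟨obj, mapL', mapR', h₁', h₂'⟩, h₃'⟩ := by
  obtain rfl : @mapL = @mapL' := by
    funext b X a a' f
    exact hL b f
  obtain rfl : @mapR = @mapR' := by
    funext b X a a' f
    exact hR b f
  rfl

theorem GradedBifunctor.ofBox_toBox (F : GradedBifunctor A B C) : F.toBox.ofBox = F :=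
  GradedBifunctor.ext_map (fun b _ _ _ f => F.boxHom_ident_right b f)
    (fun a _ _ _ g => F.boxHom_ident_left a g) _ _ _ _ _ _

/-- Naturality squares paste along `t`. This reduces naturality on `A ⊠ B` to naturality in each
variable. -/
theorem GradedCat.natural_comp (D : GradedCat.{o, h} V) {X Y : V} {a b c a' b' c' : D.Obj}
    {f : D.Hom X a b} {g : D.Hom Y b c} {f' : D.Hom X a' b'} {g' : D.Hom Y b' c'}
    {s : D.Hom (𝟙_ V) a a'} {t : D.Hom (𝟙_ V) b b'} {u : D.Hom (𝟙_ V) c c'}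
    (hf : D.reindex (λ_ X).inv (D.comp t f) = D.reindex (ρ_ X).inv (D.comp f' s))
    (hg : D.reindex (λ_ Y).inv (D.comp u g) = D.reindex (ρ_ Y).inv (D.comp g' t)) :
    D.reindex (λ_ (Y ⊗ X)).inv (D.comp u (D.comp g f)) =
      D.reindex (ρ_ (Y ⊗ X)).inv (D.comp (D.comp g' f') s) := by
  -- `h₂` moves `u` past `g`, replacing it by `t`, and `h₁` then moves `t` past `f`, replacing it by
  -- `s`.
  have h₁ := congrArg (fun z => D.reindex (𝟙 (Y ⊗ X)) (D.comp g' z)) hf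
  have h₂ := congrArg (fun z => D.reindex (𝟙 (Y ⊗ X)) (D.comp z f)) hg
  simp only [D.comp_reindex, D.reindex_comp_left, D.assoc, D.reindex_reindex] at h₁ h₂ ⊢
  calc
    _ = D.reindex ((λ_ (Y ⊗ X)).inv ≫ (α_ _ _ _).inv ≫ (α_ _ _ _).hom) (D.comp u (D.comp g f)) := by
      simp
    _ = _ := by
      refine Eq.trans ?_ h₂
      congr 1
      monoidal
    _ = _ := by
      refine Eq.trans ?_ h₁
      congr 1
      monoidal
    _ = _ := by
      congr 1
      monoidal

theorem GradedCat.natural_reindex (D : GradedCat.{o, h} V) {X Y : V} {a b a' b' : D.Obj}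
    {f : D.Hom X a b} {f' : D.Hom X a' b'} {s : D.Hom (𝟙_ V) a a'} {t : D.Hom (𝟙_ V) b b'}
    (α : Y ⟶ X) (hf : D.reindex (λ_ X).inv (D.comp t f) = D.reindex (ρ_ X).inv (D.comp f' s)) :
    D.reindex (λ_ Y).inv (D.comp t (D.reindex α f)) =
      D.reindex (ρ_ Y).inv (D.comp (D.reindex α f') s) := by
  rw [D.comp_reindex, D.reindex_comp_left, D.reindex_reindex, D.reindex_reindex,
    ← leftUnitor_inv_naturality, ← rightUnitor_inv_naturality, D.reindex_comp, hf, D.reindex_comp]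

/-- Naturality in the underlying left graded category can be read in `C` itself, where it is
comparable with naturality on `A ⊠ B`. The reindexings involved differ only by exchanging `λ_I` and
`ρ_I` in the second coordinate. -/
theorem left_natural_iff (C : BigradedCat.{o, h} V W) {X : V} {a b a' b' : C.Obj}
    (f : C.Hom (X, 𝟙_ Wᴹᵒᵖ) a b) (f' : C.Hom (X, 𝟙_ Wᴹᵒᵖ) a' b')
    (s : C.Hom (𝟙_ (V × Wᴹᵒᵖ)) a a') (t : C.Hom (𝟙_ (V × Wᴹᵒᵖ)) b b') :
    (C.left.reindex (λ_ X).inv (C.left.comp (X := X) (Y := 𝟙_ V) t f) =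
      C.left.reindex (ρ_ X).inv (C.left.comp (X := 𝟙_ V) (Y := X) f' s)) ↔
    C.reindex (λ_ (X, 𝟙_ Wᴹᵒᵖ)).inv (C.comp t f) =
      C.reindex (ρ_ (X, 𝟙_ Wᴹᵒᵖ)).inv (C.comp f' s) := by
  refine Eq.congr ?_ ?_
  · refine (C.reindex_reindex _ _ _).trans (congrArg (fun z => C.reindex z _) ?_)
    exact Prod.hom_ext (Category.comp_id _) (Category.id_comp _)
  · refine (C.reindex_reindex _ _ _).trans (congrArg (fun z => C.reindex z _) ?_)
    exact Prod.hom_ext (Category.comp_id _) ((Category.id_comp _).trans unitors_inv_equal)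

theorem right_natural_iff (C : BigradedCat.{o, h} V W) {X : Wᴹᵒᵖ} {a b a' b' : C.Obj}
    (f : C.Hom (𝟙_ V, X) a b) (f' : C.Hom (𝟙_ V, X) a' b')
    (s : C.Hom (𝟙_ (V × Wᴹᵒᵖ)) a a') (t : C.Hom (𝟙_ (V × Wᴹᵒᵖ)) b b') :
    (C.right.reindex (λ_ X).inv (C.right.comp (X := X) (Y := 𝟙_ Wᴹᵒᵖ) t f) =
      C.right.reindex (ρ_ X).inv (C.right.comp (X := 𝟙_ Wᴹᵒᵖ) (Y := X) f' s)) ↔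
    C.reindex (λ_ (𝟙_ V, X)).inv (C.comp t f) =
      C.reindex (ρ_ (𝟙_ V, X)).inv (C.comp f' s) := by
  refine Eq.congr ?_ ?_
  · refine (C.reindex_reindex _ _ _).trans (congrArg (fun z => C.reindex z _) ?_)
    exact Prod.hom_ext (Category.id_comp _) (Category.comp_id _)
  · refine (C.reindex_reindex _ _ _).trans (congrArg (fun z => C.reindex z _) ?_)
    exact Prod.hom_ext ((Category.id_comp _).trans unitors_inv_equal) (Category.comp_id _)

/-- The values of `toBox` are reindexed composites of values of `mapR` and `mapL`, and naturality is
stable under composition and reindexing. -/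
theorem GradedBifunctor.Transformation.natural_box {F G : GradedBifunctor A B C}
    (θ : F.Transformation G) :
    IsGradedNatural (boxProd A B) C F.toBox.map G.toBox.map (fun x => θ.app x.1 x.2) := by
  intro X x y f
  exact C.natural_reindex _ (C.natural_comp
    ((left_natural_iff C _ _ _ _).1 (θ.naturalL x.2 f.1))
    ((right_natural_iff C _ _ _ _).1 (θ.naturalR y.1 f.2)))

/-- The functor from graded bifunctors `A, B → C` to graded functors `A ⊠ B → C`. -/
def toBoxFunctor (A : GradedCat.{o, h} V) (B : RightGradedCat.{o', h'} W)
    (C : BigradedCat.{o'', p} V W) : GradedBifunctor A B C ⥤ GradedFunctor (boxProd A B) C where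
  obj F := F.toBox
  map {F G} (θ : GradedBifunctor.Transformation F G) :=
    (⟨fun x => θ.app x.1 x.2, θ.natural_box⟩ : GradedNat F.toBox G.toBox)

instance : (toBoxFunctor A B C).Faithful where
  map_injective {F G} θ κ h := GradedBifunctor.Transformation.ext (funext₂ fun a b =>
    congrFun (congrArg GradedNat.app h) (a, b))

instance : (toBoxFunctor A B C).Full where
  map_surjective {F G} (θ : GradedNat F.toBox G.toBox) := ⟨({
      app := fun a b => θ.app (a, b)
      naturalL := fun b X a a' f => (left_natural_iff C _ _ _ _).2 (by
        -- Naturality at a pair with one identity entry isolates a single variable.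
        have := θ.natural (X := (X, 𝟙_ Wᴹᵒᵖ)) (A := (a, b)) (B := (a', b)) (f, B.ident b)
        exact (congrArg (fun z => C.reindex _ (C.comp _ z)) (F.boxHom_ident_right b f).symm).trans
          (this.trans (congrArg (fun z => C.reindex _ (C.comp z _)) (G.boxHom_ident_right b f))))
      naturalR := fun a X b b' g => (right_natural_iff C _ _ _ _).2 (by
        have := θ.natural (X := (𝟙_ V, X)) (A := (a, b)) (B := (a, b')) (A.ident a, g)
        exact (congrArg (fun z => C.reindex _ (C.comp _ z)) (F.boxHom_ident_left a g).symm).trans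
          (this.trans (congrArg (fun z => C.reindex _ (C.comp z _)) (G.boxHom_ident_left a g)))) } : GradedBifunctor.Transformation F G), rfl⟩

end

end Box

section

variable (V : Type w) [SmallCategory V] [MonoidalCategory V]

/-- Graded bifunctors `B°, A → V̂` are graded functors `B° ⊠ A → V̂`. -/
def gbifRightIso : TwoNatIso (gbifRight.{o, h} V) (gcatRight V) :=
  TwoNatIso.ofFullyFaithful
    (fun A B => toBoxFunctor (RightGradedCat.formalOp B) A (presheaves V))
    (faithful := fun A B => inferInstanceAs (toBoxFunctor _ _ _).Faithful)
    (full := fun A B => inferInstanceAs (toBoxFunctor _ _ _).Full)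
    (fun A B H => GradedFunctor.ofBox H)
    (fun A B F => GradedBifunctor.ofBox_toBox F) (fun A B H => GradedFunctor.toBox_ofBox H)
    -- Both 2-cell actions have the same composite as component. In the second coordinate one
    -- reindexes along `λ_I⁻¹` and the other along `ρ_I⁻¹`, and these are equal.
    (fun F G => rfl) (fun φ ψ M => heq_of_eq (GradedNat.ext (funext fun x => congrArg
      (fun u => (presheaves V).reindex u _)
      (Prod.hom_ext rfl unitors_inv_equal))))

end

/-! ### Modules over the reverse of a monoidal category -/

section Reverse

variable {W : Type u} [Category.{v} W] [MonoidalCategory W]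
variable {W₀ : Type u'} [Category.{v'} W₀] {J : W₀ ⥤ W}
variable {A : Type p} [EnrichedCategory W A] {B : Type q} [EnrichedCategory W B]

namespace EnrModule

/-- The module `B ⇸ A` corresponding to a module between the formal opposites of `A` and `B`. -/
def ofReverse (M : EnrModule (J ⋙ mopFunctor W) (EnrOp W A) (EnrOp W B)) : EnrModule J B A where
  obj a b := M.obj b a
  lact a a' b := (M.ract b a' a).unmop
  ract a b' b := (M.lact b b' a).unmop
  lact_unit a b := congrArg Quiver.Hom.unmop (M.ract_unit b a)
  lact_assoc a a' a'' b := congrArg Quiver.Hom.unmop (M.ract_assoc b a'' a' a)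
  ract_unit a b := congrArg Quiver.Hom.unmop (M.lact_unit b a)
  ract_assoc a b'' b' b := congrArg Quiver.Hom.unmop (M.lact_assoc b b' b'' a)
  lact_ract a a' b' b :=
    -- Reversal exchanges the two actions and inverts the associator, so the compatibility law
    -- returns with its sides swapped and the associator on the wrong side.
    ((Iso.inv_comp_eq _).1 (congrArg Quiver.Hom.unmop (M.lact_ract b b' a' a)).symm)

/-- The module between the formal opposites of `A` and `B` corresponding to a module `B ⇸ A`. -/
def toReverse (N : EnrModule J B A) : EnrModule (J ⋙ mopFunctor W) (EnrOp W A) (EnrOp W B) where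
  obj b a := N.obj a b
  lact b b' a := (N.ract a b' b).mop
  ract b a' a := (N.lact a a' b).mop
  lact_unit b a := congrArg Quiver.Hom.mop (N.ract_unit a b)
  lact_assoc b b' b'' a := congrArg Quiver.Hom.mop (N.ract_assoc a b'' b' b)
  ract_unit b a := congrArg Quiver.Hom.mop (N.lact_unit a b)
  ract_assoc b a'' a' a := congrArg Quiver.Hom.mop (N.lact_assoc a a' a'' b)
  lact_ract b b' a' a :=
    congrArg Quiver.Hom.mop ((Iso.eq_inv_comp _).2 (N.lact_ract a a' b' b).symm)

variable (J A B) in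
/-- Modules between the formal opposites of `A` and `B` are modules `B ⇸ A`. -/
def ofReverseFunctor :
    EnrModule (J ⋙ mopFunctor W) (EnrOp W A) (EnrOp W B) ⥤ EnrModule J B A where
  obj M := M.ofReverse
  map {M N} (θ : Transformation M N) :=
    ({ app := fun a b => θ.app b a
       lact := fun a a' b => congrArg Quiver.Hom.unmop (θ.ract b a' a)
       ract := fun a b' b => congrArg Quiver.Hom.unmop (θ.lact b b' a) } :
      Transformation M.ofReverse N.ofReverse)

instance : (ofReverseFunctor J A B).Faithful where
  map_injective {M N} θ κ h := Transformation.ext (funext₂ fun b a =>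
    congrFun₂ (congrArg Transformation.app h) a b)

instance : (ofReverseFunctor J A B).Full where
  map_surjective {M N} (θ : Transformation M.ofReverse N.ofReverse) := ⟨({
    app := fun b a => θ.app a b
    lact := fun b b' a => congrArg Quiver.Hom.mop (θ.ract a b' b)
    ract := fun b a' a => congrArg Quiver.Hom.mop (θ.lact a a' b) } : Transformation M N), rfl⟩

/-- Commuting actions give commuting actions of generalized elements. This is needed because `map₂`
applies `λ` before `ρ`, while reversal interchanges the two. -/
theorem lelt_relt (M : EnrModule J A B) {b b' : B} (y : 𝟙_ W ⟶ (b ⟶[W] b')) {a' a : A}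
    (x : 𝟙_ W ⟶ (a' ⟶[W] a)) :
    M.lelt y a' ≫ M.relt b x = M.relt b' x ≫ M.lelt y a := by
  rw [lelt, lelt, Category.assoc, Category.assoc, M.lact_relt, ← whisker_exchange_assoc,
    leftUnitor_inv_naturality_assoc]

variable {A' : Type p'} [EnrichedCategory W A'] {B' : Type q'} [EnrichedCategory W B']

/-- The components of `map₂` on the two sides of the duality are preimages under different full
functors, `J ⋙ mopFunctor W` and `J`; applying `J` makes them comparable as morphisms of `W`. -/
theorem map_preimage_comp_mop [(J ⋙ mopFunctor W).Full] {X Y Z : W₀}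
    (f : (J ⋙ mopFunctor W).obj X ⟶ (J ⋙ mopFunctor W).obj Y)
    (g : (J ⋙ mopFunctor W).obj Y ⟶ (J ⋙ mopFunctor W).obj Z) :
    J.map ((J ⋙ mopFunctor W).preimage f ≫ (J ⋙ mopFunctor W).preimage g) =
      f.unmop ≫ g.unmop := by
  rw [J.map_comp]
  exact congrArg₂ (fun x y => x ≫ y)
    (congrArg Quiver.Hom.unmop ((J ⋙ mopFunctor W).map_preimage f))
    (congrArg Quiver.Hom.unmop ((J ⋙ mopFunctor W).map_preimage g))

theorem map_preimage_comp [J.Full] {X Y Z : W₀} (f : J.obj X ⟶ J.obj Y) (g : J.obj Y ⟶ J.obj Z) :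
    J.map (J.preimage f ≫ J.preimage g) = f ≫ g := by
  rw [J.map_comp, J.map_preimage, J.map_preimage]

/-- After applying `J`, one side acts by `relt` and then `lelt`, the other in the opposite order. -/
theorem ofReverseFunctor_map_map₂ [J.Full] [J.Faithful] [(J ⋙ mopFunctor W).Full]
    [(J ⋙ mopFunctor W).Faithful] {F F' : EnrichedFunctor W A' A} (φ : EnrNatTrans W F' F)
    {G G' : EnrichedFunctor W B' B} (ψ : EnrNatTrans W G G')
    (M : EnrModule (J ⋙ mopFunctor W) (EnrOp W A) (EnrOp W B)) :
    (ofReverseFunctor J A' B').map ((map₂ (J ⋙ mopFunctor W) φ.enrOp ψ.enrOp).app M) =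
      (map₂ J ψ φ).app M.ofReverse := by
  refine Transformation.ext (funext₂ fun a b => J.map_injective ?_)
  change J.map ((J ⋙ mopFunctor W).preimage _ ≫ (J ⋙ mopFunctor W).preimage _) =
    J.map (J.preimage _ ≫ J.preimage _)
  exact (map_preimage_comp_mop _ _).trans
    ((M.ofReverse.lelt_relt (φ.app a) (ψ.app b)).symm.trans (map_preimage_comp _ _).symm)

end EnrModule

end Reverse

section

variable (V : Type w) [SmallCategory V] [MonoidalCategory V]

/-- Modules `A ⇸ B` for left graded categories are modules `B° ⇸ A°`. -/
def gmodLeftIso : TwoNatIso (gmodLeft.{o, w, t} V) (gmodRight.{o, w, t} V).formalOp :=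
  TwoNatIso.ofFullyFaithful
    (fun A B => EnrModule.ofReverseFunctor (inclPsh.{w, t} V)
      (RightGradedCat.Enriched.{o, w, t} A.formalOp) (RightGradedCat.Enriched.{o, w, t} B.formalOp))
    (faithful := fun A B => inferInstanceAs (EnrModule.ofReverseFunctor _ _ _).Faithful)
    (full := fun A B => inferInstanceAs (EnrModule.ofReverseFunctor _ _ _).Full)
    (fun A B N => EnrModule.toReverse N)
    -- Reversal only swaps the two actions, so both round trips and naturality in 1-cells hold by
    -- definition; only the 2-cells need an argument.
    (fun A B M => rfl) (fun A B N => rfl)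
    (fun F G => rfl) (fun φ ψ M => heq_of_eq (EnrModule.ofReverseFunctor_map_map₂ _ _ M))

end

/-! ### Morphisms out of a Day convolution as graded morphisms of `V̂` -/

section Curry

variable {V : Type w} [SmallCategory V] [MonoidalCategory V]

theorem map_map_apply (Q : Vᵒᵖ ⥤ Type w) {X Y Z : V} (α : Y ⟶ X) (β : Z ⟶ Y) (m : Q.obj (op X)) :
    Q.map β.op (Q.map α.op m) = Q.map (β ≫ α).op m :=
  (types_congr_hom (Q.map_comp α.op β.op) m).symm

theorem map_id_apply (Q : Vᵒᵖ ⥤ Type w) {X : V} (m : Q.obj (op X)) : Q.map (𝟙 X).op m = m :=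
  types_congr_hom (Q.map_id (op X)) m

theorem map_hom_inv_apply (Q : Vᵒᵖ ⥤ Type w) {X Y : V} (e : Y ≅ X) (m : Q.obj (op X)) :
    Q.map e.inv.op (Q.map e.hom.op m) = m := by
  rw [map_map_apply, e.inv_hom_id, map_id_apply]

theorem map_congr (Q : Vᵒᵖ ⥤ Type w) {X Y : V} {α β : Y ⟶ X} (h : α = β) (m : Q.obj (op X)) :
    Q.map α.op m = Q.map β.op m := h ▸ rfl

theorem map_injective (Q : Vᵒᵖ ⥤ Type w) {X Y : V} (α : Y ⟶ X) [IsIso α] :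
    Function.Injective (Q.map α.op) := fun m m' h => by
  have := congrArg (Q.map (inv α).op) h
  rwa [map_map_apply, map_map_apply, IsIso.inv_hom_id, map_id_apply, map_id_apply] at this

theorem nat_apply {P Q : Vᵒᵖ ⥤ Type w} (t : P ⟶ Q) {X Y : V} (α : Y ⟶ X) (m : P.obj (op X)) :
    t.app (op Y) (P.map α.op m) = Q.map α.op (t.app (op X) m) :=
  types_congr_hom (t.naturality α.op) m

namespace Psh

/-- An element of `P`, as an element of its image in the presheaves of huge sets. -/
def up {P : Vᵒᵖ ⥤ Type w} {Z : V} (m : P.obj (op Z)) :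
    ((inclPsh.{w, t} V).obj P).functor.obj (op Z) := ULift.up m

/-- The inverse of `Psh.up`. -/
def down {P : Vᵒᵖ ⥤ Type w} {Z : V} (m : ((inclPsh.{w, t} V).obj P).functor.obj (op Z)) :
    P.obj (op Z) := ULift.down m

theorem up_map {P : Vᵒᵖ ⥤ Type w} {Y Z : V} (α : Y ⟶ Z) (m : P.obj (op Z)) :
    up.{w, t} (P.map α.op m) = ((inclPsh.{w, t} V).obj P).functor.map α.op (up m) := rfl

theorem down_injective {P : Vᵒᵖ ⥤ Type w} {Z : V} :
    Function.Injective (down.{w, t} (P := P) (Z := Z)) := ULift.down_injective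

/-- The bilinear map `H(X) × P(Z) → Q(X ⊗ Z)` corresponding to `H ⊗ P → Q`. -/
def lapp {H : Psh.{w, t} V} {P Q : Vᵒᵖ ⥤ Type w}
    (l : H ⊗ (inclPsh.{w, t} V).obj P ⟶ (inclPsh.{w, t} V).obj Q) {X Z : V}
    (f : H.functor.obj (op X)) (m : P.obj (op Z)) : Q.obj (op (X ⊗ Z)) :=
  down (l.natTrans.app (op X ⊗ op Z) (eta H _ f (up m)))

/-- The bilinear map `P(Z) × H(X) → Q(Z ⊗ X)` corresponding to `P ⊗ H → Q`. -/
def rapp {H : Psh.{w, t} V} {P Q : Vᵒᵖ ⥤ Type w}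
    (r : (inclPsh.{w, t} V).obj P ⊗ H ⟶ (inclPsh.{w, t} V).obj Q) {X Z : V}
    (m : P.obj (op Z)) (f : H.functor.obj (op X)) : Q.obj (op (Z ⊗ X)) :=
  down (r.natTrans.app (op Z ⊗ op X) (eta _ H (up m) f))

section

variable {H : Psh.{w, t} V} {P Q R : Vᵒᵖ ⥤ Type w}

theorem lapp_map (l : H ⊗ (inclPsh.{w, t} V).obj P ⟶ (inclPsh.{w, t} V).obj Q) {X X' Z Z' : V}
    (α : X' ⟶ X) (β : Z' ⟶ Z) (f : H.functor.obj (op X)) (m : P.obj (op Z)) :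
    lapp l (H.functor.map α.op f) (P.map β.op m) = Q.map (α ⊗ₘ β).op (lapp l f m) := by
  rw [lapp, up_map, eta_map, app_map]
  rfl

theorem rapp_map (r : (inclPsh.{w, t} V).obj P ⊗ H ⟶ (inclPsh.{w, t} V).obj Q) {X X' Z Z' : V}
    (α : X' ⟶ X) (β : Z' ⟶ Z) (f : H.functor.obj (op X)) (m : P.obj (op Z)) :
    rapp r (P.map β.op m) (H.functor.map α.op f) = Q.map (β ⊗ₘ α).op (rapp r m f) := by
  rw [rapp, up_map, eta_map, app_map]
  rfl

theorem lapp_map_left (l : H ⊗ (inclPsh.{w, t} V).obj P ⟶ (inclPsh.{w, t} V).obj Q) {X X' Z : V}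
    (α : X' ⟶ X) (f : H.functor.obj (op X)) (m : P.obj (op Z)) :
    lapp l (H.functor.map α.op f) m = Q.map (α ▷ Z).op (lapp l f m) := by
  simpa [map_id_apply] using lapp_map l α (𝟙 Z) f m

theorem lapp_map_right (l : H ⊗ (inclPsh.{w, t} V).obj P ⟶ (inclPsh.{w, t} V).obj Q) {X Z Z' : V}
    (β : Z' ⟶ Z) (f : H.functor.obj (op X)) (m : P.obj (op Z)) :
    lapp l f (P.map β.op m) = Q.map (X ◁ β).op (lapp l f m) := by
  have := lapp_map l (𝟙 X) β f m
  rw [op_id, map_id] at this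
  simpa using this

theorem rapp_map_left (r : (inclPsh.{w, t} V).obj P ⊗ H ⟶ (inclPsh.{w, t} V).obj Q) {X Z Z' : V}
    (β : Z' ⟶ Z) (f : H.functor.obj (op X)) (m : P.obj (op Z)) :
    rapp r (P.map β.op m) f = Q.map (β ▷ X).op (rapp r m f) := by
  have := rapp_map r (𝟙 X) β f m
  rw [op_id, map_id] at this
  simpa using this

theorem rapp_map_right (r : (inclPsh.{w, t} V).obj P ⊗ H ⟶ (inclPsh.{w, t} V).obj Q) {X X' Z : V}
    (α : X' ⟶ X) (f : H.functor.obj (op X)) (m : P.obj (op Z)) :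
    rapp r m (H.functor.map α.op f) = Q.map (Z ◁ α).op (rapp r m f) := by
  simpa [map_id_apply] using rapp_map r α (𝟙 Z) f m

/-- This is the uniqueness half of the universal property: a morphism out of a Day convolution is
determined by its values on the elements `eta`. -/
theorem lapp_ext {l l' : H ⊗ (inclPsh.{w, t} V).obj P ⟶ (inclPsh.{w, t} V).obj Q}
    (h : ∀ {X Z : V} (f : H.functor.obj (op X)) (m : P.obj (op Z)), lapp l f m = lapp l' f m) :
    l = l' :=
  eta_ext fun _ _ f m => down_injective (h f (down m))

theorem rapp_ext {r r' : (inclPsh.{w, t} V).obj P ⊗ H ⟶ (inclPsh.{w, t} V).obj Q}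
    (h : ∀ {X Z : V} (f : H.functor.obj (op X)) (m : P.obj (op Z)), rapp r m f = rapp r' m f) :
    r = r' :=
  eta_ext fun _ _ m f => down_injective (h f (down m))

theorem lapp_whiskerRight_comp {K : Psh.{w, t} V} (g : K ⟶ H)
    (l : H ⊗ (inclPsh.{w, t} V).obj P ⟶ (inclPsh.{w, t} V).obj Q) {X Z : V}
    (f : K.functor.obj (op X)) (m : P.obj (op Z)) :
    lapp (g ▷ _ ≫ l) f m = lapp l (g.natTrans.app _ f) m := by
  rw [lapp, comp_app, whiskerRight_app]
  rfl

theorem rapp_whiskerLeft_comp {K : Psh.{w, t} V} (g : K ⟶ H)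
    (r : (inclPsh.{w, t} V).obj P ⊗ H ⟶ (inclPsh.{w, t} V).obj Q) {X Z : V}
    (f : K.functor.obj (op X)) (m : P.obj (op Z)) :
    rapp (_ ◁ g ≫ r) m f = rapp r m (g.natTrans.app _ f) := by
  rw [rapp, comp_app, whiskerLeft_app]
  rfl

theorem lapp_comp_map (l : H ⊗ (inclPsh.{w, t} V).obj P ⟶ (inclPsh.{w, t} V).obj Q) (s : Q ⟶ R)
    {X Z : V} (f : H.functor.obj (op X)) (m : P.obj (op Z)) :
    lapp (l ≫ (inclPsh.{w, t} V).map s) f m = s.app _ (lapp l f m) := rfl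

theorem rapp_comp_map (r : (inclPsh.{w, t} V).obj P ⊗ H ⟶ (inclPsh.{w, t} V).obj Q) (s : Q ⟶ R)
    {X Z : V} (f : H.functor.obj (op X)) (m : P.obj (op Z)) :
    rapp (r ≫ (inclPsh.{w, t} V).map s) m f = s.app _ (rapp r m f) := rfl

theorem lapp_whiskerLeft_map_comp (s : P ⟶ Q)
    (l : H ⊗ (inclPsh.{w, t} V).obj Q ⟶ (inclPsh.{w, t} V).obj R)
    {X Z : V} (f : H.functor.obj (op X)) (m : P.obj (op Z)) :
    lapp (H ◁ (inclPsh.{w, t} V).map s ≫ l) f m = lapp l f (s.app _ m) := by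
  rw [lapp, comp_app, whiskerLeft_app]
  rfl

theorem rapp_map_whiskerRight_comp (s : P ⟶ Q)
    (r : (inclPsh.{w, t} V).obj Q ⊗ H ⟶ (inclPsh.{w, t} V).obj R)
    {X Z : V} (f : H.functor.obj (op X)) (m : P.obj (op Z)) :
    rapp ((inclPsh.{w, t} V).map s ▷ H ≫ r) m f = rapp r (s.app _ m) f := by
  rw [rapp, comp_app, whiskerRight_app]
  rfl

/-- The morphism `H ⊗ P → Q` corresponding to a bilinear map. -/
def lmk (φ : ∀ {X Z : V}, H.functor.obj (op X) → P.obj (op Z) → Q.obj (op (X ⊗ Z)))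
    (hφ : ∀ {X X' Z Z' : V} (α : X' ⟶ X) (β : Z' ⟶ Z) (f : H.functor.obj (op X))
      (m : P.obj (op Z)),
      φ (H.functor.map α.op f) (P.map β.op m) = Q.map (α ⊗ₘ β).op (φ f m)) :
    H ⊗ (inclPsh.{w, t} V).obj P ⟶ (inclPsh.{w, t} V).obj Q :=
  DayFunctor.tensorDesc
    { app := fun x => ↾(fun p => up (φ (X := x.1.unop) (Z := x.2.unop) p.1 (down p.2)))
      naturality := fun x y u => by
        ext p
        exact congrArg up (hφ u.1.unop u.2.unop p.1 (down p.2)) }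

theorem lapp_lmk (φ : ∀ {X Z : V}, H.functor.obj (op X) → P.obj (op Z) → Q.obj (op (X ⊗ Z)))
    (hφ) {X Z : V} (f : H.functor.obj (op X)) (m : P.obj (op Z)) :
    lapp (lmk.{w, t} φ hφ) f m = φ f m :=
  congrArg down (tensorDesc_app _ f (up m))

/-- The morphism `P ⊗ H → Q` corresponding to a bilinear map. -/
def rmk (φ : ∀ {X Z : V}, P.obj (op Z) → H.functor.obj (op X) → Q.obj (op (Z ⊗ X)))
    (hφ : ∀ {X X' Z Z' : V} (α : X' ⟶ X) (β : Z' ⟶ Z) (f : H.functor.obj (op X))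
      (m : P.obj (op Z)),
      φ (P.map β.op m) (H.functor.map α.op f) = Q.map (β ⊗ₘ α).op (φ m f)) :
    (inclPsh.{w, t} V).obj P ⊗ H ⟶ (inclPsh.{w, t} V).obj Q :=
  DayFunctor.tensorDesc
    { app := fun x => ↾(fun p => up (φ (X := x.2.unop) (Z := x.1.unop) (down p.1) p.2))
      naturality := fun x y u => by
        ext p
        exact congrArg up (hφ u.2.unop u.1.unop p.2 (down p.1)) }

theorem rapp_rmk (φ : ∀ {X Z : V}, P.obj (op Z) → H.functor.obj (op X) → Q.obj (op (Z ⊗ X)))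
    (hφ) {X Z : V} (f : H.functor.obj (op X)) (m : P.obj (op Z)) :
    rapp (rmk.{w, t} φ hφ) m f = φ m f :=
  congrArg down (tensorDesc_app _ (up m) f)

/-- The inverse unitor sends `m` to the class of `(nu, m)`, so the composite depends on `e` only
through the single element `e(nu)`. The target `s` is arbitrary because the criterion serves both
the unit axiom, with `s` the identity, and the action of generalized elements in 2-cells. -/
theorem lunit_iff (e : 𝟙_ (Psh.{w, t} V) ⟶ H)
    (l : H ⊗ (inclPsh.{w, t} V).obj P ⟶ (inclPsh.{w, t} V).obj Q) (s : P ⟶ Q) :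
    (λ_ _).inv ≫ e ▷ _ ≫ l = (inclPsh.{w, t} V).map s ↔
      ∀ {Z : V} (m : P.obj (op Z)),
        Q.map (λ_ Z).inv.op (lapp l (e.natTrans.app (op (𝟙_ V)) (nu V)) m) = s.app _ m := by
  have key : ∀ {Z : V} (m : P.obj (op Z)),
      down (((λ_ _).inv ≫ e ▷ _ ≫ l).natTrans.app (op Z) (up m)) =
        Q.map (λ_ Z).inv.op (lapp l (e.natTrans.app (op (𝟙_ V)) (nu V)) m) := fun {Z} m => by
    rw [comp_app, leftUnitor_inv_app, app_map, comp_app, whiskerRight_app]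
    rfl
  refine ⟨fun h Z m => ?_, fun h => hom_ext' fun x m => down_injective ?_⟩
  · rw [← key, h]
    rfl
  · exact (key (down m)).trans (h (down m))

theorem runit_iff (e : 𝟙_ (Psh.{w, t} V) ⟶ H)
    (r : (inclPsh.{w, t} V).obj P ⊗ H ⟶ (inclPsh.{w, t} V).obj Q) (s : P ⟶ Q) :
    (ρ_ _).inv ≫ _ ◁ e ≫ r = (inclPsh.{w, t} V).map s ↔
      ∀ {Z : V} (m : P.obj (op Z)),
        Q.map (ρ_ Z).inv.op (rapp r m (e.natTrans.app (op (𝟙_ V)) (nu V))) = s.app _ m := by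
  have key : ∀ {Z : V} (m : P.obj (op Z)),
      down (((ρ_ _).inv ≫ _ ◁ e ≫ r).natTrans.app (op Z) (up m)) =
        Q.map (ρ_ Z).inv.op (rapp r m (e.natTrans.app (op (𝟙_ V)) (nu V))) := fun {Z} m => by
    rw [comp_app, rightUnitor_inv_app, app_map, comp_app, whiskerLeft_app]
    rfl
  refine ⟨fun h Z m => ?_, fun h => hom_ext' fun x m => down_injective ?_⟩
  · rw [← key, h]
    rfl
  · exact (key (down m)).trans (h (down m))

/-- Morphisms out of a threefold convolution are tested on elements `eta (eta f g) m`. The Day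
associator rebrackets such an element and reindexes it along the associator of `V`, which is where
the latter comes from. -/
theorem lassoc_iff {K L : Psh.{w, t} V} (c : H ⊗ K ⟶ L)
    (l : L ⊗ (inclPsh.{w, t} V).obj P ⟶ (inclPsh.{w, t} V).obj R)
    (l' : K ⊗ (inclPsh.{w, t} V).obj P ⟶ (inclPsh.{w, t} V).obj Q)
    (l'' : H ⊗ (inclPsh.{w, t} V).obj Q ⟶ (inclPsh.{w, t} V).obj R) :
    c ▷ _ ≫ l = (α_ _ _ _).hom ≫ H ◁ l' ≫ l'' ↔
      ∀ {X Y Z : V} (f : H.functor.obj (op X)) (g : K.functor.obj (op Y)) (m : P.obj (op Z)),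
        lapp l (X := X ⊗ Y) (c.natTrans.app (op X ⊗ op Y) (eta H K f g)) m =
          R.map (α_ X Y Z).hom.op (lapp l'' f (lapp l' g m)) := by
  have key : ∀ {X Y Z : V} (f : H.functor.obj (op X)) (g : K.functor.obj (op Y))
      (m : P.obj (op Z)),
      down (((α_ _ _ _).hom ≫ H ◁ l' ≫ l'').natTrans.app ((op X ⊗ op Y) ⊗ op Z)
        (eta (H ⊗ K) _ (eta H K f g) (up m))) =
          R.map (α_ X Y Z).hom.op (lapp l'' f (lapp l' g m)) := fun {X Y Z} f g m => by
    rw [comp_app, associator_app, app_map, comp_app, whiskerLeft_app]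
    rfl
  have key' : ∀ {X Y Z : V} (f : H.functor.obj (op X)) (g : K.functor.obj (op Y))
      (m : P.obj (op Z)),
      down ((c ▷ _ ≫ l).natTrans.app ((op X ⊗ op Y) ⊗ op Z)
        (eta (H ⊗ K) _ (eta H K f g) (up m))) =
        lapp l (X := X ⊗ Y) (c.natTrans.app (op X ⊗ op Y) (eta H K f g)) m :=
      fun {X Y Z} f g m => by
    rw [comp_app, whiskerRight_app]
    rfl
  refine ⟨fun h X Y Z f g m => ?_, fun h => eta_ext₃ fun x y z f g m => down_injective ?_⟩
  · rw [← key, ← key', h]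
  · exact (key' f g (down m)).trans ((h f g (down m)).trans (key f g (down m)).symm)

theorem rassoc_iff {K L : Psh.{w, t} V} (c : H ⊗ K ⟶ L)
    (r : (inclPsh.{w, t} V).obj P ⊗ L ⟶ (inclPsh.{w, t} V).obj R)
    (r' : (inclPsh.{w, t} V).obj P ⊗ H ⟶ (inclPsh.{w, t} V).obj Q)
    (r'' : (inclPsh.{w, t} V).obj Q ⊗ K ⟶ (inclPsh.{w, t} V).obj R) :
    _ ◁ c ≫ r = (α_ _ _ _).inv ≫ r' ▷ K ≫ r'' ↔
      ∀ {X Y Z : V} (f : H.functor.obj (op X)) (g : K.functor.obj (op Y)) (m : P.obj (op Z)),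
        rapp r m (X := X ⊗ Y) (c.natTrans.app (op X ⊗ op Y) (eta H K f g)) =
          R.map (α_ Z X Y).inv.op (rapp r'' (rapp r' m f) g) := by
  have key : ∀ {X Y Z : V} (f : H.functor.obj (op X)) (g : K.functor.obj (op Y))
      (m : P.obj (op Z)),
      down (((α_ _ _ _).hom ≫ _ ◁ c ≫ r).natTrans.app ((op Z ⊗ op X) ⊗ op Y)
        (eta _ K (eta _ H (up m) f) g)) =
          R.map (α_ Z X Y).hom.op
            (rapp r m (X := X ⊗ Y) (c.natTrans.app (op X ⊗ op Y) (eta H K f g))) :=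
      fun {X Y Z} f g m => by
    rw [comp_app, associator_app, app_map, comp_app, whiskerLeft_app]
    rfl
  have key' : ∀ {X Y Z : V} (f : H.functor.obj (op X)) (g : K.functor.obj (op Y))
      (m : P.obj (op Z)),
      down ((r' ▷ K ≫ r'').natTrans.app ((op Z ⊗ op X) ⊗ op Y)
        (eta _ K (eta _ H (up m) f) g)) = rapp r'' (rapp r' m f) g :=
      fun {X Y Z} f g m => by
    rw [comp_app, whiskerRight_app]
    rfl
  -- `eta_ext₃` concerns left-bracketed convolutions, so the inverse associator is moved across
  -- first.
  rw [Iso.eq_inv_comp]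
  refine ⟨fun h X Y Z f g m => ?_, fun h => eta_ext₃ fun z x y m f g => down_injective ?_⟩
  · rw [← key', ← h, key, map_map_apply, Iso.inv_hom_id, map_id_apply]
  · refine (key f g (down m)).trans (Eq.trans ?_ (key' f g (down m)).symm)
    rw [h, map_map_apply, Iso.hom_inv_id, map_id_apply]

/-- Here the element acted upon sits between the two acting ones. The resulting condition has the
shape of `isBigradedSquare_iff`. -/
theorem lrassoc_iff {K : Psh.{w, t} V} {P' : Vᵒᵖ ⥤ Type w}
    (l : H ⊗ (inclPsh.{w, t} V).obj P ⟶ (inclPsh.{w, t} V).obj Q)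
    (r : (inclPsh.{w, t} V).obj Q ⊗ K ⟶ (inclPsh.{w, t} V).obj R)
    (r' : (inclPsh.{w, t} V).obj P ⊗ K ⟶ (inclPsh.{w, t} V).obj P')
    (l' : H ⊗ (inclPsh.{w, t} V).obj P' ⟶ (inclPsh.{w, t} V).obj R) :
    l ▷ K ≫ r = (α_ _ _ _).hom ≫ H ◁ r' ≫ l' ↔
      ∀ {X Y Z : V} (f : H.functor.obj (op X)) (g : K.functor.obj (op Y)) (m : P.obj (op Z)),
        rapp r (lapp l f m) g = R.map (α_ X Z Y).hom.op (lapp l' f (rapp r' m g)) := by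
  have key : ∀ {X Y Z : V} (f : H.functor.obj (op X)) (g : K.functor.obj (op Y))
      (m : P.obj (op Z)),
      down (((α_ _ _ _).hom ≫ H ◁ r' ≫ l').natTrans.app ((op X ⊗ op Z) ⊗ op Y)
        (eta _ K (eta H _ f (up m)) g)) =
          R.map (α_ X Z Y).hom.op (lapp l' f (rapp r' m g)) :=
      fun {X Y Z} f g m => by
    rw [comp_app, associator_app, app_map, comp_app, whiskerLeft_app]
    rfl
  have key' : ∀ {X Y Z : V} (f : H.functor.obj (op X)) (g : K.functor.obj (op Y))
      (m : P.obj (op Z)),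
      down ((l ▷ K ≫ r).natTrans.app ((op X ⊗ op Z) ⊗ op Y)
        (eta _ K (eta H _ f (up m)) g)) = rapp r (lapp l f m) g :=
      fun {X Y Z} f g m => by
    rw [comp_app, whiskerRight_app]
    rfl
  refine ⟨fun h X Y Z f g m => ?_, fun h => eta_ext₃ fun x z y f m g => down_injective ?_⟩
  · rw [← key, ← key', h]
  · exact (key' f g (down m)).trans ((h f g (down m)).trans (key f g (down m)).symm)

end

end Psh

end Curry

/-! ### Graded morphisms of `V̂` of grades `(X, I)` and `(I, X')` -/

section PresheafHoms

variable {V : Type w} [SmallCategory V] [MonoidalCategory V]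

section

variable {P Q R S : Vᵒᵖ ⥤ Type w}

theorem shift_natural {U : V × Vᴹᵒᵖ} (f : P ⟶ (shift U).op ⋙ Q) {Z Z' : V} (β : Z' ⟶ Z)
    (m : P.obj (op Z)) :
    (f.app (op Z') (P.map β.op m) : Q.obj (op ((shift U).obj Z'))) =
      Q.map ((shift U).map β).op (f.app (op Z) m) :=
  types_congr_hom (f.naturality β.op) m

/-- The graded morphism of grade `(X, I)` corresponding to a natural family of maps
`P(Z) → Q(X ⊗ Z)`. -/
def leftMk {X : V} (φ : ∀ {Z : V}, P.obj (op Z) → Q.obj (op (X ⊗ Z)))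
    (hφ : ∀ {Z Z' : V} (β : Z' ⟶ Z) (m : P.obj (op Z)),
      φ (P.map β.op m) = Q.map (X ◁ β).op (φ m)) :
    (presheaves V).left.Hom X P Q :=
  show P ⟶ (shift (X, 𝟙_ Vᴹᵒᵖ)).op ⋙ Q from
  { app := fun Z => ↾(fun m => Q.map (ρ_ (X ⊗ Z.unop)).hom.op (φ m))
    naturality := fun Z Z' u => by
      ext m
      change Q.map (ρ_ (X ⊗ Z'.unop)).hom.op (φ (P.map u.unop.op m)) =
        Q.map ((X ◁ u.unop) ▷ 𝟙_ V).op (Q.map (ρ_ (X ⊗ Z.unop)).hom.op (φ m))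
      rw [hφ, map_map_apply, map_map_apply]
      exact map_congr Q (by simp) _ }

/-- The natural family of maps `P(Z) → Q(Z ⊗ X)` corresponding to a graded morphism. -/
def leftApp {X : V} (f : (presheaves V).left.Hom X P Q) {Z : V} (m : P.obj (op Z)) :
    Q.obj (op (X ⊗ Z)) :=
  -- The shift by `(X, I)` sends `Z` to `(X ⊗ Z) ⊗ I`; the unitor removes the trailing unit.
  Q.map (ρ_ (X ⊗ Z)).inv.op
    ((show P ⟶ (shift (X, 𝟙_ Vᴹᵒᵖ)).op ⋙ Q from f).app (op Z) m)

theorem leftApp_leftMk {X : V} (φ : ∀ {Z : V}, P.obj (op Z) → Q.obj (op (X ⊗ Z))) (hφ)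
    {Z : V} (m : P.obj (op Z)) : leftApp (leftMk φ hφ) m = φ m := by
  change Q.map _ (Q.map _ _) = _
  rw [map_map_apply, Iso.inv_hom_id, map_id_apply]

theorem leftApp_ext {X : V} {f g : (presheaves V).left.Hom X P Q}
    (h : ∀ {Z : V} (m : P.obj (op Z)), leftApp f m = leftApp g m) : f = g := by
  refine NatTrans.ext (funext fun Z => ?_)
  ext m
  exact map_injective Q (ρ_ (X ⊗ Z.unop)).inv (h m)

theorem leftApp_map {X : V} (f : (presheaves V).left.Hom X P Q) {Z Z' : V} (β : Z' ⟶ Z)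
    (m : P.obj (op Z)) : leftApp f (P.map β.op m) = Q.map (X ◁ β).op (leftApp f m) := by
  refine (congrArg _ (shift_natural f β m)).trans ?_
  refine (map_map_apply Q _ _ _).trans (Eq.trans ?_ (map_map_apply Q _ _ _).symm)
  refine map_congr Q ?_ _
  change _ ≫ (X ◁ β) ▷ 𝟙_ V = _
  simp

theorem leftApp_reindex {X Y : V} (α : Y ⟶ X) (f : (presheaves V).left.Hom X P Q) {Z : V}
    (m : P.obj (op Z)) :
    leftApp ((presheaves V).left.reindex α f) m = Q.map (α ▷ Z).op (leftApp f m) := by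
  refine (map_map_apply Q _ _ _).trans (Eq.trans ?_ (map_map_apply Q _ _ _).symm)
  refine map_congr Q ?_ _
  change _ ≫ (α ▷ Z ⊗ₘ 𝟙 (𝟙_ V)) = _
  simp

/-- Composition evaluates `g` at the shifted object `(X ⊗ Z) ⊗ I`. Naturality of `g` in the right
unitor replaces it by `X ⊗ Z`, and the rest is coherence in `V`. -/
theorem leftApp_comp {X Y : V} (g : (presheaves V).left.Hom Y Q R)
    (f : (presheaves V).left.Hom X P Q) {Z : V} (m : P.obj (op Z)) :
    leftApp ((presheaves V).left.comp g f) m =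
      R.map (α_ Y X Z).hom.op (leftApp g (leftApp f m)) := by
  refine Eq.trans ?_ (congrArg (fun z => R.map (α_ Y X Z).hom.op (R.map (ρ_ _).inv.op z))
    (shift_natural g (ρ_ (X ⊗ Z)).inv _).symm)
  refine (congrArg _ (map_map_apply R _ _ _)).trans ?_
  refine (map_map_apply R _ _ _).trans (Eq.trans ?_ (congrArg _ (map_map_apply R _ _ _).symm))
  refine Eq.trans ?_ (map_map_apply R _ _ _).symm
  refine map_congr R ?_ _
  change (ρ_ _).inv ≫ (𝟙 (Y ⊗ X) ▷ Z ⊗ₘ (ρ_ (𝟙_ V)).inv) ≫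
    (α_ Y X Z).hom ▷ (𝟙_ V ⊗ 𝟙_ V) ≫ (α_ (Y ⊗ (X ⊗ Z)) (𝟙_ V) (𝟙_ V)).inv ≫
      (α_ Y (X ⊗ Z) (𝟙_ V)).hom ▷ 𝟙_ V =
    (α_ Y X Z).hom ≫ (ρ_ (Y ⊗ X ⊗ Z)).inv ≫ (Y ◁ (ρ_ (X ⊗ Z)).inv) ▷ 𝟙_ V
  monoidal

/-- The graded morphism of grade `(I, X)` corresponding to a natural family of maps
`P(Z) → Q(Z ⊗ X)`. -/
def rightMk {X : Vᴹᵒᵖ} (φ : ∀ {Z : V}, P.obj (op Z) → Q.obj (op (Z ⊗ X.unmop)))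
    (hφ : ∀ {Z Z' : V} (β : Z' ⟶ Z) (m : P.obj (op Z)),
      φ (P.map β.op m) = Q.map (β ▷ X.unmop).op (φ m)) :
    (presheaves V).right.Hom X P Q :=
  show P ⟶ (shift (𝟙_ V, X)).op ⋙ Q from
  { app := fun Z => ↾(fun m => Q.map ((λ_ Z.unop).hom ▷ X.unmop).op (φ m))
    naturality := fun Z Z' u => by
      ext m
      change Q.map ((λ_ Z'.unop).hom ▷ X.unmop).op (φ (P.map u.unop.op m)) =
        Q.map ((𝟙_ V ◁ u.unop) ▷ X.unmop).op (Q.map ((λ_ Z.unop).hom ▷ X.unmop).op (φ m))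
      rw [hφ, map_map_apply, map_map_apply]
      exact map_congr Q (by monoidal) _ }

/-- The natural family of maps `P(Z) → Q(Z ⊗ X)` corresponding to a graded morphism. -/
def rightApp {X : Vᴹᵒᵖ} (f : (presheaves V).right.Hom X P Q) {Z : V} (m : P.obj (op Z)) :
    Q.obj (op (Z ⊗ X.unmop)) :=
  -- The shift by `(I, X)` sends `Z` to `(I ⊗ Z) ⊗ X`; the left unitor removes the inner unit.
  Q.map ((λ_ Z).inv ▷ X.unmop).op
    ((show P ⟶ (shift (𝟙_ V, X)).op ⋙ Q from f).app (op Z) m)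

theorem rightApp_rightMk {X : Vᴹᵒᵖ} (φ : ∀ {Z : V}, P.obj (op Z) → Q.obj (op (Z ⊗ X.unmop))) (hφ)
    {Z : V} (m : P.obj (op Z)) : rightApp (rightMk φ hφ) m = φ m := by
  change Q.map _ (Q.map _ _) = _
  rw [map_map_apply, ← comp_whiskerRight, Iso.inv_hom_id, id_whiskerRight, map_id_apply]

theorem rightApp_ext {X : Vᴹᵒᵖ} {f g : (presheaves V).right.Hom X P Q}
    (h : ∀ {Z : V} (m : P.obj (op Z)), rightApp f m = rightApp g m) : f = g := by
  refine NatTrans.ext (funext fun Z => ?_)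
  ext m
  exact map_injective Q ((λ_ Z.unop).inv ▷ X.unmop) (h m)

theorem rightApp_map {X : Vᴹᵒᵖ} (f : (presheaves V).right.Hom X P Q) {Z Z' : V} (β : Z' ⟶ Z)
    (m : P.obj (op Z)) : rightApp f (P.map β.op m) = Q.map (β ▷ X.unmop).op (rightApp f m) := by
  refine (congrArg _ (shift_natural f β m)).trans ?_
  refine (map_map_apply Q _ _ _).trans (Eq.trans ?_ (map_map_apply Q _ _ _).symm)
  refine map_congr Q ?_ _
  change _ ≫ (𝟙_ V ◁ β) ▷ X.unmop = _
  monoidal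

theorem rightApp_reindex {X Y : Vᴹᵒᵖ} (α : Y ⟶ X) (f : (presheaves V).right.Hom X P Q) {Z : V}
    (m : P.obj (op Z)) :
    rightApp ((presheaves V).right.reindex α f) m = Q.map (Z ◁ α.unmop).op (rightApp f m) := by
  refine (map_map_apply Q _ _ _).trans (Eq.trans ?_ (map_map_apply Q _ _ _).symm)
  refine map_congr Q ?_ _
  change _ ≫ (𝟙 (𝟙_ V) ▷ Z ⊗ₘ α.unmop) = _
  simp [whisker_exchange]

/-- The grade of the composite in the reverse is `X ⊗ Y` in `V`: the morphism applied first keeps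
its grade next to `Z`, hence the inverse associator. -/
theorem rightApp_comp {X Y : Vᴹᵒᵖ} (g : (presheaves V).right.Hom Y Q R)
    (f : (presheaves V).right.Hom X P Q) {Z : V} (m : P.obj (op Z)) :
    rightApp ((presheaves V).right.comp g f) m =
      R.map (α_ Z X.unmop Y.unmop).inv.op (rightApp g (rightApp f m)) := by
  refine Eq.trans ?_ (congrArg
    (fun z => R.map (α_ Z X.unmop Y.unmop).inv.op (R.map ((λ_ _).inv ▷ Y.unmop).op z))
    (shift_natural g ((λ_ Z).inv ▷ X.unmop) _).symm)
  refine (congrArg _ (map_map_apply R _ _ _)).trans ?_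
  refine (map_map_apply R _ _ _).trans (Eq.trans ?_ (congrArg _ (map_map_apply R _ _ _).symm))
  refine Eq.trans ?_ (map_map_apply R _ _ _).symm
  refine map_congr R ?_ _
  change (λ_ Z).inv ▷ (X.unmop ⊗ Y.unmop) ≫ ((λ_ (𝟙_ V)).inv ▷ Z ⊗ₘ 𝟙 (X.unmop ⊗ Y.unmop)) ≫
    (α_ (𝟙_ V) (𝟙_ V) Z).hom ▷ (X.unmop ⊗ Y.unmop) ≫
      (α_ (𝟙_ V ⊗ (𝟙_ V ⊗ Z)) X.unmop Y.unmop).inv ≫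
      (α_ (𝟙_ V) (𝟙_ V ⊗ Z) X.unmop).hom ▷ Y.unmop =
    (α_ Z X.unmop Y.unmop).inv ≫ (λ_ (Z ⊗ X.unmop)).inv ▷ Y.unmop ≫
      (𝟙_ V ◁ ((λ_ Z).inv ▷ X.unmop)) ▷ Y.unmop
  monoidal

/-- Multiplying by `X` first lands in grade `(X ⊗ Z) ⊗ X'` and multiplying by `X'` first in `X ⊗ (Z
⊗ X')`; the square says that the results match along the associator. With `lrassoc_iff`, this
identifies squares with commutation of the two actions. -/
theorem isBigradedSquare_iff {X : V} {X' : Vᴹᵒᵖ} (f : (presheaves V).left.Hom X P Q)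
    (g : (presheaves V).left.Hom X R S) (φ : (presheaves V).right.Hom X' P R)
    (φ' : (presheaves V).right.Hom X' Q S) :
    (presheaves V).IsBigradedSquare f g φ φ' ↔
      ∀ {Z : V} (m : P.obj (op Z)),
        rightApp φ' (leftApp f m) = S.map (α_ X Z X'.unmop).hom.op (leftApp g (rightApp φ m)) := by
  -- `hL` and `hR` identify the two elementwise expressions with the components of the reindexed
  -- composites `g ∘ φ` and `φ' ∘ f`, by naturality and coherence.
  have hL : ∀ {Z : V} (m : P.obj (op Z)),
      S.map (α_ X Z X'.unmop).hom.op (leftApp g (rightApp φ m)) =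
        (show P ⟶ (shift (X, X')).op ⋙ S from
          (presheaves V).reindex ((ρ_ X).inv ×ₘ (λ_ X').inv)
          ((presheaves V).comp (X := (𝟙_ V, X')) (Y := (X, 𝟙_ Vᴹᵒᵖ)) g φ)).app (op Z) m :=
      fun {Z} m => by
    refine (congrArg _ (congrArg _ (shift_natural g _ _))).trans ?_
    refine Eq.trans ?_ (map_map_apply S _ _ _).symm
    refine (congrArg _ (map_map_apply S _ _ _)).trans ((map_map_apply S _ _ _).trans ?_)
    refine map_congr S ?_ _
    change (α_ X Z X'.unmop).hom ≫ (ρ_ (X ⊗ Z ⊗ X'.unmop)).inv ≫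
        (X ◁ ((λ_ Z).inv ▷ X'.unmop)) ▷ 𝟙_ V =
      ((ρ_ X).inv ▷ Z ⊗ₘ (ρ_ X'.unmop).inv) ≫ (α_ X (𝟙_ V) Z).hom ▷ (X'.unmop ⊗ 𝟙_ V) ≫
        (α_ (X ⊗ (𝟙_ V ⊗ Z)) X'.unmop (𝟙_ V)).inv ≫ (α_ X (𝟙_ V ⊗ Z) X'.unmop).hom ▷ 𝟙_ V
    monoidal
  have hR : ∀ {Z : V} (m : P.obj (op Z)),
      rightApp φ' (leftApp f m) =
        (show P ⟶ (shift (X, X')).op ⋙ S from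
          (presheaves V).reindex ((λ_ X).inv ×ₘ (ρ_ X').inv)
          ((presheaves V).comp (X := (X, 𝟙_ Vᴹᵒᵖ)) (Y := (𝟙_ V, X')) φ' f)).app (op Z) m :=
      fun {Z} m => by
    refine (congrArg _ (shift_natural φ' _ _)).trans ?_
    refine Eq.trans ?_ (map_map_apply S _ _ _).symm
    refine (map_map_apply S _ _ _).trans ?_
    refine map_congr S ?_ _
    change (λ_ (X ⊗ Z)).inv ▷ X'.unmop ≫ (𝟙_ V ◁ (ρ_ (X ⊗ Z)).inv) ▷ X'.unmop =
      ((λ_ X).inv ▷ Z ⊗ₘ (λ_ X'.unmop).inv) ≫ (α_ (𝟙_ V) X Z).hom ▷ (𝟙_ V ⊗ X'.unmop) ≫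
        (α_ (𝟙_ V ⊗ (X ⊗ Z)) (𝟙_ V) X'.unmop).inv ≫ (α_ (𝟙_ V) (X ⊗ Z) (𝟙_ V)).hom ▷ X'.unmop
    monoidal
  refine ⟨fun h Z m => ?_, fun h => NatTrans.ext (funext fun Z => ?_)⟩
  · rw [hL, hR]
    exact congrArg (fun k : P ⟶ (shift (X, X')).op ⋙ S => k.app (op Z) m) h.symm
  · ext m
    exact (hL m).symm.trans ((h m).symm.trans (hR m))

/-- The graded morphism of grade `(I, I)` corresponding to a morphism of presheaves. -/
def ofHom (s : P ⟶ Q) : (presheaves V).Hom (𝟙_ (V × Vᴹᵒᵖ)) P Q where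
  app Z := s.app Z ≫ Q.map (shiftUnit Z.unop).op
  naturality Z Z' u := by
    simp only [NatTrans.naturality_assoc, Category.assoc, Functor.comp_map, Functor.op_map,
      ← Q.map_comp, ← op_comp]
    rw [shiftUnit_naturality]
    rfl

instance (Z : V) : IsIso (shiftUnit Z) :=
  inferInstanceAs (IsIso ((ρ_ (𝟙_ V ⊗ Z)).hom ≫ (λ_ Z).hom))

/-- The morphism of presheaves corresponding to a graded morphism of grade `(I, I)`. -/
def toHom (f : (presheaves V).Hom (𝟙_ (V × Vᴹᵒᵖ)) P Q) : P ⟶ Q where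
  app Z := (show P ⟶ (shift (𝟙_ (V × Vᴹᵒᵖ))).op ⋙ Q from f).app Z ≫
    Q.map (inv (shiftUnit Z.unop)).op
  naturality Z Z' u := by
    have := (show P ⟶ (shift (𝟙_ (V × Vᴹᵒᵖ))).op ⋙ Q from f).naturality u
    rw [reassoc_of% this, Category.assoc, ← Q.map_comp]
    refine congrArg _ ((congrArg Q.map (Quiver.Hom.unop_inj ?_)).trans (Q.map_comp _ _))
    exact (IsIso.inv_comp_eq _).2 (((IsIso.eq_comp_inv _).2 (shiftUnit_naturality u.unop)).trans
      (Category.assoc _ _ _))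

theorem ofHom_toHom (f : (presheaves V).Hom (𝟙_ (V × Vᴹᵒᵖ)) P Q) : ofHom (toHom f) = f := by
  refine NatTrans.ext (funext fun Z => ?_)
  change ((show P ⟶ (shift (𝟙_ (V × Vᴹᵒᵖ))).op ⋙ Q from f).app Z ≫
    Q.map (inv (shiftUnit Z.unop)).op) ≫ Q.map (shiftUnit Z.unop).op = _
  rw [Category.assoc, ← Q.map_comp, ← op_comp, IsIso.hom_inv_id]
  simp

/-- A graded morphism of grade `(I, I)` can be read as a left or as a right one. Both readings
return `s` up to a unitor, so one component can be tested for naturality on both sides. -/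
theorem leftApp_ofHom (s : P ⟶ Q) {Z : V} (m : P.obj (op Z)) :
    leftApp (X := 𝟙_ V) (ofHom s) m = Q.map (λ_ Z).hom.op (s.app (op Z) m) := by
  refine (map_map_apply Q _ _ _).trans (map_congr Q ?_ _)
  change (ρ_ _).inv ≫ (ρ_ _).hom ≫ (λ_ Z).hom = _
  simp

theorem rightApp_ofHom (s : P ⟶ Q) {Z : V} (m : P.obj (op Z)) :
    rightApp (X := 𝟙_ Vᴹᵒᵖ) (ofHom s) m = Q.map (ρ_ Z).hom.op (s.app (op Z) m) := by
  refine (map_map_apply Q _ _ _).trans (map_congr Q ?_ _)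
  change (λ_ Z).inv ▷ 𝟙_ V ≫ (ρ_ _).hom ≫ (λ_ Z).hom = _
  simp

theorem ofHom_injective : Function.Injective (ofHom (P := P) (Q := Q)) := fun s s' h => by
  refine NatTrans.ext (funext fun Z => ?_)
  ext m
  have := congrArg (fun k => leftApp (X := 𝟙_ V) k m) h
  exact map_injective Q (λ_ Z.unop).hom
    ((leftApp_ofHom s m).symm.trans (this.trans (leftApp_ofHom s' m)))

theorem ofHom_id : ofHom (𝟙 P) = (presheaves V).ident P := by
  refine NatTrans.ext (funext fun Z => ?_)
  exact Category.id_comp _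

theorem leftApp_ident {Z : V} (m : P.obj (op Z)) :
    leftApp ((presheaves V).left.ident P) m = P.map (λ_ Z).hom.op m := by
  exact (congrArg (fun k => leftApp (X := 𝟙_ _) k m)
    ((left_ident (presheaves V) P).trans ofHom_id.symm)).trans (leftApp_ofHom _ _)

theorem rightApp_ident {Z : V} (m : P.obj (op Z)) :
    rightApp ((presheaves V).right.ident P) m = P.map (ρ_ Z).hom.op m := by
  exact (congrArg (fun k => rightApp (X := 𝟙_ _) k m)
    ((right_ident (presheaves V) P).trans ofHom_id.symm)).trans (rightApp_ofHom _ _)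

/-- At grade `I` all the unitors and the associator cancel, so that graded naturality is plain
commutation with the maps `P(Z) → Q(X ⊗ Z)`. -/
theorem left_natural_ofHom_iff {X : V} (f : (presheaves V).left.Hom X P Q)
    (f' : (presheaves V).left.Hom X R S) (s : P ⟶ R) (t : Q ⟶ S) :
    (presheaves V).left.reindex (λ_ X).inv
        ((presheaves V).left.comp (X := X) (Y := 𝟙_ V) (ofHom t) f) =
      (presheaves V).left.reindex (ρ_ X).inv
        ((presheaves V).left.comp (X := 𝟙_ V) (Y := X) f' (ofHom s)) ↔
    ∀ {Z : V} (m : P.obj (op Z)), t.app _ (leftApp f m) = leftApp f' (s.app _ m) := by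
  have h₁ : ∀ {Z : V} (m : P.obj (op Z)), leftApp ((presheaves V).left.reindex (λ_ X).inv
      ((presheaves V).left.comp (X := X) (Y := 𝟙_ V) (ofHom t) f)) m = t.app _ (leftApp f m) :=
    fun {Z} m => by
      refine (leftApp_reindex _ _ m).trans ((congrArg _ (leftApp_comp _ _ m)).trans ?_)
      refine (congrArg _ (congrArg _ (leftApp_ofHom t _))).trans ?_
      rw [map_map_apply, map_map_apply]
      exact (map_congr S (by monoidal) _).trans (map_id_apply S _)
  have h₂ : ∀ {Z : V} (m : P.obj (op Z)), leftApp ((presheaves V).left.reindex (ρ_ X).inv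
      ((presheaves V).left.comp (X := 𝟙_ V) (Y := X) f' (ofHom s))) m =
        leftApp f' (s.app _ m) := fun {Z} m => by
      refine (leftApp_reindex _ _ m).trans ((congrArg _ (leftApp_comp _ _ m)).trans ?_)
      refine (congrArg _ (congrArg _ (congrArg _ (leftApp_ofHom s m)))).trans ?_
      refine (congrArg _ (congrArg _ (leftApp_map f' _ _))).trans ?_
      rw [map_map_apply, map_map_apply]
      exact (map_congr S (by monoidal) _).trans (map_id_apply S _)
  exact ⟨fun h Z m => (h₁ m).symm.trans ((congrArg (fun k => leftApp k m) h).trans (h₂ m)),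
    fun h => leftApp_ext fun m => (h₁ m).trans ((h m).trans (h₂ m).symm)⟩

theorem right_natural_ofHom_iff {X : Vᴹᵒᵖ} (f : (presheaves V).right.Hom X P Q)
    (f' : (presheaves V).right.Hom X R S) (s : P ⟶ R) (t : Q ⟶ S) :
    (presheaves V).right.reindex (λ_ X).inv
        ((presheaves V).right.comp (X := X) (Y := 𝟙_ Vᴹᵒᵖ) (ofHom t) f) =
      (presheaves V).right.reindex (ρ_ X).inv
        ((presheaves V).right.comp (X := 𝟙_ Vᴹᵒᵖ) (Y := X) f' (ofHom s)) ↔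
    ∀ {Z : V} (m : P.obj (op Z)), t.app _ (rightApp f m) = rightApp f' (s.app _ m) := by
  have h₁ : ∀ {Z : V} (m : P.obj (op Z)), rightApp ((presheaves V).right.reindex (λ_ X).inv
      ((presheaves V).right.comp (X := X) (Y := 𝟙_ Vᴹᵒᵖ) (ofHom t) f)) m =
        t.app _ (rightApp f m) := fun {Z} m => by
      refine (rightApp_reindex _ _ m).trans ((congrArg _ (rightApp_comp _ _ m)).trans ?_)
      refine (congrArg _ (congrArg _ (rightApp_ofHom t _))).trans ?_
      refine (congrArg _ (map_map_apply S _ _ _)).trans ((map_map_apply S _ _ _).trans ?_)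
      refine (map_congr S ?_ _).trans (map_id_apply S _)
      change Z ◁ (ρ_ X.unmop).inv ≫ (α_ Z X.unmop (𝟙_ V)).inv ≫ (ρ_ (Z ⊗ X.unmop)).hom = _
      monoidal
  have h₂ : ∀ {Z : V} (m : P.obj (op Z)), rightApp ((presheaves V).right.reindex (ρ_ X).inv
      ((presheaves V).right.comp (X := 𝟙_ Vᴹᵒᵖ) (Y := X) f' (ofHom s))) m =
        rightApp f' (s.app _ m) := fun {Z} m => by
      refine (rightApp_reindex _ _ m).trans ((congrArg _ (rightApp_comp _ _ m)).trans ?_)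
      refine (congrArg _ (congrArg _ (congrArg _ (rightApp_ofHom s m)))).trans ?_
      refine (congrArg _ (congrArg _ (rightApp_map f' _ _))).trans ?_
      refine (congrArg _ (map_map_apply S _ _ _)).trans ((map_map_apply S _ _ _).trans ?_)
      refine (map_congr S ?_ _).trans (map_id_apply S _)
      change Z ◁ (λ_ X.unmop).inv ≫ (α_ Z (𝟙_ V) X.unmop).inv ≫ (ρ_ Z).hom ▷ X.unmop = _
      monoidal
  exact ⟨fun h Z m => (h₁ m).symm.trans ((congrArg (fun k => rightApp k m) h).trans (h₂ m)),
    fun h => rightApp_ext fun m => (h₁ m).trans ((h m).trans (h₂ m).symm)⟩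

theorem ofHom_comp (s : P ⟶ Q) (t : Q ⟶ R) :
    ofHom (s ≫ t) = (presheaves V).comp₀ (ofHom t) (ofHom s) := by
  refine Eq.trans (leftApp_ext (X := 𝟙_ V) fun {Z} m => ?_) (left_comp₀ (presheaves V) _ _)
  refine (leftApp_ofHom _ m).trans (Eq.trans ?_ (leftApp_reindex _ _ m).symm)
  refine Eq.trans ?_ (congrArg _ (leftApp_comp (X := 𝟙_ V) (Y := 𝟙_ V) (ofHom t) (ofHom s) m)).symm
  refine Eq.trans ?_ (congrArg _ (congrArg _ (congrArg _ (leftApp_ofHom s m)))).symm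
  refine Eq.trans ?_ (congrArg _ (congrArg _ (leftApp_ofHom t _))).symm
  rw [nat_apply, map_map_apply, map_map_apply, map_map_apply]
  exact map_congr R (by monoidal) _

end

end PresheafHoms

/-! ### Modules between right graded categories in terms of elements -/

section ModuleElements

variable {V : Type w} [SmallCategory V] [MonoidalCategory V]
variable {A B : RightGradedCat.{o, max w t} V}

variable (A B) in
/-- `V̂`-modules `A ⇸ B` between right `V`-graded categories. -/
abbrev RightModule := EnrModule (inclPsh.{w, t} V) (RightGradedCat.Enriched.{o, w, t} A)
  (RightGradedCat.Enriched.{o, w, t} B)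

namespace RightModule

variable (M : RightModule.{o, w, t} A B)

/-- The presheaf `M(b, a)`. -/
abbrev val (b : B.Obj) (a : A.Obj) : Vᵒᵖ ⥤ Type w := EnrModule.obj M b a

/-- The action `B(b, b') ⊗ M(b', a) → M(b, a)`. -/
def lactPsh (b b' : B.Obj) (a : A.Obj) :
    RightGradedCat.homPsh.{o, w, t} B b b' ⊗ (inclPsh.{w, t} V).obj (M.val b' a) ⟶
      (inclPsh.{w, t} V).obj (M.val b a) := EnrModule.lact M b b' a

/-- The action `M(b, a') ⊗ A(a', a) → M(b, a)`. -/
def ractPsh (b : B.Obj) (a' a : A.Obj) :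
    (inclPsh.{w, t} V).obj (M.val b a') ⊗ RightGradedCat.homPsh.{o, w, t} A a' a ⟶
      (inclPsh.{w, t} V).obj (M.val b a) := EnrModule.ract M b a' a

/-- The left action of `f ∈ B(X; b, b')`. -/
def lmul {X Z : V} {b b' : B.Obj} {a : A.Obj} (f : B.Hom (mop X) b b')
    (m : (M.val b' a).obj (op Z)) : (M.val b a).obj (op (X ⊗ Z)) :=
  Psh.lapp (X := X) (M.lactPsh b b' a) f m

/-- The right action of `f ∈ A(X; a', a)`. -/
def rmul {X Z : V} {b : B.Obj} {a' a : A.Obj} (m : (M.val b a').obj (op Z))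
    (f : A.Hom (mop X) a' a) : (M.val b a).obj (op (Z ⊗ X)) :=
  Psh.rapp (X := X) (M.ractPsh b a' a) m f

theorem lmul_map {X Z Z' : V} {b b' : B.Obj} {a : A.Obj} (β : Z' ⟶ Z) (f : B.Hom (mop X) b b')
    (m : (M.val b' a).obj (op Z)) :
    M.lmul f ((M.val b' a).map β.op m) = (M.val b a).map (X ◁ β).op (M.lmul f m) :=
  Psh.lapp_map_right (X := X) (M.lactPsh b b' a) β f m

theorem lmul_reindex {X X' Z : V} {b b' : B.Obj} {a : A.Obj} (α : X' ⟶ X)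
    (f : B.Hom (mop X) b b') (m : (M.val b' a).obj (op Z)) :
    M.lmul (B.reindex α.mop f) m = (M.val b a).map (α ▷ Z).op (M.lmul f m) :=
  Psh.lapp_map_left (M.lactPsh b b' a) α f m

theorem rmul_map {X Z Z' : V} {b : B.Obj} {a' a : A.Obj} (β : Z' ⟶ Z) (f : A.Hom (mop X) a' a)
    (m : (M.val b a').obj (op Z)) :
    M.rmul ((M.val b a').map β.op m) f = (M.val b a).map (β ▷ X).op (M.rmul m f) :=
  Psh.rapp_map_left (X := X) (M.ractPsh b a' a) β f m

theorem rmul_reindex {X X' Z : V} {b : B.Obj} {a' a : A.Obj} (α : X' ⟶ X)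
    (f : A.Hom (mop X) a' a) (m : (M.val b a').obj (op Z)) :
    M.rmul m (A.reindex α.mop f) = (M.val b a).map (Z ◁ α).op (M.rmul m f) :=
  Psh.rapp_map_right (M.ractPsh b a' a) α f m

/-- The enriched identity corresponds to the element `B.ident b` by `idPsh_app`, so the unit axiom
of the module becomes a formula for the action of that element. -/
theorem lmul_ident {Z : V} (b : B.Obj) {a : A.Obj} (m : (M.val b a).obj (op Z)) :
    M.lmul (X := 𝟙_ V) (B.ident b) m = (M.val b a).map (λ_ Z).hom.op m := by
  -- The axiom is restated with the hom-objects written as `homPsh` and with an identity of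
  -- presheaves as target, the shape required by `lunit_iff`.
  have e : (λ_ _).inv ≫ RightGradedCat.idPsh.{o, w, t} B b ▷ _ ≫ M.lactPsh b b a =
    (inclPsh.{w, t} V).map (𝟙 (M.val b a)) := EnrModule.lact_unit M b a
  have h := (Psh.lunit_iff _ _ _).1 e m
  refine map_injective (M.val b a) (λ_ Z).inv (Eq.trans (congrArg (fun k =>
    (M.val b a).map (λ_ Z).inv.op (Psh.lapp (X := 𝟙_ V) (M.lactPsh b b a) k m))
    (RightGradedCat.idPsh_app.{o, w, t} B b).symm) (h.trans (map_hom_inv_apply _ _ m).symm))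

theorem rmul_ident {Z : V} {b : B.Obj} (a : A.Obj) (m : (M.val b a).obj (op Z)) :
    M.rmul (X := 𝟙_ V) m (A.ident a) = (M.val b a).map (ρ_ Z).hom.op m := by
  have e : (ρ_ _).inv ≫ _ ◁ RightGradedCat.idPsh.{o, w, t} A a ≫ M.ractPsh b a a =
    (inclPsh.{w, t} V).map (𝟙 (M.val b a)) := EnrModule.ract_unit M b a
  have h := (Psh.runit_iff _ _ _).1 e m
  refine map_injective (M.val b a) (ρ_ Z).inv (Eq.trans (congrArg (fun k =>
    (M.val b a).map (ρ_ Z).inv.op (Psh.rapp (X := 𝟙_ V) (M.ractPsh b a a) m k))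
    (RightGradedCat.idPsh_app.{o, w, t} A a).symm) (h.trans (map_hom_inv_apply _ _ m).symm))

/-- Since `B` is right graded, `g ∘ f` has grade `X ⊗ Y` in `V`. The action is contravariant in `b`,
so `g` acts first and the grades line up without any symmetry. -/
theorem lmul_comp {X Y Z : V} {b b' b'' : B.Obj} {a : A.Obj} (f : B.Hom (mop X) b b')
    (g : B.Hom (mop Y) b' b'') (m : (M.val b'' a).obj (op Z)) :
    M.lmul (X := X ⊗ Y) (B.comp g f) m =
      (M.val b a).map (α_ X Y Z).hom.op (M.lmul f (M.lmul g m)) := by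
  have e : RightGradedCat.compPsh.{o, w, t} B b b' b'' ▷ _ ≫ M.lactPsh b b'' a =
    (α_ _ _ _).hom ≫ _ ◁ M.lactPsh b' b'' a ≫ M.lactPsh b b' a := EnrModule.lact_assoc M b b' b'' a
  have h := (Psh.lassoc_iff _ _ _ _).1 e (X := X) (Y := Y) f g m
  exact (congrArg (fun k => Psh.lapp (X := X ⊗ Y) (M.lactPsh b b'' a) k m)
    (RightGradedCat.compPsh_app.{o, w, t} B (x := op X) (y := op Y) f g).symm).trans h

theorem rmul_comp {X Y Z : V} {b : B.Obj} {a'' a' a : A.Obj} (f : A.Hom (mop X) a'' a')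
    (g : A.Hom (mop Y) a' a) (m : (M.val b a'').obj (op Z)) :
    M.rmul (X := X ⊗ Y) m (A.comp g f) =
      (M.val b a).map (α_ Z X Y).inv.op (M.rmul (M.rmul m f) g) := by
  have e : _ ◁ RightGradedCat.compPsh.{o, w, t} A a'' a' a ≫ M.ractPsh b a'' a =
    (α_ _ _ _).inv ≫ M.ractPsh b a'' a' ▷ _ ≫ M.ractPsh b a' a := EnrModule.ract_assoc M b a'' a' a
  have h := (Psh.rassoc_iff _ _ _ _).1 e (X := X) (Y := Y) f g m
  exact (congrArg (fun k => Psh.rapp (X := X ⊗ Y) (M.ractPsh b a'' a) m k)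
    (RightGradedCat.compPsh_app.{o, w, t} A (x := op X) (y := op Y) f g).symm).trans h

theorem rmul_lmul {X Y Z : V} {b b' : B.Obj} {a' a : A.Obj} (f : B.Hom (mop X) b b')
    (g : A.Hom (mop Y) a' a) (m : (M.val b' a').obj (op Z)) :
    M.rmul (M.lmul f m) g = (M.val b a).map (α_ X Z Y).hom.op (M.lmul f (M.rmul m g)) := by
  have e : M.lactPsh b b' a' ▷ _ ≫ M.ractPsh b a' a =
    (α_ _ _ _).hom ≫ _ ◁ M.ractPsh b' a' a ≫ M.lactPsh b b' a := EnrModule.lact_ract M b b' a' a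
  exact (Psh.lrassoc_iff _ _ _ _).1 e (X := X) (Y := Y) f g m

/-- The graded morphism of grade `(X, I)` given by the left action of `f ∈ B(X; b, b')`. -/
def leftHom {X : V} {b b' : B.Obj} (a : A.Obj) (f : B.Hom (mop X) b b') :
    (presheaves V).left.Hom X (M.val b' a) (M.val b a) :=
  leftMk (fun m => M.lmul f m) (fun β m => M.lmul_map β f m)

/-- The graded morphism of grade `(I, X)` given by the right action of `f ∈ A(X; a', a)`. -/
def rightHom {X : Vᴹᵒᵖ} (b : B.Obj) {a' a : A.Obj} (f : A.Hom X a' a) :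
    (presheaves V).right.Hom X (M.val b a') (M.val b a) :=
  rightMk (fun m => M.rmul (X := X.unmop) m f) (fun β m => M.rmul_map β f m)

theorem leftApp_leftHom {X Z : V} {b b' : B.Obj} (a : A.Obj) (f : B.Hom (mop X) b b')
    (m : (M.val b' a).obj (op Z)) : leftApp (M.leftHom a f) m = M.lmul f m :=
  leftApp_leftMk _ _ m

theorem rightApp_rightHom {X : Vᴹᵒᵖ} {Z : V} (b : B.Obj) {a' a : A.Obj} (f : A.Hom X a' a)
    (m : (M.val b a').obj (op Z)) : rightApp (M.rightHom b f) m = M.rmul (X := X.unmop) m f :=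
  rightApp_rightMk _ _ m

/-- The functor laws, evaluated on elements, are naturality of the action in the grade and the
associativity and unit axioms; the formal opposite absorbs the contravariance in `b`. -/
theorem isGradedFunctor_leftHom (a : A.Obj) :
    IsGradedFunctor (RightGradedCat.formalOp B) (presheaves V).left (fun b => M.val b a)
      (fun f => M.leftHom a f) where
  map_reindex {X Y} α {b b'} f := leftApp_ext fun m => by
    refine (M.leftApp_leftHom a _ m).trans (Eq.trans ?_ (leftApp_reindex α _ m).symm)
    refine Eq.trans ?_ (congrArg _ (M.leftApp_leftHom a _ m).symm)
    exact M.lmul_reindex α f m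
  map_comp {X Y b b' b''} g f := leftApp_ext fun m => by
    refine (M.leftApp_leftHom a _ m).trans (Eq.trans ?_ (leftApp_comp _ _ m).symm)
    refine Eq.trans ?_ (congrArg _ ((M.leftApp_leftHom a _ _).trans
      (congrArg _ (M.leftApp_leftHom a _ m))).symm)
    exact M.lmul_comp g f m
  map_ident b := leftApp_ext fun m =>
    (M.leftApp_leftHom a _ m).trans ((M.lmul_ident b m).trans (leftApp_ident m).symm)

theorem isGradedFunctor_rightHom (b : B.Obj) :
    IsGradedFunctor A (presheaves V).right (fun a => M.val b a) (fun f => M.rightHom b f) where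
  map_reindex {X Y} α {a a'} f := rightApp_ext fun m => by
    refine (M.rightApp_rightHom b _ m).trans (Eq.trans ?_ (rightApp_reindex α _ m).symm)
    refine Eq.trans ?_ (congrArg _ (M.rightApp_rightHom b _ m).symm)
    exact M.rmul_reindex α.unmop f m
  map_comp {X Y a a' a''} g f := rightApp_ext fun m => by
    refine (M.rightApp_rightHom b _ m).trans (Eq.trans ?_ (rightApp_comp _ _ m).symm)
    refine Eq.trans ?_ (congrArg _ ((M.rightApp_rightHom b _ _).trans
      (congrArg (fun k => M.rmul (X := Y.unmop) k g) (M.rightApp_rightHom b _ m))).symm)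
    exact M.rmul_comp f g m
  map_ident a := rightApp_ext fun m =>
    (M.rightApp_rightHom b _ m).trans ((M.rmul_ident a m).trans (rightApp_ident m).symm)

/-- The graded bifunctor `B°, A → V̂` corresponding to a module. -/
def toBifunctor : GradedBifunctor (RightGradedCat.formalOp B) A (presheaves V) where
  obj b a := M.val b a
  mapL a _ _ _ f := M.leftHom a f
  mapR b _ _ _ f := M.rightHom b f
  isGradedL a := M.isGradedFunctor_leftHom a
  isGradedR b := M.isGradedFunctor_rightHom b
  square {X b b'} f {X' a a'} g := (isBigradedSquare_iff _ _ _ _).2 fun m => by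
    refine (M.rightApp_rightHom b' g _).trans ?_
    refine (congrArg (fun k => M.rmul (X := X'.unmop) k g) (M.leftApp_leftHom a f m)).trans ?_
    -- On elements, the bigraded square is exactly the commutation of the two actions.
    refine (M.rmul_lmul f g m).trans (congrArg _ ?_)
    exact ((M.leftApp_leftHom a' f _).trans (congrArg _ (M.rightApp_rightHom b g m))).symm

end RightModule

end ModuleElements

/-! ### The module corresponding to a graded bifunctor -/

section ModuleOfBifunctor

variable {V : Type w} [SmallCategory V] [MonoidalCategory V]
variable {A B : RightGradedCat.{o, max w t} V}

namespace GradedBifunctor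

variable (F : GradedBifunctor (RightGradedCat.formalOp B) A (presheaves V))

/-- The presheaf `F(b, a)`. -/
abbrev val (b : B.Obj) (a : A.Obj) : Vᵒᵖ ⥤ Type w := F.obj b a

/-- The bilinear map given by the action of `F` on graded morphisms of `B`. -/
def lmul {X Z : V} {b b' : B.Obj} {a : A.Obj} (f : B.Hom (mop X) b b')
    (m : (F.val b' a).obj (op Z)) : (F.val b a).obj (op (X ⊗ Z)) :=
  leftApp (X := X) (F.mapL a (a := b') (a' := b) f) m

/-- The bilinear map given by the action of `F` on graded morphisms of `A`. -/
def rmul {X Z : V} {b : B.Obj} {a' a : A.Obj} (m : (F.val b a').obj (op Z))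
    (f : A.Hom (mop X) a' a) : (F.val b a).obj (op (Z ⊗ X)) :=
  rightApp (X := mop X) (F.mapR b f) m

/-- Naturality in the grade is preservation of reindexing by `F`; naturality in `Z` holds because
the values of `F` are natural transformations. Together they let the family factor through the Day
convolution. -/
theorem lmul_natural {X X' Z Z' : V} {b b' : B.Obj} {a : A.Obj} (α : X' ⟶ X) (β : Z' ⟶ Z)
    (f : B.Hom (mop X) b b') (m : (F.val b' a).obj (op Z)) :
    F.lmul (B.reindex α.mop f) ((F.val b' a).map β.op m) =
      (F.val b a).map (α ⊗ₘ β).op (F.lmul f m) := by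
  refine (congrArg (fun k => leftApp (X := X') k ((F.val b' a).map β.op m))
    ((F.isGradedL a).map_reindex (A := b') (B := b) α f)).trans ?_
  refine (leftApp_reindex α _ _).trans ((congrArg _ (leftApp_map _ β m)).trans ?_)
  exact (map_map_apply (F.val b a) _ _ _).trans
    (map_congr _ (MonoidalCategory.tensorHom_def _ _).symm _)

theorem rmul_natural {X X' Z Z' : V} {b : B.Obj} {a' a : A.Obj} (α : X' ⟶ X) (β : Z' ⟶ Z)
    (f : A.Hom (mop X) a' a) (m : (F.val b a').obj (op Z)) :
    F.rmul ((F.val b a').map β.op m) (A.reindex α.mop f) =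
      (F.val b a).map (β ⊗ₘ α).op (F.rmul m f) := by
  refine (congrArg (fun k => rightApp (X := mop X') k ((F.val b a').map β.op m))
    ((F.isGradedR b).map_reindex α.mop f)).trans ?_
  refine (rightApp_reindex α.mop _ _).trans ((congrArg _ (rightApp_map _ β m)).trans ?_)
  exact (map_map_apply (F.val b a) _ _ _).trans
    (map_congr _ (MonoidalCategory.tensorHom_def' _ _).symm _)

theorem lmul_ident {Z : V} (b : B.Obj) {a : A.Obj} (m : (F.val b a).obj (op Z)) :
    F.lmul (X := 𝟙_ V) (B.ident b) m = (F.val b a).map (λ_ Z).hom.op m :=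
  (congrArg (fun k => leftApp (X := 𝟙_ V) k m) ((F.isGradedL a).map_ident b)).trans
    (leftApp_ident m)

theorem rmul_ident {Z : V} {b : B.Obj} (a : A.Obj) (m : (F.val b a).obj (op Z)) :
    F.rmul (X := 𝟙_ V) m (A.ident a) = (F.val b a).map (ρ_ Z).hom.op m :=
  (congrArg (fun k => rightApp (X := 𝟙_ Vᴹᵒᵖ) k m) ((F.isGradedR b).map_ident a)).trans
    (rightApp_ident m)

theorem lmul_comp {X Y Z : V} {b b' b'' : B.Obj} {a : A.Obj} (f : B.Hom (mop X) b b')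
    (g : B.Hom (mop Y) b' b'') (m : (F.val b'' a).obj (op Z)) :
    F.lmul (X := X ⊗ Y) (B.comp g f) m =
      (F.val b a).map (α_ X Y Z).hom.op (F.lmul f (F.lmul g m)) :=
  (congrArg (fun k => leftApp (X := X ⊗ Y) k m)
    ((F.isGradedL a).map_comp (X := Y) (Y := X) (A := b'') (B := b') (E := b) f g)).trans
      (leftApp_comp _ _ m)

theorem rmul_comp {X Y Z : V} {b : B.Obj} {a'' a' a : A.Obj} (f : A.Hom (mop X) a'' a')
    (g : A.Hom (mop Y) a' a) (m : (F.val b a'').obj (op Z)) :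
    F.rmul (X := X ⊗ Y) m (A.comp g f) =
      (F.val b a).map (α_ Z X Y).inv.op (F.rmul (F.rmul m f) g) :=
  (congrArg (fun k => rightApp (X := mop Y ⊗ mop X) k m) ((F.isGradedR b).map_comp g f)).trans
    (rightApp_comp _ _ m)

theorem rmul_lmul {X Y Z : V} {b b' : B.Obj} {a' a : A.Obj} (f : B.Hom (mop X) b b')
    (g : A.Hom (mop Y) a' a) (m : (F.val b' a').obj (op Z)) :
    F.rmul (F.lmul f m) g = (F.val b a).map (α_ X Z Y).hom.op (F.lmul f (F.rmul m g)) :=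
  (isBigradedSquare_iff _ _ _ _).1 (F.square (X := X) (a := b') (a' := b) f (X' := mop Y) g) m

/-- The action `B(b, b') ⊗ F(b', a) → F(b, a)`. -/
def lact (b b' : B.Obj) (a : A.Obj) :
    RightGradedCat.homPsh.{o, w, t} B b b' ⊗ (inclPsh.{w, t} V).obj (F.val b' a) ⟶
      (inclPsh.{w, t} V).obj (F.val b a) :=
  Psh.lmk (fun {X Z} f m => F.lmul (X := X) (Z := Z) f m) (fun α β f m => F.lmul_natural α β f m)

/-- The action `F(b, a') ⊗ A(a', a) → F(b, a)`. -/
def ract (b : B.Obj) (a' a : A.Obj) :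
    (inclPsh.{w, t} V).obj (F.val b a') ⊗ RightGradedCat.homPsh.{o, w, t} A a' a ⟶
      (inclPsh.{w, t} V).obj (F.val b a) :=
  Psh.rmk (fun {X Z} m f => F.rmul (X := X) (Z := Z) m f) (fun α β f m => F.rmul_natural α β f m)

theorem lapp_lact {X Z : V} {b b' : B.Obj} {a : A.Obj} (f : B.Hom (mop X) b b')
    (m : (F.val b' a).obj (op Z)) :
    Psh.lapp (X := X) (lact.{o, w, t} F b b' a) f m = F.lmul f m :=
  Psh.lapp_lmk _ _ _ m

theorem rapp_ract {X Z : V} {b : B.Obj} {a' a : A.Obj} (m : (F.val b a').obj (op Z))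
    (f : A.Hom (mop X) a' a) :
    Psh.rapp (X := X) (ract.{o, w, t} F b a' a) m f = F.rmul m f :=
  Psh.rapp_rmk _ _ _ m

/-- This and the next four statements use the elementwise criteria in the converse direction: a
module axiom holds because it holds on generating elements, where it is a functor law or a square of
`F`. -/
theorem lact_unit (b : B.Obj) (a : A.Obj) :
    (λ_ _).inv ≫ RightGradedCat.idPsh.{o, w, t} B b ▷ _ ≫ F.lact b b a = 𝟙 _ := by
  refine Eq.trans ((Psh.lunit_iff _ _ (𝟙 (F.val b a))).2 fun {Z} m => ?_)
    ((inclPsh.{w, t} V).map_id _)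
  refine (congrArg (fun k => (F.val b a).map (λ_ Z).inv.op
    (Psh.lapp (X := 𝟙_ V) (lact.{o, w, t} F b b a) k m))
      (RightGradedCat.idPsh_app.{o, w, t} B b)).trans ?_
  refine (congrArg _ ((F.lapp_lact (X := 𝟙_ V) (B.ident b) m).trans (F.lmul_ident b m))).trans ?_
  exact map_hom_inv_apply _ _ m

theorem ract_unit (b : B.Obj) (a : A.Obj) :
    (ρ_ _).inv ≫ _ ◁ RightGradedCat.idPsh.{o, w, t} A a ≫ F.ract b a a = 𝟙 _ := by
  refine Eq.trans ((Psh.runit_iff _ _ (𝟙 (F.val b a))).2 fun {Z} m => ?_)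
    ((inclPsh.{w, t} V).map_id _)
  refine (congrArg (fun k => (F.val b a).map (ρ_ Z).inv.op
    (Psh.rapp (X := 𝟙_ V) (ract.{o, w, t} F b a a) m k))
      (RightGradedCat.idPsh_app.{o, w, t} A a)).trans ?_
  refine (congrArg _ ((F.rapp_ract (X := 𝟙_ V) m (A.ident a)).trans (F.rmul_ident a m))).trans ?_
  exact map_hom_inv_apply _ _ m

theorem lact_assoc (b b' b'' : B.Obj) (a : A.Obj) :
    RightGradedCat.compPsh.{o, w, t} B b b' b'' ▷ _ ≫ lact.{o, w, t} F b b'' a =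
      (α_ _ _ _).hom ≫ RightGradedCat.homPsh.{o, w, t} B b b' ◁ lact.{o, w, t} F b' b'' a ≫
        lact.{o, w, t} F b b' a := by
  have e := Psh.lassoc_iff (P := F.val b'' a) (Q := F.val b' a) (R := F.val b a)
    (RightGradedCat.compPsh.{o, w, t} B b b' b'') (lact.{o, w, t} F b b'' a)
    (lact.{o, w, t} F b' b'' a) (lact.{o, w, t} F b b' a)
  refine e.2 ?_
  intro X Y Z f g m
  refine (congrArg (fun k => Psh.lapp (X := X ⊗ Y) (lact.{o, w, t} F b b'' a) k m)
    (RightGradedCat.compPsh_app.{o, w, t} B (x := op X) (y := op Y) f g)).trans ?_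
  refine (F.lapp_lact (X := X ⊗ Y) (B.comp (X := mop X) (Y := mop Y) g f) m).trans ?_
  refine (F.lmul_comp f g m).trans (congrArg _ ?_)
  exact ((F.lapp_lact f _).trans (congrArg (fun k => F.lmul f k) (F.lapp_lact g m))).symm

theorem ract_assoc (b : B.Obj) (a'' a' a : A.Obj) :
    _ ◁ RightGradedCat.compPsh.{o, w, t} A a'' a' a ≫ ract.{o, w, t} F b a'' a =
      (α_ _ _ _).inv ≫ ract.{o, w, t} F b a'' a' ▷ RightGradedCat.homPsh.{o, w, t} A a' a ≫
        ract.{o, w, t} F b a' a := by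
  have e := Psh.rassoc_iff (P := F.val b a'') (Q := F.val b a') (R := F.val b a)
    (RightGradedCat.compPsh.{o, w, t} A a'' a' a) (ract.{o, w, t} F b a'' a)
    (ract.{o, w, t} F b a'' a') (ract.{o, w, t} F b a' a)
  refine e.2 ?_
  intro X Y Z f g m
  refine (congrArg (fun k => Psh.rapp (X := X ⊗ Y) (ract.{o, w, t} F b a'' a) m k)
    (RightGradedCat.compPsh_app.{o, w, t} A (x := op X) (y := op Y) f g)).trans ?_
  refine (F.rapp_ract (X := X ⊗ Y) m (A.comp (X := mop X) (Y := mop Y) g f)).trans ?_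
  refine (F.rmul_comp f g m).trans (congrArg _ ?_)
  exact ((F.rapp_ract _ g).trans (congrArg (fun k => F.rmul k g) (F.rapp_ract m f))).symm

theorem lact_ract (b b' : B.Obj) (a' a : A.Obj) :
    lact.{o, w, t} F b b' a' ▷ RightGradedCat.homPsh.{o, w, t} A a' a ≫ ract.{o, w, t} F b a' a =
      (α_ _ _ _).hom ≫ RightGradedCat.homPsh.{o, w, t} B b b' ◁ ract.{o, w, t} F b' a' a ≫
        lact.{o, w, t} F b b' a := by
  have e := Psh.lrassoc_iff (P := F.val b' a') (Q := F.val b a') (R := F.val b a)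
    (P' := F.val b' a) (lact.{o, w, t} F b b' a') (ract.{o, w, t} F b a' a)
    (ract.{o, w, t} F b' a' a) (lact.{o, w, t} F b b' a)
  refine e.2 ?_
  intro X Y Z f g m
  refine (F.rapp_ract _ g).trans ((congrArg (fun k => F.rmul k g) (F.lapp_lact f m)).trans ?_)
  refine (F.rmul_lmul f g m).trans (congrArg _ ?_)
  exact ((F.lapp_lact f _).trans (congrArg (fun k => F.lmul f k) (F.rapp_ract m g))).symm

end GradedBifunctor

end ModuleOfBifunctor

/-! ### The isomorphism between modules and graded bifunctors -/

section ModuleBifunctorIso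

variable {V : Type w} [SmallCategory V] [MonoidalCategory V]
variable {A B : RightGradedCat.{o, max w t} V}

/-- A module between right `V`-graded categories, in terms of their hom-presheaves. -/
def RightModule.mk (obj : B.Obj → A.Obj → Vᵒᵖ ⥤ Type w)
    (lact : ∀ (b b' : B.Obj) (a : A.Obj), RightGradedCat.homPsh.{o, w, t} B b b' ⊗
      (inclPsh.{w, t} V).obj (obj b' a) ⟶ (inclPsh.{w, t} V).obj (obj b a))
    (ract : ∀ (b : B.Obj) (a' a : A.Obj), (inclPsh.{w, t} V).obj (obj b a') ⊗
      RightGradedCat.homPsh.{o, w, t} A a' a ⟶ (inclPsh.{w, t} V).obj (obj b a))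
    (lact_unit : ∀ (b : B.Obj) (a : A.Obj),
      (λ_ _).inv ≫ RightGradedCat.idPsh.{o, w, t} B b ▷ _ ≫ lact b b a = 𝟙 _)
    (lact_assoc : ∀ (b b' b'' : B.Obj) (a : A.Obj),
      RightGradedCat.compPsh.{o, w, t} B b b' b'' ▷ _ ≫ lact b b'' a =
        (α_ _ _ _).hom ≫ RightGradedCat.homPsh.{o, w, t} B b b' ◁ lact b' b'' a ≫ lact b b' a)
    (ract_unit : ∀ (b : B.Obj) (a : A.Obj),
      (ρ_ _).inv ≫ _ ◁ RightGradedCat.idPsh.{o, w, t} A a ≫ ract b a a = 𝟙 _)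
    (ract_assoc : ∀ (b : B.Obj) (a'' a' a : A.Obj),
      _ ◁ RightGradedCat.compPsh.{o, w, t} A a'' a' a ≫ ract b a'' a =
        (α_ _ _ _).inv ≫ ract b a'' a' ▷ RightGradedCat.homPsh.{o, w, t} A a' a ≫ ract b a' a)
    (lact_ract : ∀ (b b' : B.Obj) (a' a : A.Obj),
      lact b b' a' ▷ RightGradedCat.homPsh.{o, w, t} A a' a ≫ ract b a' a =
        (α_ _ _ _).hom ≫ RightGradedCat.homPsh.{o, w, t} B b b' ◁ ract b' a' a ≫ lact b b' a) :
    RightModule.{o, w, t} A B :=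
  EnrModule.mk obj lact ract lact_unit lact_assoc ract_unit ract_assoc lact_ract

/-- Once the presheaves agree by definition, a module is determined by its two actions. -/
theorem RightModule.mk_congr {obj : B.Obj → A.Obj → Vᵒᵖ ⥤ Type w}
    {lact lact' : ∀ (b b' : B.Obj) (a : A.Obj), RightGradedCat.homPsh.{o, w, t} B b b' ⊗
      (inclPsh.{w, t} V).obj (obj b' a) ⟶ (inclPsh.{w, t} V).obj (obj b a)}
    {ract ract' : ∀ (b : B.Obj) (a' a : A.Obj), (inclPsh.{w, t} V).obj (obj b a') ⊗
      RightGradedCat.homPsh.{o, w, t} A a' a ⟶ (inclPsh.{w, t} V).obj (obj b a)}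
    (hl : lact = lact') (hr : ract = ract') (h₁ h₂ h₃ h₄ h₅ h₁' h₂' h₃' h₄' h₅') :
    RightModule.mk.{o, w, t} obj lact ract h₁ h₂ h₃ h₄ h₅ =
      RightModule.mk obj lact' ract' h₁' h₂' h₃' h₄' h₅' := by
  subst hl hr
  rfl

namespace GradedBifunctor

variable (F : GradedBifunctor (RightGradedCat.formalOp B) A (presheaves V))

/-- The module `A ⇸ B` corresponding to a graded bifunctor `B°, A → V̂`. -/
def toModule : RightModule.{o, w, t} A B := by
  refine RightModule.mk.{o, w, t} (fun b a => F.val b a) (lact.{o, w, t} F) (ract.{o, w, t} F)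
    ?_ ?_ ?_ ?_ ?_
  · have e := lact_unit.{o, w, t} F
    with_reducible exact e
  · have e := lact_assoc.{o, w, t} F
    with_reducible exact e
  · have e := ract_unit.{o, w, t} F
    with_reducible exact e
  · have e := ract_assoc.{o, w, t} F
    with_reducible exact e
  · have e := lact_ract.{o, w, t} F
    with_reducible exact e

/-- Transformations between equal graded bifunctors that have the same components. -/
theorem Transformation.heq {W : Type u'} [Category.{v'} W] [MonoidalCategory W]
    {V : Type u} [Category.{v} V] [MonoidalCategory V]
    {A : GradedCat.{o, h} V} {B : RightGradedCat.{o', h'} W} {C : BigradedCat.{o'', p} V W}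
    {F F' G G' : GradedBifunctor A B C}
    (hF : F = F') (hG : G = G') {θ : Transformation F G} {θ' : Transformation F' G'}
    (h : HEq θ.app θ'.app) : HEq θ θ' := by
  subst hF hG
  exact heq_of_eq (Transformation.ext (eq_of_heq h))

end GradedBifunctor

/-- Both morphisms correspond to the same bilinear map, as `leftApp` undoes `leftMk`. -/
theorem RightModule.lact_toBifunctor (M : RightModule.{o, w, t} A B) (b b' : B.Obj) (a : A.Obj) :
    GradedBifunctor.lact.{o, w, t} M.toBifunctor b b' a = M.lactPsh b b' a :=
  Psh.lapp_ext fun f m => (GradedBifunctor.lapp_lact M.toBifunctor f m).trans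
    (M.leftApp_leftHom a f m)

theorem RightModule.ract_toBifunctor (M : RightModule.{o, w, t} A B) (b : B.Obj) (a' a : A.Obj) :
    GradedBifunctor.ract.{o, w, t} M.toBifunctor b a' a = M.ractPsh b a' a :=
  Psh.rapp_ext fun f m => (GradedBifunctor.rapp_ract M.toBifunctor m f).trans
    (M.rightApp_rightHom (X := mop _) b f m)

end ModuleBifunctorIso

/-! ### The bijection between modules and graded bifunctors. -/

section ModuleBijection
variable {V : Type w} [SmallCategory V] [MonoidalCategory V]
variable {A B : RightGradedCat.{o, max w t} V}

namespace GradedBifunctor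

variable (F : GradedBifunctor (RightGradedCat.formalOp B) A (presheaves V))

theorem lmul_toModule {X Z : V} {b b' : B.Obj} {a : A.Obj} (f : B.Hom (mop X) b b')
    (m : (F.val b' a).obj (op Z)) :
    RightModule.lmul (toModule.{o, w, t} F) f m = F.lmul f m := by
  have e := lapp_lact.{o, w, t} F f m
  exact e

theorem rmul_toModule {X Z : V} {b : B.Obj} {a' a : A.Obj} (m : (F.val b a').obj (op Z))
    (f : A.Hom (mop X) a' a) :
    RightModule.rmul (toModule.{o, w, t} F) m f = F.rmul m f := by
  have e := rapp_ract.{o, w, t} F m f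
  exact e

theorem leftHom_toModule {X : V} {b b' : B.Obj} {a : A.Obj} (f : B.Hom (mop X) b b') :
    RightModule.leftHom (toModule.{o, w, t} F) a f = F.mapL a f :=
  leftApp_ext fun m =>
    (RightModule.leftApp_leftHom (toModule.{o, w, t} F) a f m).trans (F.lmul_toModule f m)

theorem rightHom_toModule {X : Vᴹᵒᵖ} {b : B.Obj} {a' a : A.Obj} (f : A.Hom X a' a) :
    RightModule.rightHom (toModule.{o, w, t} F) b f = F.mapR b f :=
  rightApp_ext fun m =>
    (RightModule.rightApp_rightHom (toModule.{o, w, t} F) b f m).trans (F.rmul_toModule m f)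

theorem toBifunctor_toModule : RightModule.toBifunctor (toModule.{o, w, t} F) = F :=
  ext_map (A := RightGradedCat.formalOp B) (C := presheaves V) (obj := fun b a => F.val b a)
    (mapL := fun a {X : V} {b b' : B.Obj} f => RightModule.leftHom (toModule.{o, w, t} F) (X := X) (b := b')
      (b' := b) a f)
    (mapL' := fun a {X : V} {b b' : B.Obj} f => F.mapL a f)
    (mapR := fun b {X a a'} f => RightModule.rightHom (toModule.{o, w, t} F) (X := X) b f)
    (mapR' := fun b {X a a'} f => F.mapR b f)
    (fun a _ _ _ f => F.leftHom_toModule f) (fun b _ _ _ f => F.rightHom_toModule f)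
    _ _ _ F.isGradedL F.isGradedR F.square

end GradedBifunctor

theorem RightModule.toModule_toBifunctor (M : RightModule.{o, w, t} A B) :
    GradedBifunctor.toModule.{o, w, t} M.toBifunctor = M := by
  have h₁ : GradedBifunctor.lact.{o, w, t} M.toBifunctor = M.lactPsh :=
    funext fun b => funext fun b' => funext fun a => M.lact_toBifunctor b b' a
  have h₂ : GradedBifunctor.ract.{o, w, t} M.toBifunctor = M.ractPsh :=
    funext fun b => funext fun a' => funext fun a => M.ract_toBifunctor b a' a
  exact RightModule.mk_congr (obj := fun b a => M.val b a) (lact' := M.lactPsh)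
    (ract' := M.ractPsh) h₁ h₂ _ _ _ _ _ M.lact_unit M.lact_assoc M.ract_unit M.ract_assoc M.lact_ract
end ModuleBijection

/-! ### Transformations of modules and transformations of graded bifunctors. -/

section ModuleBifunctorIso

variable {V : Type w} [SmallCategory V] [MonoidalCategory V]
variable {A B : RightGradedCat.{o, max w t} V}

namespace RightModule

theorem lact_natural_iff (M N : RightModule.{o, w, t} A B) (b b' : B.Obj) (a : A.Obj)
    (s : M.val b' a ⟶ N.val b' a) (t : M.val b a ⟶ N.val b a) :
    M.lactPsh b b' a ≫ (inclPsh.{w, t} V).map t = _ ◁ (inclPsh.{w, t} V).map s ≫ N.lactPsh b b' a ↔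
      ∀ {X Z : V} (f : B.Hom (mop X) b b') (m : (M.val b' a).obj (op Z)),
        t.app _ (M.lmul f m) = N.lmul f (s.app _ m) := by
  refine ⟨fun h X Z f m => ?_, fun h => Psh.lapp_ext fun {X Z} f m => ?_⟩
  · exact (Psh.lapp_comp_map (X := X) (M.lactPsh b b' a) t f m).symm.trans
      ((congrArg (fun l => Psh.lapp (X := X) l f m) h).trans
        (Psh.lapp_whiskerLeft_map_comp (X := X) s (N.lactPsh b b' a) f m))
  · exact (Psh.lapp_comp_map (X := X) (M.lactPsh b b' a) t f m).trans
      ((h f m).trans (Psh.lapp_whiskerLeft_map_comp (X := X) s (N.lactPsh b b' a) f m).symm)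

theorem ract_natural_iff (M N : RightModule.{o, w, t} A B) (b : B.Obj) (a' a : A.Obj)
    (s : M.val b a' ⟶ N.val b a') (t : M.val b a ⟶ N.val b a) :
    M.ractPsh b a' a ≫ (inclPsh.{w, t} V).map t = (inclPsh.{w, t} V).map s ▷ _ ≫ N.ractPsh b a' a ↔
      ∀ {X Z : V} (f : A.Hom (mop X) a' a) (m : (M.val b a').obj (op Z)),
        t.app _ (M.rmul m f) = N.rmul (s.app _ m) f := by
  refine ⟨fun h X Z f m => ?_, fun h => Psh.rapp_ext fun {X Z} f m => ?_⟩
  · exact (Psh.rapp_comp_map (X := X) (M.ractPsh b a' a) t f m).symm.trans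
      ((congrArg (fun l => Psh.rapp (X := X) l m f) h).trans
        (Psh.rapp_map_whiskerRight_comp (X := X) s (N.ractPsh b a' a) f m))
  · exact (Psh.rapp_comp_map (X := X) (M.ractPsh b a' a) t f m).trans
      ((h f m).trans (Psh.rapp_map_whiskerRight_comp (X := X) s (N.ractPsh b a' a) f m).symm)

/-- Both conditions unfold to the same equation on elements, that `s` commutes with the action of
every graded morphism of `B`; this gives well-definedness on transformations and fullness at once.
-/
theorem isGradedNatural_leftHom_iff (M N : RightModule.{o, w, t} A B) (a : A.Obj)
    (s : ∀ b, M.val b a ⟶ N.val b a) :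
    IsGradedNatural (RightGradedCat.formalOp B) (presheaves V).left
        (fun f => M.leftHom a f) (fun f => N.leftHom a f) (fun b => ofHom (s b)) ↔
      ∀ b b' : B.Obj, M.lactPsh b b' a ≫ (inclPsh.{w, t} V).map (s b) =
        _ ◁ (inclPsh.{w, t} V).map (s b') ≫ N.lactPsh b b' a := by
  refine ⟨fun h b b' => (lact_natural_iff M N b b' a _ _).2 fun {X Z} f m => ?_,
    fun h X b b' f => (left_natural_ofHom_iff _ _ _ _).2 fun m => ?_⟩
  · refine (congrArg _ (M.leftApp_leftHom a f m)).symm.trans ?_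
    exact ((left_natural_ofHom_iff _ _ _ _).1 (h (A := b') (B := b) f) m).trans
      (N.leftApp_leftHom a f _)
  · refine (congrArg _ (M.leftApp_leftHom a f m)).trans ?_
    exact ((lact_natural_iff M N b' b a _ _).1 (h b' b) f m).trans (N.leftApp_leftHom a f _).symm

theorem isGradedNatural_rightHom_iff (M N : RightModule.{o, w, t} A B) (b : B.Obj)
    (s : ∀ a, M.val b a ⟶ N.val b a) :
    IsGradedNatural A (presheaves V).right
        (fun f => M.rightHom b f) (fun f => N.rightHom b f) (fun a => ofHom (s a)) ↔
      ∀ a' a : A.Obj, M.ractPsh b a' a ≫ (inclPsh.{w, t} V).map (s a) =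
        (inclPsh.{w, t} V).map (s a') ▷ _ ≫ N.ractPsh b a' a := by
  refine ⟨fun h a' a => (ract_natural_iff M N b a' a _ _).2 fun {X Z} f m => ?_,
    fun h X a' a f => (right_natural_ofHom_iff _ _ _ _).2 fun m => ?_⟩
  · refine (congrArg _ (M.rightApp_rightHom (X := mop X) b f m)).symm.trans ?_
    exact ((right_natural_ofHom_iff _ _ _ _).1 (h f) m).trans
      (N.rightApp_rightHom (X := mop X) b f _)
  · refine (congrArg _ (M.rightApp_rightHom b f m)).trans ?_
    exact ((ract_natural_iff M N b a' a _ _).1 (h a' a) f m).trans (N.rightApp_rightHom b f _).symm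

/-- The transformation of graded bifunctors corresponding to a transformation of modules. -/
def toBifunctorMap {M N : RightModule.{o, w, t} A B} (θ : EnrModule.Transformation M N) :
    GradedBifunctor.Transformation M.toBifunctor N.toBifunctor where
  app b a := ofHom (P := M.val b a) (Q := N.val b a) (θ.app b a)
  naturalL a := (isGradedNatural_leftHom_iff M N a (fun b => θ.app b a)).2
    fun b b' => θ.lact b b' a
  naturalR b := (isGradedNatural_rightHom_iff M N b (fun a => θ.app b a)).2
    fun a' a => θ.ract b a' a

theorem lact_toHom {M N : RightModule.{o, w, t} A B}
    (κ : GradedBifunctor.Transformation M.toBifunctor N.toBifunctor) (b b' : B.Obj) (a : A.Obj) :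
    M.lactPsh b b' a ≫
        (inclPsh.{w, t} V).map (toHom (P := M.val b a) (Q := N.val b a) (κ.app b a)) =
      _ ◁ (inclPsh.{w, t} V).map (toHom (P := M.val b' a) (Q := N.val b' a) (κ.app b' a)) ≫
        N.lactPsh b b' a := by
  have e : (fun b => ofHom (toHom (P := M.val b a) (Q := N.val b a) (κ.app b a))) =
    fun b => κ.app b a := funext fun b => ofHom_toHom _
  -- The criterion speaks about families of the form `ofHom (s b)`, so naturality of `κ` is
  -- transported along the equality of whole families.
  have h₀ := congrArg (fun app : ∀ b : B.Obj,
    (presheaves V).left.Hom (𝟙_ V) (M.val b a) (N.val b a) =>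
      IsGradedNatural (RightGradedCat.formalOp B) (presheaves V).left
        (fun f => M.leftHom a f) (fun f => N.leftHom a f) app) e
  have h := h₀.mpr
  exact (isGradedNatural_leftHom_iff M N a _).1 (h (κ.naturalL a)) b b'

theorem ract_toHom {M N : RightModule.{o, w, t} A B}
    (κ : GradedBifunctor.Transformation M.toBifunctor N.toBifunctor) (b : B.Obj) (a' a : A.Obj) :
    M.ractPsh b a' a ≫
        (inclPsh.{w, t} V).map (toHom (P := M.val b a) (Q := N.val b a) (κ.app b a)) =
      (inclPsh.{w, t} V).map (toHom (P := M.val b a') (Q := N.val b a') (κ.app b a')) ▷ _ ≫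
        N.ractPsh b a' a := by
  have e : (fun a => ofHom (toHom (P := M.val b a) (Q := N.val b a) (κ.app b a))) =
    fun a => κ.app b a := funext fun a => ofHom_toHom _
  have h₀ := congrArg (fun app : ∀ a : A.Obj,
    (presheaves V).right.Hom (𝟙_ Vᴹᵒᵖ) (M.val b a) (N.val b a) =>
      IsGradedNatural A (presheaves V).right
        (fun f => M.rightHom b f) (fun f => N.rightHom b f) app) e
  have h := h₀.mpr
  exact (isGradedNatural_rightHom_iff M N b _).1 (h (κ.naturalR b)) a' a

/-- The transformation of modules corresponding to a transformation of graded bifunctors. -/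
def ofBifunctorMap {M N : RightModule.{o, w, t} A B}
    (κ : GradedBifunctor.Transformation M.toBifunctor N.toBifunctor) :
    EnrModule.Transformation M N where
  app b a := toHom (P := M.val b a) (Q := N.val b a) (κ.app b a)
  lact b b' a := lact_toHom κ b b' a
  ract b a' a := ract_toHom κ b a' a

variable (A B) in
/-- The functor `GMOD_V(A, B) → GBIF(B°, A; V̂)`. -/
def toBifunctorFunctor :
    RightModule.{o, w, t} A B ⥤ GradedBifunctor (RightGradedCat.formalOp B) A (presheaves V) where
  obj M := M.toBifunctor
  map {M N} (θ : EnrModule.Transformation M N) := toBifunctorMap θ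
  map_id M := GradedBifunctor.Transformation.ext (funext₂ fun b a => ofHom_id)
  map_comp {M N L} (θ : EnrModule.Transformation M N) (κ : EnrModule.Transformation N L) :=
    GradedBifunctor.Transformation.ext (funext₂ fun b a => ofHom_comp (θ.app b a) (κ.app b a))

instance : (toBifunctorFunctor.{o, w, t} A B).Faithful where
  map_injective {M N} θ κ h := EnrModule.Transformation.ext (funext₂ fun b a =>
    ofHom_injective (congrFun₂ (congrArg GradedBifunctor.Transformation.app h) b a))

instance : (toBifunctorFunctor.{o, w, t} A B).Full where
  map_surjective {M N} κ := ⟨ofBifunctorMap κ, GradedBifunctor.Transformation.ext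
    (funext₂ fun b a => ofHom_toHom _)⟩

end RightModule

end ModuleBifunctorIso

/-! ### 2-naturality -/

section ModuleBifunctorNatural

variable {V : Type w} [SmallCategory V] [MonoidalCategory V]
variable {A B A' B' : RightGradedCat.{o, max w t} V}

namespace RightModule

variable (M : RightModule.{o, w, t} A B) (F : GradedFunctor A' A) (G : GradedFunctor B' B)

/-- The module `M(G, F)`. -/
abbrev restr : RightModule.{o, w, t} A' B' :=
  EnrModule.restrict M (GradedFunctor.enriched.{o, w, t} F) (GradedFunctor.enriched.{o, w, t} G)

theorem lmul_restr {X Z : V} {b b' : B'.Obj} {a : A'.Obj} (f : B'.Hom (mop X) b b')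
    (m : (M.val (G.obj b') (F.obj a)).obj (op Z)) :
    (M.restr F G).lmul f m = M.lmul (G.map f) m := by
  have e := Psh.lapp_whiskerRight_comp (X := X) ((GradedFunctor.enriched.{o, w, t} G).map b b')
    (M.lactPsh (G.obj b) (G.obj b') (F.obj a)) f m
  exact e

theorem rmul_restr {X Z : V} {b : B'.Obj} {a' a : A'.Obj}
    (m : (M.val (G.obj b) (F.obj a')).obj (op Z)) (f : A'.Hom (mop X) a' a) :
    (M.restr F G).rmul m f = M.rmul m (F.map f) := by
  have e := Psh.rapp_whiskerLeft_comp (X := X) ((GradedFunctor.enriched.{o, w, t} F).map a' a)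
    (M.ractPsh (G.obj b) (F.obj a') (F.obj a)) f m
  exact e

theorem leftHom_restr {X : V} {b b' : B'.Obj} (a : A'.Obj) (f : B'.Hom (mop X) b b') :
    (M.restr F G).leftHom a f = M.leftHom (F.obj a) (G.map f) :=
  leftApp_ext fun m => ((M.restr F G).leftApp_leftHom a f m).trans
    ((M.lmul_restr F G f m).trans (M.leftApp_leftHom (F.obj a) (G.map f) m).symm)

theorem rightHom_restr {X : Vᴹᵒᵖ} (b : B'.Obj) {a' a : A'.Obj} (f : A'.Hom X a' a) :
    (M.restr F G).rightHom b f = M.rightHom (G.obj b) (F.map f) :=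
  rightApp_ext fun m => ((M.restr F G).rightApp_rightHom b f m).trans
    ((M.rmul_restr F G m f).trans (M.rightApp_rightHom (G.obj b) (F.map f) m).symm)

/-- The presheaves agree by definition, and an element of a restricted module is acted on through
the image of the graded morphism, as in the restricted bifunctor. -/
theorem toBifunctor_restr :
    (M.restr F G).toBifunctor = M.toBifunctor.restrict G.rightFormalOp F :=
  GradedBifunctor.ext_map (A := RightGradedCat.formalOp B') (C := presheaves V)
    (obj := fun b a => M.val (G.obj b) (F.obj a))
    (mapL := fun a {X : V} {b b' : B'.Obj} f => (M.restr F G).leftHom (X := X) (b := b') (b' := b) a f)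
    (mapL' := fun a {X : V} {b b' : B'.Obj} f => M.leftHom (F.obj a) (G.map f))
    (mapR := fun b {X a a'} f => (M.restr F G).rightHom (X := X) b f)
    (mapR' := fun b {X a a'} f => M.rightHom (G.obj b) (F.map f))
    (fun a _ _ _ f => M.leftHom_restr F G a f) (fun b _ _ _ f => M.rightHom_restr F G b f)
    (M.restr F G).toBifunctor.isGradedL (M.restr F G).toBifunctor.isGradedR
    (M.restr F G).toBifunctor.square (M.toBifunctor.restrict G.rightFormalOp F).isGradedL
    (M.toBifunctor.restrict G.rightFormalOp F).isGradedR
    (M.toBifunctor.restrict G.rightFormalOp F).square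

/-- A morphism out of the unit presheaf amounts to its value at `nu`, so the action of the
generalized element `y` is the action of an honest graded morphism of grade `I`. The map `s` is only
specified through its image, because the components of `map₂` are preimages under `inclPsh`. -/
theorem ofHom_lelt {b b' : B.Obj} (a : A.Obj)
    (y : 𝟙_ (Psh.{w, t} V) ⟶ RightGradedCat.homPsh.{o, w, t} B b b')
    (s : M.val b' a ⟶ M.val b a)
    (hs : (inclPsh.{w, t} V).map s = (λ_ _).inv ≫ y ▷ _ ≫ M.lactPsh b b' a) :
    ofHom s = M.leftHom (X := 𝟙_ V) a (y.natTrans.app (op (𝟙_ V)) (Psh.nu V)) :=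
  leftApp_ext (X := 𝟙_ V) fun {Z} m => by
    refine (leftApp_ofHom s m).trans ?_
    refine (congrArg _ ((Psh.lunit_iff y (M.lactPsh b b' a) s).1 hs.symm m)).symm.trans ?_
    refine (map_hom_inv_apply _ (λ_ Z).symm _).trans ?_
    exact (M.leftApp_leftHom (X := 𝟙_ V) a _ m).symm

theorem ofHom_relt (b : B.Obj) {a' a : A.Obj}
    (x : 𝟙_ (Psh.{w, t} V) ⟶ RightGradedCat.homPsh.{o, w, t} A a' a)
    (s : M.val b a' ⟶ M.val b a)
    (hs : (inclPsh.{w, t} V).map s = (ρ_ _).inv ≫ _ ◁ x ≫ M.ractPsh b a' a) :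
    ofHom s = M.rightHom (X := 𝟙_ Vᴹᵒᵖ) b (x.natTrans.app (op (𝟙_ V)) (Psh.nu V)) :=
  rightApp_ext (X := 𝟙_ Vᴹᵒᵖ) fun {Z} m => by
    refine (rightApp_ofHom s m).trans ?_
    refine (congrArg _ ((Psh.runit_iff x (M.ractPsh b a' a) s).1 hs.symm m)).symm.trans ?_
    refine (map_hom_inv_apply _ (ρ_ Z).symm _).trans ?_
    exact (M.rightApp_rightHom (X := 𝟙_ Vᴹᵒᵖ) b _ m).symm

variable {F G} {F' : GradedFunctor A' A} {G' : GradedFunctor B' B}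

theorem enriched_app (φ : GradedNat F F') (a : A'.Obj) :
    ((GradedNat.enriched.{o, w, t} φ).app a).natTrans.app (op (𝟙_ V)) (Psh.nu V) = φ.app a :=
  Psh.unitDesc_app _

/-- This is 2-naturality in 2-cells: on both sides `ψ` acts first, from the left, and then `φ` from
the right, so the composites match factor by factor. -/
theorem ofHom_map₂_app (φ : GradedNat F F') (ψ : GradedNat G' G) (b : B'.Obj) (a : A'.Obj) :
    ofHom (P := M.val (G.obj b) (F.obj a)) (Q := M.val (G'.obj b) (F'.obj a))
        (EnrModule.Transformation.app ((EnrModule.map₂ (inclPsh.{w, t} V)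
          (GradedNat.enriched.{o, w, t} φ) (GradedNat.enriched.{o, w, t} ψ)).app M) b a) =
      (presheaves V).comp₀ (M.rightHom (X := 𝟙_ Vᴹᵒᵖ) (G'.obj b) (φ.app a))
        (M.leftHom (X := 𝟙_ V) (F.obj a) (ψ.app b)) := by
  have e₁ := M.ofHom_lelt (F.obj a) ((GradedNat.enriched.{o, w, t} ψ).app b) _
    ((inclPsh.{w, t} V).map_preimage (EnrModule.lelt M ((GradedNat.enriched.{o, w, t} ψ).app b)
      (F.obj a)))
  have e₂ := M.ofHom_relt (G'.obj b) ((GradedNat.enriched.{o, w, t} φ).app a) _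
    ((inclPsh.{w, t} V).map_preimage (EnrModule.relt M (G'.obj b)
      ((GradedNat.enriched.{o, w, t} φ).app a)))
  refine (ofHom_comp _ _).trans (congrArg₂ (fun g f => (presheaves V).comp₀ g f)
    (e₂.trans (congrArg (fun k => M.rightHom (X := 𝟙_ Vᴹᵒᵖ) (G'.obj b) k) (enriched_app φ a)))
    (e₁.trans (congrArg (fun k => M.leftHom (X := 𝟙_ V) (F.obj a) k) (enriched_app ψ b))))

end RightModule

end ModuleBifunctorNatural

/-! ### The 2-natural isomorphism for right graded categories. -/

section

variable (V : Type w) [SmallCategory V] [MonoidalCategory V]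

/-- On transformations the components on both sides are identical; only the source and target
bifunctors differ, by the equality `toBifunctor_restr`. -/
theorem toBifunctorFunctor_natural {A A' B B' : RightGradedCat.{o, max w t} V}
    (F : GradedFunctor A' A) (G : GradedFunctor B' B) :
    (gmodRight.{o, w, t} V).map F G ⋙ RightModule.toBifunctorFunctor.{o, w, t} A' B' =
      RightModule.toBifunctorFunctor.{o, w, t} A B ⋙ (gbifRight V).map F G :=
  CategoryTheory.Functor.hext (fun M => RightModule.toBifunctor_restr M F G) fun M N θ =>
    GradedBifunctor.Transformation.heq (RightModule.toBifunctor_restr M F G)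
      (RightModule.toBifunctor_restr N F G) HEq.rfl

/-- Modules `A ⇸ B` are graded bifunctors `B°, A → V̂`, for right graded categories. -/
def gmodRightIso : TwoNatIso (gmodRight.{o, w, t} V) (gbifRight V) :=
  TwoNatIso.ofFullyFaithful
    (fun A B => RightModule.toBifunctorFunctor.{o, w, t} A B)
    (faithful := fun A B => inferInstanceAs (RightModule.toBifunctorFunctor A B).Faithful)
    (full := fun A B => inferInstanceAs (RightModule.toBifunctorFunctor A B).Full)
    (fun A B N => GradedBifunctor.toModule.{o, w, t} N)
    (fun A B M => RightModule.toModule_toBifunctor M)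
    (fun A B N => GradedBifunctor.toBifunctor_toModule.{o, w, t} N)
    (fun F G => toBifunctorFunctor_natural V F G)
    (fun {A A' B B' F F' G G'} φ ψ M =>
      GradedBifunctor.Transformation.heq (RightModule.toBifunctor_restr M F G)
        (RightModule.toBifunctor_restr M F' G')
        (heq_of_eq (funext₂ fun b a => RightModule.ofHom_map₂_app M φ ψ b a)))

end

end VGraded

end

theorem mainTheorem4 (V : Type w) [CategoryTheory.SmallCategory V]
    [CategoryTheory.MonoidalCategory V] :
    Nonempty (VGraded.TwoNatIso (VGraded.gmodRight.{o, w, t} V) (VGraded.gbifRight V)) ∧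
    Nonempty (VGraded.TwoNatIso (VGraded.gmodLeft.{o, w, t} V) (VGraded.gbifLeft V)) ∧
    Nonempty (VGraded.TwoNatIso (VGraded.gmodRight.{o, w, t} V) (VGraded.gcatRight V)) ∧
    Nonempty (VGraded.TwoNatIso (VGraded.gmodLeft.{o, w, t} V) (VGraded.gcatLeft V)) :=
  ⟨⟨VGraded.gmodRightIso V⟩,
    -- Substituting `(B°, A°)` for `(A, B)` in `GBIF(B°, A; V̂)` gives `GBIF(A°°, B°; V̂)`, and
    -- `A°°` is `A` by definition. The last component uses the same fact for `A ⊠ B°`.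
    ⟨(VGraded.gmodLeftIso V).trans (VGraded.gmodRightIso V).formalOp⟩,
    ⟨(VGraded.gmodRightIso V).trans (VGraded.gbifRightIso V)⟩,
    ⟨(VGraded.gmodLeftIso V).trans
      ((VGraded.gmodRightIso V).trans (VGraded.gbifRightIso V)).formalOp⟩⟩
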